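/- For $N\ge 0$ let $\mathcal C_N=\mathbb C[x_1,\dots,x_N]/(x_1^2-x_1,\dots,x_N^2-x_N)$, with the action of the symmetric group $\Sigma_N$ given by $(\sigma\circ f)(x_1,\dots,x_N)=f(x_{\sigma(1)},\dots,x_{\sigma(N)})$. For a finite system $\mathcal F=\{f_1,\dots,f_K\}\subset\mathcal C_N$ put $$\mathcal F_\sigma=\{\sigma\circ f_1,\dots,\sigma\circ f_K\},\qquad \mathrm{Stab}(\mathcal F)=\{\sigma\in\Sigma_N:\mathcal F_\sigma=\mathcal F\},$$ $$Z(\mathcal F)=\{x\in\{0,1\}^N: f_k(x)=0\text{ for } 1\le k\le K\}.$$ Systems are presented to a Turing machine as follows. Fix a sequence $\theta_0,\theta_1,\dots$ of complex numbers that is linearly independent over $\mathbb Q$; a coefficient is presented by a finite list of rational numbers $(q_0,\dots,q_{m-1})$, in binary, and denotes $\sum_j q_j\theta_j$. (For $\theta_0=1,\theta_1=i$ these include all Gaussian rationals, and every countable set of complex numbers lies in the $\mathbb Q$-span of such a sequence.) A term is a coefficient together with a square-free monomial, written as a $0/1$ vector of length $N$; a polynomial is a finite list of terms and denotes the class in $\mathcal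 C_N$ of their sum; a system is $N$, in unary, together with a finite list of polynomials. The numbers $N$ and $K$ and the bound $n$ on the number of terms of each polynomial are part of the input and arbitrary, and running times are measured in the length of the input. **Theorem.** For every such sequence $\theta$ and every constant $c_0\in\mathbb N$, the following decision problem is in co-NP: given a presented system $\mathcal F$, decide whether $$|\Sigma_N\smallsetminus\mathrm{Stab}(\mathcal F)|\le c_0\quad\text{and}\quad Z(\mathcal F)\ne\emptyset .$$ In particular, for systems $\mathcal F$ with $|\Sigma_N\smallsetminus\mathrm{Stab}(\mathcal F)|\le c_0$, the problem of deciding whether $Z(\mathcal F)$ is non-empty is in co-NP. -/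

import Mathlib

/-! ### NP and co-NP over Mathlib's polynomial-time (multi-stack) Turing machines -/

/-- The decision problem "given an instance `x : α`, is `x ∈ Q`?", whose instances are written
as strings through `e`, is in NP: there are a polynomial-time verifier `V` and a polynomial `p`
such that `x ∈ Q` exactly when `V` accepts `x` with some certificate `w` of length at most
`p` of the length of `x`. -/
def InNP {α Γ : Type} (e : Computability.Encoding α Γ) (Q : Set α) : Prop :=
  ∃ (p : Polynomial ℕ) (V : α × List Bool → Bool),
    Nonempty (Turing.TM2ComputableInPolyTime
      (Computability.encodingProd e (Computability.encodingList Bool)).encode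
      Computability.encodingBoolBool.encode V) ∧
    ∀ x : α, x ∈ Q ↔
      ∃ w : List Bool, w.length ≤ p.eval (e.encode x).length ∧ V (x, w) = true

/-- The decision problem `Q` is in co-NP: its complementary problem is in NP. -/
def InCoNP {α Γ : Type} (e : Computability.Encoding α Γ) (Q : Set α) : Prop :=
  InNP e Qᶜ

/-! ### Polynomials in Boolean variables -/

noncomputable section

/-- The ideal of `ℂ[x₁, …, x_N]` generated by the polynomials `xᵢ² - xᵢ`. -/
def boolIdeal (N : ℕ) : Ideal (MvPolynomial (Fin N) ℂ) :=
  Ideal.span (Set.range fun i : Fin N => MvPolynomial.X i ^ 2 - MvPolynomial.X i)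

/-- The ring `ℂ[x₁, …, x_N] / (xᵢ² - xᵢ)`. -/
abbrev BoolVarRing (N : ℕ) : Type := MvPolynomial (Fin N) ℂ ⧸ boolIdeal N

theorem boolIdeal_le_comap_rename {N : ℕ} (σ : Equiv.Perm (Fin N)) :
    boolIdeal N ≤ (boolIdeal N).comap (MvPolynomial.rename σ).toRingHom := by
  refine Ideal.span_le.mpr ?_
  rintro _ ⟨i, rfl⟩
  refine Ideal.subset_span ⟨σ i, ?_⟩
  simp

/-- The action of a permutation, `(σ ∘ f)(x₁, …, x_N) = f(x_{σ(1)}, …, x_{σ(N)})`. -/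
def permute {N : ℕ} (σ : Equiv.Perm (Fin N)) : BoolVarRing N →+* BoolVarRing N :=
  Ideal.quotientMap (boolIdeal N) (MvPolynomial.rename σ).toRingHom (boolIdeal_le_comap_rename σ)

/-- The point of `{0, 1}^N ⊆ ℂ^N` given by a Boolean vector. -/
def boolPoint {N : ℕ} (a : Fin N → Bool) : Fin N → ℂ := fun i => if a i then 1 else 0

theorem eval_boolPoint_eq_zero {N : ℕ} (a : Fin N → Bool) :
    ∀ f ∈ boolIdeal N, MvPolynomial.eval (boolPoint a) f = 0 := by
  intro f hf
  have h : boolIdeal N ≤ RingHom.ker (MvPolynomial.eval (boolPoint a)) := by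
    refine Ideal.span_le.mpr ?_
    rintro _ ⟨i, rfl⟩
    cases h : a i <;> simp [RingHom.mem_ker, boolPoint, h]
  exact h hf

/-- Evaluation of an element of `ℂ[x₁, …, x_N] / (xᵢ² - xᵢ)` at a point of `{0, 1}^N`. -/
def evalAt {N : ℕ} (a : Fin N → Bool) : BoolVarRing N →+* ℂ :=
  Ideal.Quotient.lift (boolIdeal N) (MvPolynomial.eval (boolPoint a)) (eval_boolPoint_eq_zero a)

/-- The Boolean variety `Z(F)`: the common zeros in `{0, 1}^N` of the elements of `F`. -/
def boolVariety {N : ℕ} (F : Set (BoolVarRing N)) : Set (Fin N → Bool) :=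
  {a | ∀ f ∈ F, evalAt a f = 0}

/-- `Stab(F)`: the permutations `σ` for which the permuted system `F_σ` is equal to `F`. -/
def stab {N : ℕ} (F : Set (BoolVarRing N)) : Set (Equiv.Perm (Fin N)) :=
  {σ | (fun f => permute σ f) '' F = F}

/-! ### Systems as finite inputs -/

/-- A term in `N` Boolean variables: a square-free monomial (a set of variables) with a
coefficient, which is presented by finitely many rational coordinates. -/
structure BoolTerm (N : ℕ) where
  coords : List ℚ
  vars : Finset (Fin N)

/-- A presented system: the number `N` of variables, and a finite list of polynomials, each given
as a list of terms. -/
structure BoolSystem where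
  numVars : ℕ
  polys : List (List (BoolTerm numVars))

/-- The complex number `∑ⱼ qⱼ θⱼ` with coordinates `q₀, q₁, …` along the sequence `θ`. -/
def coeffValue (θ : ℕ → ℂ) (q : List ℚ) : ℂ := ∑ j : Fin q.length, (q.get j : ℂ) * θ j

/-- The polynomial presented by a list of terms. -/
def polyValue (θ : ℕ → ℂ) {N : ℕ} (p : List (BoolTerm N)) : MvPolynomial (Fin N) ℂ :=
  (p.map fun t => MvPolynomial.C (coeffValue θ t.coords) * ∏ i ∈ t.vars, MvPolynomial.X i).sum

/-- The set `F = {f₁, …, f_K}` in `ℂ[x₁, …, x_N] / (xᵢ² - xᵢ)` that a presented system denotes. -/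
def BoolSystem.toSet (θ : ℕ → ℂ) (S : BoolSystem) : Set (BoolVarRing S.numVars) :=
  {f | ∃ p ∈ S.polys, f = Ideal.Quotient.mk (boolIdeal S.numVars) (polyValue θ p)}

/-- The alphabet in which systems are written. -/
inductive SysSym where
  | var
  | bit (b : Bool)
  | neg
  | slash
  | endCoord
  | mono
  | endTerm
  | endPoly
  deriving DecidableEq, Fintype

/-- Binary digits of a natural number. -/
def encNat (n : ℕ) : List SysSym := (Computability.encodeNat n).map SysSym.bit

/-- A rational number: sign, numerator and denominator in binary. -/
def encRat (q : ℚ) : List SysSym :=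
  (if q < 0 then [SysSym.neg] else []) ++ encNat q.num.natAbs ++ SysSym.slash :: encNat q.den

/-- A term: its coordinates, then the exponents of the `N` variables (one bit for each). -/
def encTerm {N : ℕ} (t : BoolTerm N) : List SysSym :=
  (t.coords.flatMap fun q => encRat q ++ [SysSym.endCoord]) ++
    SysSym.mono :: List.ofFn fun i : Fin N => SysSym.bit (decide (i ∈ t.vars))

/-- A polynomial: its terms one after the other. -/
def encPoly {N : ℕ} (p : List (BoolTerm N)) : List SysSym :=
  p.flatMap fun t => encTerm t ++ [SysSym.endTerm]

/-- A system: the number of variables in unary, then the polynomials one after the other. -/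
def encSystem (S : BoolSystem) : List SysSym :=
  List.replicate S.numVars SysSym.var ++ S.polys.flatMap fun p => encPoly p ++ [SysSym.endPoly]

/-! The encoding is injective. -/

theorem append_sep_inj {s : SysSym} : ∀ {a b c d : List SysSym}, s ∉ a → s ∉ b →
    a ++ s :: c = b ++ s :: d → a = b ∧ c = d
  | [], [], _, _, _, _, h => by simpa using h
  | [], x :: b, _, _, _, hb, h => by simp at h hb; exact absurd h.1 hb.1
  | x :: a, [], _, _, ha, _, h => by simp at h ha; exact absurd h.1.symm ha.1
  | x :: a, y :: b, _, _, ha, hb, h => by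
    simp only [List.cons_append, List.cons.injEq, List.mem_cons, not_or] at h ha hb
    have := append_sep_inj ha.2 hb.2 h.2
    exact ⟨by rw [h.1, this.1], this.2⟩

theorem flatMap_sep_inj {β : Type} {s : SysSym} {g : β → List SysSym} (hg : Function.Injective g)
    (hs : ∀ x, s ∉ g x) : ∀ {l l' : List β},
    (l.flatMap fun x => g x ++ [s]) = (l'.flatMap fun x => g x ++ [s]) → l = l'
  | [], [], _ => rfl
  | [], y :: l', h => by simp at h
  | x :: l, [], h => by simp at h
  | x :: l, y :: l', h => by
    simp only [List.flatMap_cons, List.append_assoc, List.singleton_append] at h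
    have h' := append_sep_inj (hs x) (hs y) h
    rw [hg h'.1, flatMap_sep_inj hg hs h'.2]

theorem encNat_injective : Function.Injective encNat := by
  intro m n h
  have hb : Function.Injective SysSym.bit := fun a b h => by simpa using h
  have := List.map_injective_iff.mpr hb h
  rw [← Computability.decode_encodeNat m, this, Computability.decode_encodeNat]

theorem not_mem_encNat {s : SysSym} (hs : ∀ b, SysSym.bit b ≠ s) (n : ℕ) : s ∉ encNat n := by
  simp [encNat, hs]

theorem not_mem_encRat {s : SysSym} (hs : ∀ b, SysSym.bit b ≠ s) (h₁ : s ≠ SysSym.neg)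
    (h₂ : s ≠ SysSym.slash) (q : ℚ) : s ∉ encRat q := by
  simp only [encRat, List.mem_append, List.mem_cons, not_or]
  refine ⟨⟨?_, not_mem_encNat hs _⟩, h₂, not_mem_encNat hs _⟩
  split_ifs <;> simp [h₁]

theorem encRat_injective : Function.Injective encRat := by
  intro q r h
  have hsl : ∀ q : ℚ, SysSym.slash ∉ (if q < 0 then [SysSym.neg] else []) ++ encNat q.num.natAbs := by
    intro q
    simp only [List.mem_append, not_or]
    refine ⟨?_, not_mem_encNat (by simp) _⟩
    split_ifs <;> simp
  obtain ⟨h₁, h₂⟩ := append_sep_inj (hsl q) (hsl r) h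
  have hden : q.den = r.den := encNat_injective h₂
  have hneg : ∀ n, SysSym.neg ∉ encNat n := not_mem_encNat (by simp)
  have hnum : q.num = r.num := by
    by_cases hq : q < 0 <;> by_cases hr : r < 0
    · simp only [hq, hr, if_true, List.singleton_append, List.cons.injEq, true_and] at h₁
      have := encNat_injective h₁
      have := Rat.num_neg.mpr hq
      have := Rat.num_neg.mpr hr
      omega
    · simp only [hq, hr, if_true, if_false, List.singleton_append, List.nil_append] at h₁
      exact absurd (h₁ ▸ List.mem_cons_self) (hneg _)
    · simp only [hq, hr, if_true, if_false, List.singleton_append, List.nil_append] at h₁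
      exact absurd (h₁ ▸ List.mem_cons_self) (hneg _)
    · simp only [hq, hr, if_false, List.nil_append] at h₁
      have := encNat_injective h₁
      have := Rat.num_nonneg.mpr (not_lt.mp hq)
      have := Rat.num_nonneg.mpr (not_lt.mp hr)
      omega
  exact Rat.ext hnum hden

theorem not_mem_coords {s : SysSym} (hs : ∀ b, SysSym.bit b ≠ s) (h₁ : s ≠ SysSym.neg)
    (h₂ : s ≠ SysSym.slash) (h₃ : s ≠ SysSym.endCoord) (l : List ℚ) :
    s ∉ l.flatMap fun q => encRat q ++ [SysSym.endCoord] := by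
  simp only [List.mem_flatMap, List.mem_append, List.mem_singleton, not_exists, not_and, not_or]
  exact fun q _ => ⟨not_mem_encRat hs h₁ h₂ q, h₃⟩

theorem not_mem_encTerm {N : ℕ} {s : SysSym} (hs : ∀ b, SysSym.bit b ≠ s) (h₁ : s ≠ SysSym.neg)
    (h₂ : s ≠ SysSym.slash) (h₃ : s ≠ SysSym.endCoord) (h₄ : s ≠ SysSym.mono) (t : BoolTerm N) :
    s ∉ encTerm t := by
  simp only [encTerm, List.mem_append, List.mem_cons, not_or]
  refine ⟨not_mem_coords hs h₁ h₂ h₃ _, h₄, ?_⟩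
  simp [List.mem_ofFn, hs]

theorem encTerm_injective {N : ℕ} : Function.Injective (encTerm (N := N)) := by
  rintro ⟨c, v⟩ ⟨c', v'⟩ h
  have hm := not_mem_coords (s := SysSym.mono) (by simp) (by simp) (by simp) (by simp)
  obtain ⟨h₁, h₂⟩ := append_sep_inj (hm c) (hm c') h
  have hc : c = c' :=
    flatMap_sep_inj encRat_injective (not_mem_encRat (by simp) (by simp) (by simp)) h₁
  have hv : v = v' := by
    have h₃ := List.ofFn_injective h₂
    ext i
    simpa using congrFun h₃ i
  rw [hc, hv]

theorem not_mem_encPoly {N : ℕ} {s : SysSym} (hs : ∀ b, SysSym.bit b ≠ s) (h₁ : s ≠ SysSym.neg)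
    (h₂ : s ≠ SysSym.slash) (h₃ : s ≠ SysSym.endCoord) (h₄ : s ≠ SysSym.mono) (h₅ : s ≠ SysSym.endTerm)
    (p : List (BoolTerm N)) : s ∉ encPoly p := by
  simp only [encPoly, List.mem_flatMap, List.mem_append, List.mem_singleton, not_exists, not_and,
    not_or]
  exact fun t _ => ⟨not_mem_encTerm hs h₁ h₂ h₃ h₄ t, h₅⟩

theorem encPoly_injective {N : ℕ} : Function.Injective (encPoly (N := N)) := fun _ _ h =>
  flatMap_sep_inj encTerm_injective
    (not_mem_encTerm (by simp) (by simp) (by simp) (by simp) (by simp)) h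

theorem encSystem_injective : Function.Injective encSystem := by
  have hvar : ∀ {N : ℕ} (l : List (List (BoolTerm N))),
      (l.flatMap fun p => encPoly p ++ [SysSym.endPoly]).count SysSym.var = 0 := by
    intro N l
    refine List.count_eq_zero.mpr ?_
    simp only [List.mem_flatMap, List.mem_append, List.mem_singleton, not_exists, not_and, not_or]
    exact fun p _ =>
      ⟨not_mem_encPoly (by simp) (by simp) (by simp) (by simp) (by simp) (by simp) p, by simp⟩
  rintro ⟨N, l⟩ ⟨M, l'⟩ h
  have hN : N = M := by
    have := congrArg (List.count SysSym.var) h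
    simpa [encSystem, List.count_append, hvar] using this
  subst hN
  have hl : l = l' :=
    flatMap_sep_inj encPoly_injective
      (not_mem_encPoly (by simp) (by simp) (by simp) (by simp) (by simp) (by simp))
      (List.append_cancel_left h)
  rw [hl]

/-- The encoding of systems as strings. -/
def systemEncoding : Computability.Encoding BoolSystem SysSym where
  encode := encSystem
  decode := Function.partialInv encSystem
  decode_encode S := Function.partialInv_left encSystem_injective S

end

/-! The problem is even decidable in polynomial time, so the verifier ignores its certificate.

Group theory: the stabilizer is a subgroup. If it is proper, one of its cosets lies in the
complement, which therefore has at least N!/2 ≥ N/2 elements. Hence for N ≥ 2c₀ + 1 the bound on the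
complement says that the stabilizer is all of Σ_N. This can be checked on transpositions, and then Z
is invariant under Σ_N, so that only the N + 1 points consisting of r ones followed by zeros have to
be tried (`large_iff`). For N ≤ 2c₀ the numbers of permutations and of points are bounded, and all
of them are tried.

Algebra: whether σ ∘ f equals f' is decided by values. A combination of square-free monomials that
vanishes at the indicators of these monomials is zero, because the matrix of values is unitriangular
with respect to inclusion (`eq_zero_of_evalAt_eq_zero`, `permute_polyClass_eq_iff`).

Arithmetic: by linear independence of θ, values are compared one rational coordinate at a time. A
coordinate is accumulated as an unreduced fraction, whose numerator and denominator are at most 2^L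
for inputs of length L (`fracValue_spec`). A nonzero integer of absolute value below 2^n fails to be
divisible by some number up to 2n, since otherwise the central binomial coefficient would divide it
(`exists_not_dvd`). So it suffices to compute modulo all small numbers.

Machines: consequently every number that occurs is at most the length of the padded tape, and is
stored as the position of a head. Functions on boundedly many such registers that are computable in
polynomial time are closed under composition and primitive recursion (`PolyComp.comp`,
`PolyComp.rec`), because a recursion makes at most as many passes as the tape has cells. A head is
simulated by two stacks (`steps_of_runs`). -/

/-! ### Programs moving finitely many heads along a tape -/

namespace HeadProg

open Turing Function

/-- Programs acting on registers, each of which holds the position of a head on a fixed tape. -/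
inductive Cmd (B : Type) where
  | inc (r : ℕ)
  | dec (r : ℕ)
  | top (r : ℕ)
  | test (b : B) (r r' : ℕ)
  | seq (c d : Cmd B)
  | loop (r : ℕ) (c : Cmd B)

/-- `Runs tape c s t s'`: the program `c` leads from the register contents `s` to `s'` in time `t`.
The command `test b r r'` increments `r'` if the symbol under the head `r` is `b`, and `loop r c`
repeats `r := r - 1; c` until `r` is zero. -/
inductive Runs {B : Type} [DecidableEq B] (tape : List B) :
    Cmd B → (ℕ → ℕ) → ℕ → (ℕ → ℕ) → Prop
  | inc (r : ℕ) (s : ℕ → ℕ) :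
      Runs tape (.inc r) s 1 (update s r (min (s r + 1) tape.length))
  | dec (r : ℕ) (s : ℕ → ℕ) : Runs tape (.dec r) s 1 (update s r (s r - 1))
  | top (r : ℕ) (s : ℕ → ℕ) :
      Runs tape (.top r) s (tape.length - s r + 1) (update s r tape.length)
  | test (b : B) (r r' : ℕ) (s : ℕ → ℕ) :
      Runs tape (.test b r r') s 1
        (if tape[s r]? = some b then update s r' (min (s r' + 1) tape.length) else s)
  | seq {c d : Cmd B} {s s' s'' : ℕ → ℕ} {t t' : ℕ} :
      Runs tape c s t s' → Runs tape d s' t' s'' → Runs tape (.seq c d) s (t + t') s''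
  | loop_zero {r : ℕ} {c : Cmd B} {s : ℕ → ℕ} : s r = 0 → Runs tape (.loop r c) s 1 s
  | loop_pos {r : ℕ} {c : Cmd B} {s s' s'' : ℕ → ℕ} {t t' : ℕ} : s r ≠ 0 →
      Runs tape c (update s r (s r - 1)) t s' → Runs tape (.loop r c) s' t' s'' →
      Runs tape (.loop r c) s (1 + t + t') s''

theorem update_le {s : ℕ → ℕ} {m r v : ℕ} (h : ∀ r, s r ≤ m) (hv : v ≤ m) (r' : ℕ) :
    update s r v r' ≤ m := by
  by_cases h' : r' = r
  · subst h'; simpa using hv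
  · simpa [h'] using h r'

/-- Increments are cut off at the end of the tape, so a register always remains the position of a
head. -/
theorem Runs.le_length {B : Type} [DecidableEq B] {tape : List B} {c : Cmd B} {s s' : ℕ → ℕ}
    {t : ℕ} (h : Runs tape c s t s') (hs : ∀ r, s r ≤ tape.length) (r : ℕ) :
    s' r ≤ tape.length := by
  induction h generalizing r with
  | inc r s => exact update_le hs (min_le_right _ _) _
  | dec r s => exact update_le hs ((Nat.sub_le _ _).trans (hs _)) _
  | top r s => exact update_le hs le_rfl _
  | test b r r' s =>
    split_ifs
    · exact update_le hs (min_le_right _ _) _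
    · exact hs _
  | seq _ _ ih₁ ih₂ => exact ih₂ (ih₁ hs) _
  | loop_zero _ => exact hs _
  | loop_pos _ _ _ ih₁ ih₂ => exact ih₂ (ih₁ (update_le hs ((Nat.sub_le _ _).trans (hs _)))) _

/-! ### Compilation to stack machines -/

/-- The stacks of the machine: two for each head, besides input, output and a temporary one. -/
inductive Stk (R : ℕ) where
  | inp
  | out
  | tmp
  | lft (r : Fin (R + 1))
  | rgt (r : Fin (R + 1))
  deriving DecidableEq, Fintype

/-- The stack alphabets. -/
@[reducible]
def StkSym (A : Type) (R : ℕ) : Stk R → Type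
  | .inp => A
  | .out => Bool
  | .tmp => A
  | .lft _ => Option A
  | .rgt _ => Option A

/-- The stack index of a register. -/
def reg (R r : ℕ) : Fin (R + 1) := Fin.ofNat (R + 1) r

/-- Statements of the machine. -/
abbrev StkStmt (A : Type) (R : ℕ) (Λ : Type) : Type :=
  TM2.Stmt (StkSym A R) Λ (Option (Option A))

/-- Labels of the statements that a program is compiled to. -/
def Cmd.Lab {B : Type} : Cmd B → Type
  | .seq c d => c.Lab ⊕ d.Lab
  | .loop _ c => Option c.Lab
  | _ => Unit

/-- The label at which the execution of a program starts. -/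
def Cmd.entry {B : Type} : (c : Cmd B) → c.Lab
  | .seq c _ => Sum.inl c.entry
  | .loop _ _ => none
  | .inc _ | .dec _ | .top _ | .test _ _ _ => ()

/-- The labels of a program form a finite type. -/
instance Cmd.fintypeLab {B : Type} : (c : Cmd B) → Fintype c.Lab
  | .seq c d => @instFintypeSum _ _ c.fintypeLab d.fintypeLab
  | .loop _ c => @instFintypeOption _ c.fintypeLab
  | .inc _ | .dec _ | .top _ | .test _ _ _ => inferInstanceAs (Fintype Unit)

/-- The largest register of a program. -/
def Cmd.maxReg {B : Type} : Cmd B → ℕ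
  | .inc r | .dec r | .top r => r
  | .test _ r r' => max r r'
  | .seq c d => max c.maxReg d.maxReg
  | .loop r c => max r c.maxReg

section Compile

variable {A : Type} {Λ : Type}

open TM2.Stmt

/-- Move a head to the right or to the left and go to `x`; if it cannot move, go to `y`. -/
def shiftHead {R : ℕ} (r : Fin (R + 1)) (right : Bool) (x y : Λ) : StkStmt A R Λ :=
  if right then
    pop (.rgt r) (fun _ o => o) (branch Option.isSome
      (push (.lft r) (fun v => (v.getD none : Option A)) (load (fun _ => none) (goto fun _ => x)))
      (goto fun _ => y))
  else
    pop (.lft r) (fun _ o => o) (branch Option.isSome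
      (push (.rgt r) (fun v => (v.getD none : Option A)) (load (fun _ => none) (goto fun _ => x)))
      (goto fun _ => y))

/-- The statements of a compiled program: its labels are embedded by `e`, and the execution is
continued at `x`. -/
def Cmd.code [DecidableEq A] (R : ℕ) :
    (c : Cmd (Option A)) → (c.Lab → Λ) → Λ → c.Lab → StkStmt A R Λ
  | .inc r, _, x, _ => shiftHead (reg R r) true x x
  | .dec r, _, x, _ => shiftHead (reg R r) false x x
  | .top r, e, x, l => shiftHead (reg R r) true (e l) x
  | .test b r r', _, x, _ =>
      peek (.rgt (reg R r)) (fun _ o => o) (branch (fun v => v = some b)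
        (load (fun _ => none) (shiftHead (reg R r') true x x))
        (load (fun _ => none) (goto fun _ => x)))
  | .seq c d, e, _, .inl l => c.code R (fun l => e (.inl l)) (e (.inr d.entry)) l
  | .seq _ d, e, x, .inr l => d.code R (fun l => e (.inr l)) x l
  | .loop r c, e, x, none => shiftHead (reg R r) false (e (some c.entry)) x
  | .loop _ c, e, _, some l => c.code R (fun l => e (some l)) (e none) l

/-- The stacks when the heads are at the positions `s`. -/
def stks (R : ℕ) (tape : List (Option A)) (s : ℕ → ℕ) : ∀ k : Stk R, List (StkSym A R k)
  | .inp => []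
  | .out => []
  | .tmp => []
  | .lft r => (tape.take (s r)).reverse
  | .rgt r => tape.drop (s r)

theorem reg_eq_iff {R r : ℕ} (h : r ≤ R) (i : Fin (R + 1)) : i = reg R r ↔ (i : ℕ) = r := by
  simp [reg, Fin.ext_iff, Nat.mod_eq_of_lt (Nat.lt_succ_of_le h)]

theorem val_reg {R r : ℕ} (h : r ≤ R) : ((reg R r : Fin (R + 1)) : ℕ) = r :=
  (reg_eq_iff h _).1 rfl

/-- The two orders of the updates, here and in `stks_update'`, are those in which a move to the
right and a move to the left pop and push. -/
theorem stks_update {R r : ℕ} (h : r ≤ R) (tape : List (Option A)) (s : ℕ → ℕ) (v : ℕ) :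
    stks R tape (update s r v) =
      update (update (stks R tape s) (.rgt (reg R r)) (tape.drop v)) (.lft (reg R r))
        (tape.take v).reverse := by
  funext k
  rcases k with _ | _ | _ | i | i
  · simp [stks]
  · simp [stks]
  · simp [stks]
  all_goals
    by_cases hi : i = reg R r
    · subst hi
      simp [stks, val_reg h]
    · have : (i : ℕ) ≠ r := fun h' => hi ((reg_eq_iff h i).2 h')
      simp [stks, hi, this]

theorem stks_update' {R r : ℕ} (h : r ≤ R) (tape : List (Option A)) (s : ℕ → ℕ) (v : ℕ) :
    stks R tape (update s r v) =
      update (update (stks R tape s) (.lft (reg R r)) (tape.take v).reverse) (.rgt (reg R r))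
        (tape.drop v) := by
  rw [stks_update h, update_comm (by simp)]

/-- At the right end of the tape the right stack is empty: the pop returns `none` and nothing is
pushed, which agrees with the cut-off in `Runs`. -/
theorem stepAux_shiftHead_true {R r : ℕ} (h : r ≤ R) (tape : List (Option A)) (s : ℕ → ℕ)
    (hs : s r ≤ tape.length) (x y : Λ) :
    TM2.stepAux (shiftHead (reg R r) true x y) none (stks R tape s) =
      ⟨some (if s r < tape.length then x else y), none,
        stks R tape (update s r (min (s r + 1) tape.length))⟩ := by
  rw [stks_update h]
  by_cases hlt : s r < tape.length
  · have h1 : stks R tape s (.rgt (reg R r)) = tape[s r] :: tape.drop (s r + 1) := by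
      rw [← List.drop_eq_getElem_cons hlt]; simp [stks, val_reg h]
    have h2 : (tape.take (s r + 1)).reverse = tape[s r] :: stks R tape s (.lft (reg R r)) := by
      rw [List.take_succ_eq_append_getElem hlt]; simp [stks, val_reg h]
    rw [min_eq_left (Nat.succ_le_of_lt hlt), h2]
    simp [shiftHead, h1, hlt]
  · have he : s r = tape.length := by omega
    have h1 : stks R tape s (.rgt (reg R r)) = [] := by simp [stks, val_reg h, he]
    have h2 : stks R tape s (.lft (reg R r)) = tape.reverse := by simp [stks, val_reg h, he]
    simp only [shiftHead, if_true, TM2.stepAux, h1, hlt, if_false]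
    simp only [List.head?_nil, Option.isSome_none, cond_false, List.tail_nil]
    have hm : min (s r + 1) tape.length = tape.length := by omega
    rw [hm, List.drop_length, List.take_length, ← h2]
    rw [update_comm (by simp), update_eq_self]

theorem stepAux_shiftHead_false {R r : ℕ} (h : r ≤ R) (tape : List (Option A)) (s : ℕ → ℕ)
    (hs : s r ≤ tape.length) (x y : Λ) :
    TM2.stepAux (shiftHead (reg R r) false x y) none (stks R tape s) =
      ⟨some (if s r ≠ 0 then x else y), none, stks R tape (update s r (s r - 1))⟩ := by
  rw [stks_update' h]
  by_cases h0 : s r = 0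
  · have h1 : stks R tape s (.rgt (reg R r)) = tape := by simp [stks, val_reg h, h0]
    have h2 : stks R tape s (.lft (reg R r)) = [] := by simp [stks, val_reg h, h0]
    have h3 : tape.drop (s r - 1) = stks R tape s (.rgt (reg R r)) := by rw [h1]; simp [h0]
    rw [h3, update_comm (by simp), update_eq_self]
    simp [shiftHead, h2, h0]
  · obtain ⟨p, hp⟩ := Nat.exists_eq_succ_of_ne_zero h0
    have hlt : p < tape.length := by omega
    have h1 : stks R tape s (.lft (reg R r)) = tape[p] :: (tape.take p).reverse := by
      have : tape.take (p + 1) = tape.take p ++ [tape[p]] :=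
        List.take_succ_eq_append_getElem hlt
      simp only [stks, val_reg h, hp, Nat.succ_eq_add_one, this]
      simp
    have h2 : tape.drop p = tape[p] :: stks R tape s (.rgt (reg R r)) := by
      rw [List.drop_eq_getElem_cons hlt]; simp [stks, val_reg h, hp]
    rw [show s r - 1 = p by omega, h2]
    simp [shiftHead, h1, h0]

/-- `n` steps of the machine `m` lead from `a` to `b`. -/
def Steps {R : ℕ} (m : Λ → StkStmt A R Λ) (n : ℕ)
    (a b : TM2.Cfg (StkSym A R) Λ (Option (Option A))) : Prop :=
  (flip bind (TM2.step m))^[n] (some a) = some b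

theorem Steps.trans {R : ℕ} {m : Λ → StkStmt A R Λ} {n n' : ℕ}
    {a b c : TM2.Cfg (StkSym A R) Λ (Option (Option A))} (h : Steps m n a b)
    (h' : Steps m n' b c) : Steps m (n + n') a c := by
  rw [Steps, add_comm, iterate_add_apply, h, h']

theorem Steps.one {R : ℕ} {m : Λ → StkStmt A R Λ} {l : Λ} {v : Option (Option A)}
    {S : ∀ k, List (StkSym A R k)} {b : TM2.Cfg (StkSym A R) Λ (Option (Option A))}
    (h : TM2.stepAux (m l) v S = b) : Steps m 1 ⟨some l, v, S⟩ b := by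
  simp [Steps, flip, TM2.step, h]

variable [DecidableEq A]

/-- Time in `Runs` is counted so as to be exactly the number of machine steps; the last unit of
`top` and of a loop is the pop that fails. The exit label `x` is general in the induction, since the
first half of a sequence exits to the second half and a loop body to the head of its loop. -/
theorem steps_of_runs {R : ℕ} {tape : List (Option A)} {c : Cmd (Option A)} {s s' : ℕ → ℕ} {t : ℕ}
    (h : Runs tape c s t s') (hs : ∀ r, s r ≤ tape.length) (hc : c.maxReg ≤ R)
    (m : Λ → StkStmt A R Λ) (e : c.Lab → Λ) (x : Λ) (hm : ∀ l, m (e l) = c.code R e x l) :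
    Steps m t ⟨some (e c.entry), none, stks R tape s⟩ ⟨some x, none, stks R tape s'⟩ := by
  induction h generalizing x with
  | inc r s =>
    refine Steps.one ?_
    rw [hm, Cmd.code, stepAux_shiftHead_true (R := R) (r := r) hc _ _ (hs r), ite_self]
  | dec r s =>
    refine Steps.one ?_
    rw [hm, Cmd.code, stepAux_shiftHead_false (R := R) (r := r) hc _ _ (hs r), ite_self]
  | top r s =>
    -- Induction on the number of cells to the right of the head; `top` returns to its own label
    -- until the pop fails.
    obtain ⟨n, hn⟩ : ∃ n, n = tape.length - s r := ⟨_, rfl⟩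
    rw [← hn]
    induction n generalizing s with
    | zero =>
      refine Steps.one ?_
      have : s r = tape.length := by have := hs r; omega
      rw [hm, Cmd.code, stepAux_shiftHead_true (R := R) (r := r) hc _ _ (hs r)]
      simp [this]
    | succ n ih =>
      rw [add_comm]
      refine Steps.trans
        (b := ⟨some (e ()), none, stks R tape (update s r (s r + 1))⟩) (Steps.one ?_) ?_
      · rw [hm, Cmd.code, stepAux_shiftHead_true (R := R) (r := r) hc _ _ (hs r)]
        simp [show s r < tape.length by omega,
          Cmd.entry]
      · have := ih (update s r (s r + 1)) (update_le hs (by omega)) (by simp; omega)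
        rw [update_idem] at this
        exact this
  | test b r r' s =>
    refine Steps.one ?_
    have hr : r ≤ R := (le_max_left _ _).trans hc
    have hh : (stks R tape s (.rgt (reg R r))).head? = tape[s r]? := by
      simp [stks, val_reg hr]
    rw [hm, Cmd.code, TM2.stepAux, TM2.stepAux, hh]
    by_cases hb : tape[s r]? = some b
    · have := stepAux_shiftHead_true (A := A) ((le_max_right _ _).trans hc) tape s (hs r') x x
      simp only [hb, if_true]
      simpa using this
    · simp [hb]
  | seq _ _ ih₁ ih₂ =>
    rename_i c d s s₁ s₂ t t' h₁ h₂
    have i₁ := ih₁ hs ((le_max_left _ _).trans hc) (fun l => e (.inl l)) (e (.inr d.entry))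
      fun l => hm (.inl l)
    have i₂ := ih₂ (h₁.le_length hs) ((le_max_right _ _).trans hc) (fun l => e (.inr l)) x
      fun l => hm (.inr l)
    exact i₁.trans i₂
  | loop_zero h0 =>
    rename_i r c s
    refine Steps.one ?_
    rw [hm, Cmd.entry, Cmd.code, stepAux_shiftHead_false ((le_max_left _ _).trans hc) _ _ (hs r)]
    have : update s r (s r - 1) = s := by rw [show s r - 1 = s r by omega, update_eq_self]
    rw [this]
    simp [h0]
  | loop_pos h0 _ _ ih₁ ih₂ =>
    rename_i r c s s₁ s₂ t t' h₁ h₂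
    have hle : ∀ r', update s r (s r - 1) r' ≤ tape.length :=
      update_le hs ((Nat.sub_le _ _).trans (hs _))
    have i₁ := ih₁ hle ((le_max_right _ _).trans hc) (fun l => e (some l)) (e none)
      fun l => hm (some l)
    have i₂ := ih₂ (h₁.le_length hle) hc e x hm
    refine (Steps.trans (Steps.one ?_) i₁).trans i₂
    rw [hm, Cmd.entry, Cmd.code, stepAux_shiftHead_false ((le_max_left _ _).trans hc) _ _ (hs r)]
    simp [h0]

end Compile

end HeadProg

/-! ### The complete machine: loading the tape, running the program, answering, emptying the stacks
-/

namespace HeadProg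

open Turing Function

section Machine

open TM2.Stmt

variable {A : Type} {Λ : Type} {R : ℕ}

/-- Push a symbol on the right stacks of the heads in a list. -/
def pushAll (f : Option (Option A) → Option A) (l : List (Fin (R + 1))) (q : StkStmt A R Λ) :
    StkStmt A R Λ :=
  l.foldr (fun r q => push (.rgt r) f q) q

/-- Pop the stacks in a list, and set the state to `some none` if one of them was not empty. -/
def popAll (l : List (Stk R)) (q : StkStmt A R Λ) : StkStmt A R Λ :=
  l.foldr (fun k q => pop k (fun v o => if o.isSome then some none else v) q) q

/-- Stacks in which all heads are at the left end of the tape `z`. -/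
def ioStks (R : ℕ) (x y : List A) (z : Fin (R + 1) → List (Option A)) :
    ∀ k : Stk R, List (StkSym A R k)
  | .inp => x
  | .out => []
  | .tmp => y
  | .lft _ => []
  | .rgt r => z r

/-- A head may be listed several times and then receives as many copies; in this way `C` blanks
reach every head in one step. -/
theorem stepAux_pushAll (f : Option (Option A) → Option A) (q : StkStmt A R Λ)
    (v : Option (Option A)) (x y : List A) (l : List (Fin (R + 1)))
    (z : Fin (R + 1) → List (Option A)) :
    TM2.stepAux (pushAll f l q) v (ioStks R x y z) =
      TM2.stepAux q v (ioStks R x y fun r => List.replicate (l.count r) (f v) ++ z r) := by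
  induction l generalizing z with
  | nil => simp [pushAll]
  | cons r l ih =>
    have : update (ioStks R x y z) (.rgt r) (f v :: ioStks R x y z (.rgt r)) =
        ioStks R x y (update z r (f v :: z r)) := by
      funext k
      rcases k with _ | _ | _ | i | i
      · simp [ioStks]
      · simp [ioStks]
      · simp [ioStks]
      · simp [ioStks]
      · by_cases hi : i = r
        · subst hi; simp [ioStks]
        · simp [ioStks, hi]
    rw [pushAll, List.foldr_cons, TM2.stepAux, this]
    rw [← pushAll, ih]
    congr 2
    funext i
    by_cases hi : i = r
    · subst hi
      simp [List.replicate_succ', List.append_assoc]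
    · simp [hi, Ne.symm hi]

/-- The state remembers whether anything was popped, so the machine can tell when all these stacks
are empty. -/
theorem stepAux_popAll (q : StkStmt A R Λ) (v : Option (Option A)) (l : List (Stk R))
    (S : ∀ k, List (StkSym A R k)) :
    ∃ v' : Option (Option A), TM2.stepAux (popAll l q) v S =
      TM2.stepAux q v' (fun k => (S k).drop (l.count k)) ∧
      (v' = none ↔ v = none ∧ ∀ k ∈ l, S k = []) := by
  induction l generalizing v S with
  | nil => exact ⟨v, by simp [popAll]⟩
  | cons k l ih =>
    obtain ⟨v', h₁, h₂⟩ := ih (if (S k).head?.isSome then some none else v)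
      (update S k (S k).tail)
    refine ⟨v', ?_, ?_⟩
    · rw [popAll, List.foldr_cons, TM2.stepAux, ← popAll, h₁]
      congr 1
      funext i
      by_cases hi : i = k
      · subst hi
        simp [← List.drop_one, List.drop_drop, add_comm]
      · simp [hi, Ne.symm hi]
    · rw [h₂]
      by_cases hS : S k = []
      · have : update S k (S k).tail = S := by rw [hS, List.tail_nil, ← hS, update_eq_self]
        rw [this]
        simp [hS]
      · have : (S k).head?.isSome := by simpa using hS
        simp [hS, this]

/-- The tape for the input `x`. -/
def pad (C : ℕ) (x : List A) : List (Option A) :=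
  x.map some ++ List.replicate (C * (x.length + 1)) none

/-- The phases of the machine besides the execution of the program. -/
inductive Phase where
  | load
  | unload
  | answer
  | clean
  deriving DecidableEq

instance : Fintype Phase := ⟨{.load, .unload, .answer, .clean}, fun x => by cases x <;> simp⟩

theorem count_blanks (C n : ℕ) (r : Fin n) :
    ((List.replicate C (List.finRange n)).flatten).count r = C := by
  induction C with
  | zero => simp
  | succ C ih =>
    rw [List.replicate_succ, List.flatten_cons, List.count_append, ih,
      List.count_eq_one_of_mem (List.nodup_finRange n) (List.mem_finRange r), add_comm]

variable [DecidableEq A] [Inhabited A]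

/-- The machine that copies its input on the tapes, runs the program `c`, and outputs whether
register `0` is nonzero. -/
noncomputable def machine (C : ℕ) (c : Cmd (Option A)) : Phase ⊕ c.Lab → StkStmt A c.maxReg (Phase ⊕ c.Lab)
  | .inl .load =>
      pop .inp (fun _ o => o.map some) (branch Option.isSome
        (push .tmp (fun v => v.join.getD default) (load (fun _ => none)
          (pushAll (fun _ => none) (List.replicate C (List.finRange _)).flatten
            (goto fun _ => .inl .load))))
        (pushAll (fun _ => none) (List.replicate C (List.finRange _)).flatten
          (goto fun _ => .inl .unload)))
  | .inl .unload =>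
      pop .tmp (fun _ o => o.map some) (branch Option.isSome
        (pushAll (fun v => v.getD none) (List.finRange _)
          (load (fun _ => none) (goto fun _ => .inl .unload)))
        (goto fun _ => .inr c.entry))
  | .inl .answer =>
      peek (.lft (reg _ 0)) (fun _ o => o) (branch Option.isSome
        (push .out (fun _ => true) (load (fun _ => none) (goto fun _ => .inl .clean)))
        (push .out (fun _ => false) (load (fun _ => none) (goto fun _ => .inl .clean))))
  | .inl .clean =>
      popAll (Finset.univ.erase Stk.out).toList (branch Option.isSome
        (load (fun _ => none) (goto fun _ => .inl .clean)) halt)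
  | .inr l => c.code c.maxReg .inr (.inl .answer) l

/-- Every input symbol brings `C` blanks, and the pop that finds the input empty brings `C` more.
The blanks come before the symbols because the right stacks are built from the right end of the
tape. -/
theorem steps_load (C : ℕ) (c : Cmd (Option A)) (x y : List A) (n : ℕ) :
    Steps (machine C c) (x.length + 1)
      ⟨some (.inl .load), none, ioStks _ x y fun _ => List.replicate n none⟩
      ⟨some (.inl .unload), none,
        ioStks _ [] (x.reverse ++ y) fun _ => List.replicate (C * (x.length + 1) + n) none⟩ := by
  induction x generalizing y n with
  | nil =>
    refine Steps.one ?_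
    have : update (ioStks c.maxReg ([] : List A) y fun _ => List.replicate n none) .inp [] =
        ioStks c.maxReg ([] : List A) y fun _ => List.replicate n none :=
      update_eq_self (f := ioStks c.maxReg ([] : List A) y fun _ => List.replicate n none) _
    simp only [machine, TM2.stepAux]
    simp only [ioStks, List.head?_nil, Option.map_none, Option.isSome_none, cond_false,
      List.tail_nil]
    rw [this, stepAux_pushAll]
    simp [count_blanks, List.replicate_append_replicate]
  | cons a x ih =>
    rw [List.length_cons, add_comm (x.length + 1) 1]
    refine (Steps.one ?_).trans (b := ⟨some (.inl .load), none,
      ioStks _ x (a :: y) fun _ => List.replicate (C + n) none⟩) ?_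
    · have : update (update (ioStks c.maxReg (a :: x) y fun _ => List.replicate n none) .inp x)
          .tmp (a :: y) = ioStks c.maxReg x (a :: y) fun _ => List.replicate n none := by
        funext k
        rcases k with _ | _ | _ | i | i <;> simp [ioStks]
      simp only [machine, TM2.stepAux]
      simp only [ioStks, List.head?_cons, Option.map_some, Option.isSome_some, cond_true,
        List.tail_cons, update_of_ne, ne_eq, reduceCtorEq, not_false_eq_true, Option.join_some,
        Option.getD_some]
      rw [this, stepAux_pushAll]
      simp [count_blanks, List.replicate_append_replicate]
    · have := ih (a :: y) (C + n)
      rw [show C * (1 + (x.length + 1)) + n = C * (x.length + 1) + (C + n) by ring]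
      simpa using this

/-- The temporary stack holds the input reversed; unloading it restores the order on the tapes of
all heads. -/
theorem steps_unload (C : ℕ) (c : Cmd (Option A)) (y : List A) (z : List (Option A)) :
    Steps (machine C c) (y.length + 1)
      ⟨some (.inl .unload), none, ioStks _ [] y fun _ => z⟩
      ⟨some (.inr c.entry), none, stks _ (y.reverse.map some ++ z) fun _ => 0⟩ := by
  induction y generalizing z with
  | nil =>
    refine Steps.one ?_
    have : update (ioStks c.maxReg ([] : List A) [] fun _ => z) .tmp [] =
        ioStks c.maxReg ([] : List A) [] fun _ => z :=
      update_eq_self (f := ioStks c.maxReg ([] : List A) [] fun _ => z) _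
    simp only [machine, TM2.stepAux]
    simp only [ioStks, List.head?_nil, Option.map_none, Option.isSome_none, cond_false,
      List.tail_nil]
    rw [this]
    congr 1
  | cons a y ih =>
    rw [List.length_cons, add_comm (y.length + 1) 1]
    refine (Steps.one ?_).trans (b := ⟨some (.inl .unload), none,
      ioStks _ [] y fun _ => some a :: z⟩) ?_
    · have : update (ioStks c.maxReg ([] : List A) (a :: y) fun _ => z) .tmp y =
          ioStks c.maxReg ([] : List A) y fun _ => z := by
        funext k
        rcases k with _ | _ | _ | i | i <;> simp [ioStks]
      simp only [machine, TM2.stepAux]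
      simp only [ioStks, List.head?_cons, Option.map_some, Option.isSome_some, cond_true,
        List.tail_cons]
      rw [this, stepAux_pushAll]
      have hc : ∀ r : Fin (c.maxReg + 1), (List.finRange (c.maxReg + 1)).count r = 1 := fun r =>
        List.count_eq_one_of_mem (List.nodup_finRange _) (List.mem_finRange r)
      simp [hc]
    · simpa using ih (some a :: z)

/-- Stacks that are empty but for the output. -/
def outStks (A : Type) (R : ℕ) (b : Bool) : ∀ k : Stk R, List (StkSym A R k)
  | .inp => []
  | .out => [b]
  | .tmp => []
  | .lft _ => []
  | .rgt _ => []

/-- A halting configuration must be empty except for the output. Each step pops all other stacks at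
once, and one more step notices that they are empty. -/
theorem steps_clean (C : ℕ) (c : Cmd (Option A)) (b : Bool) (n : ℕ)
    (S : ∀ k, List (StkSym A c.maxReg k)) (ho : S .out = [b])
    (hn : ∀ k ≠ Stk.out, (S k).length ≤ n) :
    ∃ n' ≤ n + 1, Steps (machine C c) n' ⟨some (.inl .clean), none, S⟩
      ⟨none, none, outStks A c.maxReg b⟩ := by
  have hl : ∀ k : Stk c.maxReg, (Finset.univ.erase Stk.out).toList.count k =
      if k = Stk.out then 0 else 1 := by
    intro k
    split_ifs with hk
    · exact List.count_eq_zero.2 (by simp [hk])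
    · exact List.count_eq_one_of_mem (Finset.nodup_toList _) (by simp [hk])
  induction n generalizing S with
  | zero =>
    refine ⟨1, le_rfl, Steps.one ?_⟩
    obtain ⟨v, h₁, h₂⟩ := stepAux_popAll (branch Option.isSome
        (load (fun _ => none) (goto fun _ => (Sum.inl Phase.clean : Phase ⊕ c.Lab))) halt) none
        (Finset.univ.erase Stk.out).toList S
    have hS : ∀ k ≠ Stk.out, S k = [] := fun k hk => by simpa using hn k hk
    have hv : v = none := h₂.2 ⟨rfl, fun k hk => hS k (by simpa using hk)⟩
    rw [machine, h₁, hv]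
    simp only [TM2.stepAux, Option.isSome_none, cond_false]
    congr 1
    funext k
    rcases k with _ | _ | _ | i | i <;> simp [hl, outStks, ho, hS]
  | succ n ih =>
    obtain ⟨v, h₁, h₂⟩ := stepAux_popAll (branch Option.isSome
        (load (fun _ => none) (goto fun _ => (Sum.inl Phase.clean : Phase ⊕ c.Lab))) halt) none
        (Finset.univ.erase Stk.out).toList S
    rcases hv : v with _ | w
    · have hS : ∀ k ≠ Stk.out, S k = [] := fun k hk => (h₂.1 hv).2 k (by simp [hk])
      refine ⟨1, by omega, Steps.one ?_⟩
      rw [machine, h₁, hv]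
      simp only [TM2.stepAux, Option.isSome_none, cond_false]
      congr 1
      funext k
      rcases k with _ | _ | _ | i | i <;> simp [hl, outStks, ho, hS]
    · obtain ⟨n', hn', h⟩ := ih
        (fun k => (S k).drop ((Finset.univ.erase Stk.out).toList.count k)) (by simp [hl, ho])
        (fun k hk => by
          have := hn k hk
          simp [hl, hk]; omega)
      refine ⟨1 + n', by omega, (Steps.one ?_).trans h⟩
      rw [machine, h₁, hv]
      simp

theorem steps_machine (C : ℕ) (c : Cmd (Option A)) (x : List A) (t : ℕ) (s : ℕ → ℕ)
    (h : Runs (pad C x) c (fun _ => 0) t s) :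
    ∃ n ≤ 2 * x.length + 2 + t + 1 + ((pad C x).length + 1),
      Steps (machine C c) n ⟨some (.inl .load), none, ioStks _ x [] fun _ => []⟩
        ⟨none, none, outStks A c.maxReg (decide (s 0 ≠ 0))⟩ := by
  have h₁ := steps_load C c x [] 0
  have h₂ := steps_unload C c x.reverse (List.replicate (C * (x.length + 1)) none)
  have h₃ := steps_of_runs h (fun _ => Nat.zero_le _) le_rfl (machine C c) .inr (.inl .answer)
    fun _ => rfl
  rw [List.length_reverse, List.reverse_reverse] at h₂
  simp only [List.append_nil, add_zero, List.replicate_zero] at h₁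
  have hs := h.le_length fun _ => Nat.zero_le _
  have h₄ : Steps (machine C c) 1 ⟨some (.inl .answer), none, stks _ (pad C x) s⟩
      ⟨some (.inl .clean), none,
        update (stks c.maxReg (pad C x) s) .out [decide (s 0 ≠ 0)]⟩ := by
    refine Steps.one ?_
    -- The left stack of head `0` is empty exactly when register `0` is zero; on an empty tape both
    -- hold.
    have hz : (stks c.maxReg (pad C x) s (.lft (reg c.maxReg 0))).head?.isSome =
        decide (s 0 ≠ 0) := by
      simp only [stks, val_reg (Nat.zero_le _)]
      rw [Bool.eq_iff_iff, List.isSome_head?]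
      have := hs 0
      simp only [ne_eq, List.reverse_eq_nil_iff, List.take_eq_nil_iff, decide_eq_true_eq]
      constructor
      · exact fun h h' => h (Or.inl h')
      · rintro h (h' | h')
        · exact h h'
        · rw [h'] at this; exact h (by simpa using this)
    simp only [machine, TM2.stepAux, hz]
    by_cases h0 : s 0 = 0 <;> simp [h0, stks]
  obtain ⟨n, hn, h₅⟩ := steps_clean C c (decide (s 0 ≠ 0)) (pad C x).length
    (update (stks c.maxReg (pad C x) s) .out [decide (s 0 ≠ 0)]) (by simp) (by
      intro k hk
      rcases k with _ | _ | _ | i | i <;> simp [stks] at hk ⊢)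
  exact ⟨_, by omega, (((h₁.trans h₂).trans h₃).trans h₄).trans h₅⟩

/-- A function is computable in polynomial time if its values are computed by a program in
polynomial time. -/
theorem nonempty_tm2ComputableInPolyTime [Fintype A] {α : Type} (enc : α → List A) (f : α → Bool)
    (C : ℕ) (c : Cmd (Option A)) (q : Polynomial ℕ)
    (h : ∀ a, ∃ t ≤ q.eval (pad C (enc a)).length, ∃ s : ℕ → ℕ,
      Runs (pad C (enc a)) c (fun _ => 0) t s ∧ (f a = decide (s 0 ≠ 0))) :
    Nonempty (TM2ComputableInPolyTime enc Computability.encodingBoolBool.encode f) := by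
  let tm : FinTM2 :=
    { K := Stk c.maxReg
      k₀ := .inp
      k₁ := .out
      Γ := StkSym A c.maxReg
      Λ := Phase ⊕ c.Lab
      main := .inl .load
      σ := Option (Option A)
      initialState := none
      Γk₀Fin := inferInstanceAs (Fintype A)
      m := machine C c }
  -- The length of the padded tape in terms of the length of the input.
  let P : Polynomial ℕ := .X + .C C * (.X + 1)
  have hP : ∀ x : List A, P.eval x.length = (pad C x).length := fun x => by simp [P, pad]
  refine ⟨{
    tm := tm
    inputAlphabet := Equiv.refl A
    outputAlphabet := Equiv.refl Bool
    time := 2 * .X + 2 + q.comp P + 1 + (P + 1)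
    outputsFun := fun a => ?_ }⟩
  have ha : ∃ n ≤ (2 * .X + 2 + q.comp P + 1 + (P + 1) : Polynomial ℕ).eval (enc a).length,
      Steps (machine C c) n ⟨some (.inl .load), none, ioStks _ (enc a) [] fun _ => []⟩
        ⟨none, none, outStks A c.maxReg (f a)⟩ := by
    obtain ⟨t, ht, s, hr, hf⟩ := h a
    obtain ⟨n, hn, hs⟩ := steps_machine C c (enc a) t s hr
    refine ⟨n, hn.trans ?_, hf ▸ hs⟩
    simp only [Polynomial.eval_add, Polynomial.eval_mul, Polynomial.eval_ofNat, Polynomial.eval_X,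
      Polynomial.eval_comp, Polynomial.eval_one, hP]
    omega
  have hi : initList tm (enc a) = ⟨some (.inl .load), none, ioStks _ (enc a) [] fun _ => []⟩ := by
    simp only [initList]
    congr 1
    funext k
    rcases k with _ | _ | _ | i | i <;> rfl
  have ho : haltList tm [f a] = ⟨none, none, outStks A c.maxReg (f a)⟩ := by
    simp only [haltList]
    congr 1
    funext k
    rcases k with _ | _ | _ | i | i <;> rfl
  rw [← hi, ← ho] at ha
  refine ⟨⟨ha.choose, ?_⟩, ha.choose_spec.1⟩
  have := ha.choose_spec.2
  rw [show List.map (Equiv.refl A).invFun (enc a) = enc a from List.map_id _]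
  exact this

end Machine

end HeadProg

/-! ### Functions computed by programs in polynomial time -/

namespace HeadProg

open Function

variable {B : Type} [DecidableEq B] {tape : List B}

/-- The program `c` leads from `s` to `s'` in time at most `T`. -/
def RunsIn (tape : List B) (c : Cmd B) (s : ℕ → ℕ) (T : ℕ) (s' : ℕ → ℕ) : Prop :=
  ∃ t ≤ T, Runs tape c s t s'

theorem Runs.runsIn {c : Cmd B} {s s' : ℕ → ℕ} {t : ℕ} (h : Runs tape c s t s') :
    RunsIn tape c s t s' :=
  ⟨t, le_rfl, h⟩

theorem RunsIn.mono {c : Cmd B} {s s' : ℕ → ℕ} {T T' : ℕ} (h : RunsIn tape c s T s')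
    (hT : T ≤ T') : RunsIn tape c s T' s' :=
  h.imp fun _ ht => ⟨ht.1.trans hT, ht.2⟩

theorem RunsIn.congr {c : Cmd B} {s s' s'' : ℕ → ℕ} {T : ℕ} (h : RunsIn tape c s T s')
    (he : s' = s'') : RunsIn tape c s T s'' :=
  he ▸ h

theorem RunsIn.le_length {c : Cmd B} {s s' : ℕ → ℕ} {T : ℕ} (h : RunsIn tape c s T s')
    (hs : ∀ r, s r ≤ tape.length) (r : ℕ) : s' r ≤ tape.length :=
  h.choose_spec.2.le_length hs r

theorem RunsIn.seq {c d : Cmd B} {s s' s'' : ℕ → ℕ} {T T' : ℕ} (h : RunsIn tape c s T s')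
    (h' : RunsIn tape d s' T' s'') : RunsIn tape (.seq c d) s (T + T') s'' := by
  obtain ⟨t, ht, hr⟩ := h
  obtain ⟨t', ht', hr'⟩ := h'
  exact ⟨t + t', add_le_add ht ht', hr.seq hr'⟩

/-- The state after `j` passes is `S j`. The body starts after the decrement, hence with `n - j - 1`
in register `r`. -/
theorem RunsIn.loop {c : Cmd B} {r T n : ℕ} (S : ℕ → ℕ → ℕ) (h₀ : ∀ j ≤ n, S j r = n - j)
    (h : ∀ j < n, RunsIn tape c (update (S j) r (n - j - 1)) T (S (j + 1))) :
    RunsIn tape (.loop r c) (S 0) (n * (T + 1) + 1) (S n) := by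
  induction n generalizing S with
  | zero => exact ⟨1, by simp, .loop_zero (h₀ 0 le_rfl)⟩
  | succ n ih =>
    obtain ⟨t, ht, hr⟩ := h 0 (Nat.succ_pos n)
    obtain ⟨t', ht', hr'⟩ := ih (fun j => S (j + 1))
      (fun j hj => by have := h₀ (j + 1) (by omega); omega)
      (fun j hj => by
        have := h (j + 1) (by omega)
        rwa [show n + 1 - (j + 1) - 1 = n - j - 1 by omega] at this)
    refine ⟨1 + t + t', by rw [Nat.succ_mul]; omega, .loop_pos (by rw [h₀ 0 (by omega)]; omega) ?_ hr'⟩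
    rw [h₀ 0 (by omega)]
    exact hr

theorem RunsIn.dec_zero {s : ℕ → ℕ} {z : ℕ} (hz : s z = 0) : RunsIn tape (.dec z) s 1 s := by
  refine ⟨1, le_rfl, ?_⟩
  convert Runs.dec (tape := tape) z s using 1
  rw [hz, zero_tsub, ← hz, update_eq_self]

/-- Decrementing a register that is zero changes nothing, so `dec z` serves as an empty loop body.
-/
theorem RunsIn.clear {s : ℕ → ℕ} {r z : ℕ} (hz : s z = 0) (hr : r ≠ z)
    (hs : s r ≤ tape.length) :
    RunsIn tape (.loop r (.dec z)) s (2 * tape.length + 1) (update s r 0) := by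
  have := RunsIn.loop (tape := tape) (c := .dec z) (r := r) (T := 1) (n := s r)
    (fun j => update s r (s r - j)) (fun j _ => by simp) (fun j _ => by
      simp only [update_idem]
      rw [show s r - j - 1 = s r - (j + 1) by omega]
      exact RunsIn.dec_zero (by simp [Ne.symm hr, hz]))
  simp only [tsub_zero, update_eq_self, tsub_self] at this
  exact this.mono (by omega)

theorem RunsIn.move {s : ℕ → ℕ} {r r' : ℕ} (hr' : s r' = 0) (hr : r ≠ r')
    (hs : s r ≤ tape.length) :
    RunsIn tape (.loop r (.inc r')) s (2 * tape.length + 1)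
      (update (update s r 0) r' (s r)) := by
  have := RunsIn.loop (tape := tape) (c := .inc r') (r := r) (T := 1) (n := s r)
    (fun j => update (update s r (s r - j)) r' j) (fun j _ => by simp [hr]) (fun j hj => by
      refine ⟨1, le_rfl, ?_⟩
      convert Runs.inc (tape := tape) r' _ using 1
      funext i
      by_cases h1 : i = r'
      · subst h1; simp [Ne.symm hr]; omega
      · by_cases h2 : i = r
        · subst h2; simp [h1]; omega
        · simp [h1, h2])
  simp only [tsub_zero, update_eq_self, tsub_self] at this
  rw [show update s r' 0 = s by rw [← hr', update_eq_self]] at this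
  exact this.mono (by omega)

/-- Copy the register `r` to `b`. -/
def Cmd.copy (r b : ℕ) : Cmd B :=
  .seq (.loop r (.seq (.inc b) (.inc (b + 1)))) (.loop (b + 1) (.inc r))

/-- Reading a register by a loop destroys it, so it is poured into two registers and restored from
one of them. -/
theorem RunsIn.copy {s : ℕ → ℕ} {r b : ℕ} (hr : r < b) (h₀ : s b = 0) (h₁ : s (b + 1) = 0)
    (hs : ∀ r, s r ≤ tape.length) :
    RunsIn tape (.copy r b) s (5 * tape.length + 2) (update s b (s r)) := by
  have hb : b + 1 ≠ b := by omega
  have hr1 : r ≠ b + 1 := by omega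
  have h := RunsIn.loop (tape := tape) (c := .seq (.inc b) (.inc (b + 1))) (r := r) (T := 2)
    (n := s r) (fun j => update (update (update s r (s r - j)) b j) (b + 1) j)
    (fun j _ => by simp [hr.ne, hr1]) (fun j hj => by
      refine ⟨2, le_rfl, ?_⟩
      have := hs r
      convert (Runs.inc (tape := tape) b _).seq (Runs.inc (tape := tape) (b + 1) _) using 1
      funext i
      by_cases h1 : i = b + 1
      · subst h1; simp [Ne.symm hr1]; omega
      · by_cases h2 : i = b
        · subst h2; simp [hr.ne']; omega
        · by_cases h3 : i = r
          · subst h3; simp [h1, h2]; omega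
          · simp [h1, h2, h3])
  simp only [tsub_zero, update_eq_self, tsub_self] at h
  rw [show update s b 0 = s by rw [← h₀, update_eq_self],
    show update s (b + 1) 0 = s by rw [← h₁, update_eq_self]] at h
  have h' := RunsIn.move (tape := tape)
    (s := update (update (update s r 0) b (s r)) (b + 1) (s r)) (r := b + 1) (r' := r)
    (by simp [hr.ne, hr1]) (Ne.symm hr1) (by simpa using hs r)
  refine ((h.seq h').mono (by have := hs r; omega)).congr ?_
  funext i
  by_cases h1 : i = r
  · subst h1; simp [hr.ne]
  · by_cases h2 : i = b + 1
    · subst h2; simp [h1, h₁]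
    · by_cases h3 : i = b
      · subst h3; simp [h1]
      · simp [h1, h2, h3]

/-- Write a list to the registers from `b` on. -/
def put (s : ℕ → ℕ) (b : ℕ) (l : List ℕ) : ℕ → ℕ := fun r =>
  if r < b then s r else l.getD (r - b) (s r)

theorem put_of_lt {s : ℕ → ℕ} {b : ℕ} {l : List ℕ} {r : ℕ} (h : r < b) : put s b l r = s r :=
  if_pos h

theorem put_of_ge {s : ℕ → ℕ} {b : ℕ} {l : List ℕ} {r : ℕ} (h : b + l.length ≤ r) :
    put s b l r = s r := by
  rw [put]
  split_ifs
  · rfl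
  · rw [List.getD_eq_default _ _ (by omega)]

theorem put_add {s : ℕ → ℕ} {b : ℕ} {l : List ℕ} {i : ℕ} (h : i < l.length) :
    put s b l (b + i) = l[i] := by
  rw [put, if_neg (by omega), Nat.add_sub_cancel_left, List.getD_eq_getElem _ _ h]

theorem put_zero_of_ge {s : ℕ → ℕ} {b : ℕ} {l : List ℕ} (hz : ∀ r ≥ b, s r = 0) :
    ∀ r ≥ b + l.length, put s b l r = 0 := fun r hr => by
  rw [put_of_ge hr, hz r (by omega)]

theorem put_nil {s : ℕ → ℕ} {b : ℕ} : put s b [] = s :=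
  funext fun r => by simp [put]

theorem put_singleton {s : ℕ → ℕ} {b v : ℕ} : put s b [v] = update s b v := by
  funext r
  rcases lt_trichotomy r b with h | rfl | h
  · rw [put_of_lt h, update_of_ne h.ne]
  · simp [put]
  · rw [put_of_ge (by simpa using h), update_of_ne h.ne']

theorem put_append {s : ℕ → ℕ} {b : ℕ} {l l' : List ℕ} :
    put (put s b l) (b + l.length) l' = put s b (l ++ l') := by
  funext r
  rcases lt_or_ge r b with h | h
  · rw [put_of_lt (by omega), put_of_lt h, put_of_lt h]
  obtain ⟨i, rfl⟩ := Nat.exists_eq_add_of_le h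
  rcases lt_or_ge i l.length with h' | h'
  · rw [put_of_lt (by omega), put_add h', put_add (by simp; omega), List.getElem_append_left h']
  · obtain ⟨j, rfl⟩ := Nat.exists_eq_add_of_le h'
    rcases lt_or_ge j l'.length with h'' | h''
    · rw [← add_assoc, put_add h'', add_assoc, put_add (by simp; omega)]
      simp
    · rw [put_of_ge (by omega), put_of_ge (by omega), put_of_ge (by simp; omega)]

theorem map_put_of_lt {s : ℕ → ℕ} {b : ℕ} {l ins : List ℕ} (h : ∀ r ∈ ins, r < b) :
    ins.map (put s b l) = ins.map s :=
  List.map_congr_left fun r hr => put_of_lt (h r hr)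

theorem map_put_range' {s : ℕ → ℕ} {b : ℕ} {l : List ℕ} :
    (List.range' b l.length).map (put s b l) = l := by
  refine List.ext_getElem (by simp) fun i h₁ h₂ => ?_
  simp only [List.getElem_map, List.getElem_range', one_mul]
  exact put_add h₂

/-- Clear the `k` registers from `b` on, where the register `z` is zero. -/
def Cmd.clearBlock (z : ℕ) : ℕ → ℕ → Cmd B
  | _, 0 => .dec z
  | b, k + 1 => .seq (.loop b (.dec z)) (clearBlock z (b + 1) k)

theorem RunsIn.clearBlock {s : ℕ → ℕ} {z b k : ℕ} (hz : s z = 0) (hb : b + k ≤ z)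
    (hs : ∀ r, s r ≤ tape.length) :
    RunsIn tape (.clearBlock z b k) s (k * (2 * tape.length + 1) + 1)
      (fun r => if b ≤ r ∧ r < b + k then 0 else s r) := by
  induction k generalizing s b with
  | zero =>
    refine ((RunsIn.dec_zero hz).mono (by omega)).congr ?_
    funext r
    rw [if_neg (by omega)]
  | succ k ih =>
    have h₁ := RunsIn.clear (tape := tape) hz (show b ≠ z by omega) (hs b)
    have h₂ := ih (s := update s b 0) (b := b + 1) (by simp [show z ≠ b by omega, hz]) (by omega)
      (update_le hs (Nat.zero_le _))
    refine ((h₁.seq h₂).mono (by rw [Nat.add_one_mul k]; omega)).congr ?_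
    funext r
    by_cases hr : r = b
    · subst hr; simp
    · rw [if_congr (show (b + 1 ≤ r ∧ r < b + 1 + k) ↔ (b ≤ r ∧ r < b + (k + 1)) by omega) rfl rfl,
        update_of_ne hr]

/-- Move the contents of `k` registers from `b + d` on to the registers from `b` on. -/
def Cmd.moveBlock (d : ℕ) : ℕ → ℕ → Cmd B
  | b, 0 => .dec b
  | b, k + 1 => .seq (.loop (b + d) (.inc b)) (moveBlock d (b + 1) k)

/-- The gap of `d` zero registers travels along: once a register has been moved down, its old place
is zero, so the next target is free as well. -/
theorem RunsIn.moveBlock {s : ℕ → ℕ} {d b k : ℕ} (hd : 0 < d)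
    (hz : ∀ r, b ≤ r → r < b + d → s r = 0) (hs : ∀ r, s r ≤ tape.length) :
    RunsIn tape (.moveBlock d b k) s (k * (2 * tape.length + 1) + 1)
      (fun r => if b ≤ r ∧ r < b + k then s (r + d)
        else if b + k ≤ r ∧ r < b + k + d then 0 else s r) := by
  induction k generalizing s b with
  | zero =>
    refine ((RunsIn.dec_zero (hz b le_rfl (by omega))).mono (by omega)).congr ?_
    funext r
    rw [if_neg (by omega)]
    split_ifs with h
    · exact hz r (by omega) (by omega)
    · rfl
  | succ k ih =>
    have h₁ := RunsIn.move (tape := tape) (hz b le_rfl (by omega)) (show b + d ≠ b by omega) (hs _)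
    have h₂ := ih (b := b + 1) (s := update (update s (b + d) 0) b (s (b + d)))
      (by
        intro r hr hr'
        rw [update_of_ne (by omega)]
        by_cases h : r = b + d
        · rw [h, update_self]
        · rw [update_of_ne h, hz r (by omega) (by omega)])
      (update_le (update_le hs (Nat.zero_le _)) (hs _))
    refine ((h₁.seq h₂).mono (by rw [Nat.add_one_mul k]; omega)).congr ?_
    funext r
    rcases eq_or_ne r b with rfl | h
    · rw [if_neg (by omega), if_neg (by omega), if_pos (by omega), update_self]
    by_cases h₁ : b ≤ r ∧ r < b + (k + 1)
    · rw [if_pos (by omega), if_pos h₁, update_of_ne (by omega), update_of_ne (by omega)]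
    rw [if_neg (by omega), if_neg h₁]
    by_cases h₂ : b + (k + 1) ≤ r ∧ r < b + (k + 1) + d
    · rw [if_pos (by omega), if_pos h₂]
    · rw [if_neg (by omega), if_neg h₂, update_of_ne h, update_of_ne (by omega)]

/-- Copy the registers in a list to the registers from `b` on. -/
def Cmd.copyAll : List ℕ → ℕ → Cmd B
  | [], b => .dec b
  | r :: l, b => .seq (.copy r b) (copyAll l (b + 1))

theorem RunsIn.copyAll {s : ℕ → ℕ} {l : List ℕ} {b : ℕ} (hl : ∀ r ∈ l, r < b)
    (hz : ∀ r ≥ b, s r = 0) (hs : ∀ r, s r ≤ tape.length) :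
    RunsIn tape (.copyAll l b) s (l.length * (5 * tape.length + 2) + 1) (put s b (l.map s)) := by
  induction l generalizing s b with
  | nil =>
    exact ((RunsIn.dec_zero (hz b le_rfl)).mono (by omega)).congr (by rw [List.map_nil, put_nil])
  | cons r l ih =>
    have h₁ := RunsIn.copy (tape := tape) (hl r (by simp)) (hz b le_rfl) (hz (b + 1) (by omega)) hs
    have hlt : ∀ r ∈ l, r < b := fun r hr => hl r (by simp [hr])
    have h₂ := ih (s := update s b (s r)) (b := b + 1) (fun r hr => (hlt r hr).trans (by omega))
      (fun r hr => by rw [update_of_ne (by omega), hz r (by omega)]) (update_le hs (hs _))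
    refine ((h₁.seq h₂).mono (by rw [List.length_cons, Nat.add_one_mul l.length]; omega)).congr ?_
    rw [List.map_congr_left fun r hr => update_of_ne (hlt r hr).ne _ _]
    rw [← put_singleton]
    exact put_append (l := [s r])

/-! ### Calling convention, composition and primitive recursion -/

/-- Data that are stored in a fixed number of registers. -/
class Dat (α : Type) where
  /-- the contents of the registers -/
  enc : α → List ℕ
  /-- the number of registers -/
  size : ℕ
  length_enc : ∀ a, (enc a).length = size

open Dat (enc)

instance : Dat ℕ := ⟨fun n => [n], 1, fun _ => rfl⟩

instance : Dat Bool := ⟨fun b => [b.toNat], 1, fun _ => rfl⟩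

instance : Dat Unit := ⟨fun _ => [], 0, fun _ => rfl⟩

instance {α β : Type} [Dat α] [Dat β] : Dat (α × β) :=
  ⟨fun p => enc p.1 ++ enc p.2, Dat.size α + Dat.size β, fun p => by simp [Dat.length_enc]⟩

variable {α β γ : Type} [Dat α] [Dat β] [Dat γ]

/-- The function `f` is computed by a program in polynomial time: when the registers in the list
`ins` hold the argument, and those from `b` on are zero, then the program writes the value to the
registers from `b` on. -/
def PolyComp (f : List B → α → β) : Prop :=
  ∃ (P : List ℕ → ℕ → Cmd B) (q : Polynomial ℕ) (C : ℕ),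
    ∀ (tape : List B) (a : α) (ins : List ℕ) (b : ℕ) (s : ℕ → ℕ), C ≤ tape.length →
      (∀ r, s r ≤ tape.length) → (∀ r ≥ b, s r = 0) → (∀ r ∈ ins, r < b) → ins.map s = enc a →
      RunsIn tape (P ins b) s (q.eval tape.length) (put s b (enc (f tape a)))

theorem PolyComp.slice (g : α → β) (i : ℕ)
    (hg : ∀ a, enc (g a) = ((enc a).drop i).take (Dat.size β)) :
    PolyComp (B := B) fun _ a => g a := by
  refine ⟨fun ins b => .copyAll ((ins.drop i).take (Dat.size β)) b,
    .C (Dat.size β) * (5 * .X + 2) + 1, 0, fun tape a ins b s _ hs hz hi he => ?_⟩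
  have h := RunsIn.copyAll (tape := tape) (s := s) (l := (ins.drop i).take (Dat.size β)) (b := b)
    (fun r hr => hi r (List.mem_of_mem_drop (List.mem_of_mem_take hr))) hz hs
  refine (h.mono ?_).congr ?_
  · simp only [Polynomial.eval_add, Polynomial.eval_mul, Polynomial.eval_C, Polynomial.eval_ofNat,
      Polynomial.eval_X, Polynomial.eval_one]
    gcongr
    exact List.length_take_le _ _
  · rw [hg, ← he, List.map_take, List.map_drop]

/-- The tape must have at least `n` cells, since otherwise the increments would be cut off; this is
the purpose of the constant `C` in `PolyComp`. -/
theorem PolyComp.const (n : ℕ) : PolyComp (B := B) fun _ (_ : α) => n := by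
  refine ⟨fun _ b => Nat.rec (.dec b) (fun _ c => .seq c (.inc b)) n, .C (n + 1), n,
    fun tape a ins b s hn hs hz hi he => ?_⟩
  rw [Polynomial.eval_C]
  change RunsIn tape _ s (n + 1) (put s b [n])
  rw [put_singleton]
  clear he
  induction n with
  | zero =>
    exact (RunsIn.dec_zero (hz b le_rfl)).congr (by rw [← hz b le_rfl, update_eq_self])
  | succ n ih =>
    refine RunsIn.seq (ih (by omega)) ⟨1, le_rfl, ?_⟩
    convert Runs.inc (tape := tape) b _ using 1
    rw [update_idem, update_self, min_eq_left hn]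

theorem PolyComp.length : PolyComp (B := B) fun t (_ : α) => t.length := by
  refine ⟨fun _ b => .top b, .X + 1, 0, fun tape a ins b s _ hs hz hi he => ?_⟩
  change RunsIn tape _ s _ (put s b [_])
  rw [put_singleton]
  exact ⟨_, by simp, Runs.top b s⟩

theorem PolyComp.succ {f : List B → α → ℕ} (hf : PolyComp f) :
    PolyComp fun t a => min (f t a + 1) t.length := by
  obtain ⟨P, q, C, h⟩ := hf
  refine ⟨fun ins b => .seq (P ins b) (.inc b), q + 1, C,
    fun tape a ins b s hC hs hz hi he => ?_⟩
  have h₁ := h tape a ins b s hC hs hz hi he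
  rw [Polynomial.eval_add, Polynomial.eval_one]
  refine h₁.seq ⟨1, le_rfl, ?_⟩
  change Runs tape _ (put s b [_]) _ (put s b [_])
  rw [put_singleton, put_singleton]
  convert Runs.inc (tape := tape) b _ using 1
  simp

theorem PolyComp.pred {f : List B → α → ℕ} (hf : PolyComp f) :
    PolyComp fun t a => f t a - 1 := by
  obtain ⟨P, q, C, h⟩ := hf
  refine ⟨fun ins b => .seq (P ins b) (.dec b), q + 1, C,
    fun tape a ins b s hC hs hz hi he => ?_⟩
  have h₁ := h tape a ins b s hC hs hz hi he
  rw [Polynomial.eval_add, Polynomial.eval_one]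
  refine h₁.seq ⟨1, le_rfl, ?_⟩
  change Runs tape _ (put s b [_]) _ (put s b [_])
  rw [put_singleton, put_singleton]
  convert Runs.dec (tape := tape) b _ using 1
  simp

theorem PolyComp.test (x : B) {f : List B → α → ℕ} (hf : PolyComp f) :
    PolyComp fun t a => decide (t[f t a]? = some x) := by
  obtain ⟨P, q, C, h⟩ := hf
  -- The position is computed in `b + 1`, so that `b` is still zero when the test increments it.
  refine ⟨fun ins b => .seq (P ins (b + 1)) (.seq (.test x (b + 1) b) (.loop (b + 1) (.dec (b + 2)))),
    q + (1 + (2 * .X + 1)), C, fun tape a ins b s hC hs hz hi he => ?_⟩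
  have h₁ := h tape a ins (b + 1) s hC hs (fun r hr => hz r (by omega))
    (fun r hr => (hi r hr).trans (by omega)) he
  simp only [Polynomial.eval_add, Polynomial.eval_one, Polynomial.eval_mul, Polynomial.eval_ofNat,
    Polynomial.eval_X]
  have hle := h₁.le_length hs
  change RunsIn tape _ _ _ (put s (b + 1) [_]) at h₁
  have hle : ∀ r, put s (b + 1) [f tape a] r ≤ tape.length := hle
  rw [put_singleton] at h₁ hle
  refine h₁.seq ((Runs.test _ _ _ _).runsIn.seq
    ((RunsIn.clear ?_ (by omega) ?_).congr ?_))
  · have h2 := hz (b + 2) (by omega)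
    split_ifs <;> simp [h2]
  · split_ifs
    · exact update_le hle (min_le_right _ _) _
    · exact hle _
  · change _ = put s b [_]
    rw [put_singleton]
    have hb := hz b le_rfl
    have hb1 := hz (b + 1) (by omega)
    have hu : update s (b + 1) 0 = s := by rw [← hb1, update_eq_self]
    have hu' : update s b 0 = s := by rw [← hb, update_eq_self]
    simp only [update_self]
    by_cases hx : tape[f tape a]? = some x
    · obtain ⟨hlt, -⟩ := List.getElem?_eq_some_iff.1 hx
      simp only [hx, if_true, decide_true, Bool.toNat_true]
      rw [update_of_ne (by omega), hb, min_eq_left (by omega), update_comm (by omega), update_idem,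
        hu]
    · simp [hx, hu, hu']

theorem PolyComp.pair {f : List B → α → β} {g : List B → α → γ} (hf : PolyComp f)
    (hg : PolyComp g) : PolyComp fun t a => (f t a, g t a) := by
  obtain ⟨P, q, C, h⟩ := hf
  obtain ⟨P', q', C', h'⟩ := hg
  refine ⟨fun ins b => .seq (P ins b) (P' ins (b + Dat.size β)), q + q', max C C',
    fun tape a ins b s hC hs hz hi he => ?_⟩
  have h₁ := h tape a ins b s ((le_max_left _ _).trans hC) hs hz hi he
  have h₂ := h' tape a ins (b + Dat.size β) (put s b (enc (f tape a)))
    ((le_max_right _ _).trans hC) (h₁.le_length hs)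
    (by rw [← Dat.length_enc (f tape a)]; exact put_zero_of_ge hz)
    (fun r hr => (hi r hr).trans_le (by omega)) (by rw [map_put_of_lt hi, he])
  rw [Polynomial.eval_add]
  refine (h₁.seq h₂).congr ?_
  rw [← Dat.length_enc (f tape a), put_append]
  rfl

/-- The value of `f` is stored above `b`, used as argument of `g` and erased, and the value of `g`
is moved down. The extra register `b` keeps the shift `1 + Dat.size β` positive even if `β` occupies
no registers. -/
theorem PolyComp.comp {g : List B → β → γ} {f : List B → α → β} (hg : PolyComp g)
    (hf : PolyComp f) : PolyComp fun t a => g t (f t a) := by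
  obtain ⟨P, q, C, h⟩ := hf
  obtain ⟨P', q', C', h'⟩ := hg
  refine ⟨fun ins b => .seq (P ins (b + 1)) (.seq
      (P' (List.range' (b + 1) (Dat.size β)) (b + 1 + Dat.size β)) (.seq
      (.clearBlock (b + 1 + Dat.size β + Dat.size γ) (b + 1) (Dat.size β))
      (.moveBlock (1 + Dat.size β) b (Dat.size γ)))),
    q + (q' + ((.C (Dat.size β) * (2 * .X + 1) + 1) + (.C (Dat.size γ) * (2 * .X + 1) + 1))),
    max C C', fun tape a ins b s hC hs hz hi he => ?_⟩
  have h₁ := h tape a ins (b + 1) s ((le_max_left _ _).trans hC) hs (fun r hr => hz r (by omega))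
    (fun r hr => (hi r hr).trans (by omega)) he
  have hl := Dat.length_enc (f tape a)
  have hl' := Dat.length_enc (g tape (f tape a))
  have hz₁ := put_zero_of_ge (l := enc (f tape a)) (fun r (hr : r ≥ b + 1) => hz r (by omega))
  rw [hl] at hz₁
  have h₂ := h' tape (f tape a) (List.range' (b + 1) (Dat.size β)) (b + 1 + Dat.size β)
    (put s (b + 1) (enc (f tape a))) ((le_max_right _ _).trans hC) (h₁.le_length hs) hz₁
    (fun r hr => by rw [List.mem_range'_1] at hr; omega) (by rw [← hl, map_put_range'])
  have hz₂ := put_zero_of_ge (l := enc (g tape (f tape a))) hz₁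
  rw [hl'] at hz₂
  have h₃ := RunsIn.clearBlock (tape := tape) (hz₂ _ le_rfl) (b := b + 1) (k := Dat.size β)
    (by omega) (h₂.le_length (h₁.le_length hs))
  have h₄ := RunsIn.moveBlock (tape := tape) (d := 1 + Dat.size β) (b := b) (k := Dat.size γ)
    (s := fun r => if b + 1 ≤ r ∧ r < b + 1 + Dat.size β then 0 else
      put (put s (b + 1) (enc (f tape a))) (b + 1 + Dat.size β) (enc (g tape (f tape a))) r)
    (by omega) (by
      intro r hr hr'
      split_ifs with h
      · rfl
      · rw [put_of_lt (by omega), put_of_lt (by omega), hz r hr])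
    (h₃.le_length (h₂.le_length (h₁.le_length hs)))
  simp only [Polynomial.eval_add, Polynomial.eval_mul, Polynomial.eval_C, Polynomial.eval_ofNat,
    Polynomial.eval_X, Polynomial.eval_one]
  refine (h₁.seq (h₂.seq (h₃.seq h₄))).congr ?_
  funext r
  rcases lt_or_ge r b with hr | hr
  · rw [if_neg (by omega), if_neg (by omega), if_neg (by omega), put_of_lt (by omega),
      put_of_lt (by omega), put_of_lt hr]
  obtain ⟨i, rfl⟩ := Nat.exists_eq_add_of_le hr
  rcases lt_or_ge i (Dat.size γ) with hi' | hi'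
  · rw [if_pos (by omega), if_neg (by omega),
      show b + i + (1 + Dat.size β) = b + 1 + Dat.size β + i by omega, put_add (hl' ▸ hi'),
      put_add (hl' ▸ hi')]
  · have : put s b (enc (g tape (f tape a))) (b + i) = 0 := by
      rw [put_of_ge (by omega), hz _ (by omega)]
    rw [if_neg (by omega), this]
    split_ifs with h₁ h₂
    · rfl
    · rfl
    · rw [put_of_ge (by omega), put_of_ge (by omega), hz _ (by omega)]

/-- The number of passes is the content of a register, hence at most the length of the tape, and the
running value always fills the same number of registers; so the time remains polynomial however
deeply recursions are nested. Register `b` counts down, `b + 1` holds the index, and the running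
value begins at `b + 2`. -/
theorem PolyComp.rec {x : List B → α → ℕ} {f : List B → α → β} {g : List B → α × ℕ × β → β}
    (hx : PolyComp x) (hf : PolyComp f) (hg : PolyComp g) :
    PolyComp fun t a => (Nat.rec (f t a) (fun y z => g t (a, y, z)) (x t a) : β) := by
  obtain ⟨Px, qx, Cx, hx⟩ := hx
  obtain ⟨Pf, qf, Cf, hf⟩ := hf
  obtain ⟨Pg, qg, Cg, hg⟩ := hg
  let l := Dat.size β
  refine ⟨fun ins b => .seq (Px ins b) (.seq (Pf ins (b + 2)) (.seq
      (.loop b (.seq (Pg (ins ++ (b + 1) :: List.range' (b + 2) l) (b + 2 + l + 1))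
        (.seq (.clearBlock (b + 2 + l) (b + 2) l) (.seq (.moveBlock (l + 1) (b + 2) l)
          (.inc (b + 1))))))
      (.seq (.loop (b + 1) (.dec b)) (.moveBlock 2 b l)))),
    qx + (qf + ((.X * (qg + ((.C l * (2 * .X + 1) + 1) + ((.C l * (2 * .X + 1) + 1) + 1)) + 1) + 1)
      + ((2 * .X + 1) + (.C l * (2 * .X + 1) + 1)))),
    max Cx (max Cf Cg), fun tape a ins b s hC hs hz hi he => ?_⟩
  have hl : ∀ z : β, (enc z).length = l := Dat.length_enc
  set n := x tape a with hn
  set st : ℕ → β := fun j => Nat.rec (f tape a) (fun y z => g tape (a, y, z)) j with hst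
  set S : ℕ → ℕ → ℕ := fun j => put (update (update s b (n - j)) (b + 1) j) (b + 2) (enc (st j))
    with hS
  have h₁ := hx tape a ins b s (by omega) hs hz hi he
  change RunsIn _ _ _ _ (put s b [n]) at h₁
  rw [put_singleton] at h₁
  have hs₁ := h₁.le_length hs
  have hnM : n ≤ tape.length := by simpa using hs₁ b
  have h₂ := hf tape a ins (b + 2) (update s b n) (by omega) hs₁
    (fun r hr => by rw [update_of_ne (by omega), hz r (by omega)])
    (fun r hr => (hi r hr).trans (by omega))
    (by rw [← he]; exact List.map_congr_left fun r hr => update_of_ne (hi r hr).ne _ _)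
  have hs₂ := h₂.le_length hs₁
  have hS0 : put (update s b n) (b + 2) (enc (f tape a)) = S 0 := by
    simp only [hS, tsub_zero]
    congr 1
    have : (0 : ℕ) = update s b n (b + 1) := by rw [update_of_ne (by omega), hz _ (by omega)]
    rw [this, update_eq_self]
  rw [hS0] at h₂ hs₂
  have hSz : ∀ j, ∀ r ≥ b + 2 + l, S j r = 0 := fun j r hr => by
    simp only [hS]
    rw [put_of_ge (by rw [hl]; omega), update_of_ne (by omega), update_of_ne (by omega),
      hz _ (by omega)]
  have hstep : ∀ j < n, (∀ r, S j r ≤ tape.length) →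
      RunsIn tape (.seq (Pg (ins ++ (b + 1) :: List.range' (b + 2) l) (b + 2 + l + 1))
        (.seq (.clearBlock (b + 2 + l) (b + 2) l) (.seq (.moveBlock (l + 1) (b + 2) l)
          (.inc (b + 1))))) (update (S j) b (n - j - 1))
        (qg.eval tape.length + ((l * (2 * tape.length + 1) + 1) +
          ((l * (2 * tape.length + 1) + 1) + 1))) (S (j + 1)) := by
    intro j hj hle
    have hle' : ∀ r, update (S j) b (n - j - 1) r ≤ tape.length := update_le hle (by omega)
    have hz' : ∀ r ≥ b + 2 + l, update (S j) b (n - j - 1) r = 0 := fun r hr => by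
      rw [update_of_ne (by omega), hSz j r hr]
    have e₁ : (ins ++ (b + 1) :: List.range' (b + 2) l).map (update (S j) b (n - j - 1)) =
        enc (a, j, st j) := by
      rw [List.map_append, List.map_cons]
      change _ = enc a ++ (j :: enc (st j))
      congr 1
      · rw [← he]
        refine List.map_congr_left fun r hr => ?_
        have := hi r hr
        simp only [hS]
        rw [update_of_ne (by omega), put_of_lt (by omega), update_of_ne (by omega),
          update_of_ne (by omega)]
      · congr 1
        · simp only [hS]
          rw [update_of_ne (by omega), put_of_lt (by omega), update_self]
        · rw [← hl (st j), List.map_congr_left (g := S j)]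
          · exact map_put_range'
          · intro r hr
            rw [List.mem_range'_1] at hr
            rw [update_of_ne (by omega)]
    have g₁ := hg tape (a, j, st j) (ins ++ (b + 1) :: List.range' (b + 2) l) (b + 2 + l + 1)
      (update (S j) b (n - j - 1)) (by omega) hle' (fun r hr => hz' r (by omega))
      (fun r hr => by
        simp only [List.mem_append, List.mem_cons, List.mem_range'_1] at hr
        rcases hr with hr | hr | hr
        · have := hi r hr; omega
        · omega
        · omega) e₁
    have e₂ : g tape (a, j, st j) = st (j + 1) := rfl
    rw [e₂] at g₁
    -- The new value was written one register further up, leaving `b + 2 + l` zero for use in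
    -- erasing the old value.
    have g₂ := RunsIn.clearBlock (tape := tape) (z := b + 2 + l) (b := b + 2) (k := l)
      (s := put (update (S j) b (n - j - 1)) (b + 2 + l + 1) (enc (st (j + 1))))
      (by rw [put_of_lt (by omega), hz' _ le_rfl]) le_rfl (g₁.le_length hle')
    have g₃ := RunsIn.moveBlock (tape := tape) (d := l + 1) (b := b + 2) (k := l)
      (s := fun r => if b + 2 ≤ r ∧ r < b + 2 + l then 0 else
        put (update (S j) b (n - j - 1)) (b + 2 + l + 1) (enc (st (j + 1))) r) (by omega)
      (by
        intro r hr hr'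
        split_ifs with h
        · rfl
        · rw [put_of_lt (by omega), hz' _ (by omega)])
      (g₂.le_length (g₁.le_length hle'))
    refine (g₁.seq (g₂.seq (g₃.seq (Runs.inc _ _).runsIn))).congr ?_
    funext r
    rcases lt_or_ge r (b + 2) with hr | hr
    · have e₃ : S (j + 1) r = update (update s b (n - (j + 1))) (b + 1) (j + 1) r := put_of_lt hr
      have e₄ : ∀ r < b + 2, S j r = update (update s b (n - j)) (b + 1) j r :=
        fun r hr => put_of_lt hr
      rw [e₃]
      by_cases h1 : r = b + 1
      · subst h1
        rw [update_self, update_self, if_neg (by omega), if_neg (by omega), if_neg (by omega),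
          put_of_lt (by omega), update_of_ne (by omega), e₄ _ (by omega), update_self]
        omega
      · rw [update_of_ne h1, update_of_ne h1, if_neg (by omega), if_neg (by omega),
          if_neg (by omega), put_of_lt (by omega)]
        by_cases h2 : r = b
        · subst h2; rw [update_self, update_self]; omega
        · rw [update_of_ne h2, update_of_ne h2, e₄ _ hr, update_of_ne h1, update_of_ne h2]
    · rw [update_of_ne (by omega)]
      obtain ⟨i, rfl⟩ := Nat.exists_eq_add_of_le hr
      rcases lt_or_ge i l with hi' | hi'
      · have : i < (enc (st (j + 1))).length := by rw [hl]; exact hi'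
        rw [if_pos (by omega), if_neg (by omega),
          show b + 2 + i + (l + 1) = b + 2 + l + 1 + i by omega, put_add this]
        simp only [hS]
        rw [put_add this]
      · rw [if_neg (by omega), hSz _ _ (by omega)]
        split_ifs with c₁ c₂
        · rfl
        · rfl
        · rw [put_of_ge (by rw [hl]; omega), hz' _ (by omega)]
  have hSle : ∀ j ≤ n, ∀ r, S j r ≤ tape.length := by
    intro j
    induction j with
    | zero => exact fun _ => hs₂
    | succ j ih =>
      intro hj
      have := ih (by omega)
      exact (hstep j (by omega) this).le_length (update_le this (by omega))
  have hSb : ∀ j, S j b = n - j := fun j => by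
    simp only [hS]
    rw [put_of_lt (by omega), update_of_ne (by omega), update_self]
  have h₃ := RunsIn.loop (tape := tape) S (n := n) (fun j _ => hSb j)
    fun j hj => hstep j hj (hSle j hj.le)
  have hsn := hSle n le_rfl
  -- The counter `b` has run down to zero and now serves to clear the index.
  have h₄ := RunsIn.clear (tape := tape) (s := S n) (r := b + 1) (z := b)
    (by rw [hSb, tsub_self]) (by omega) (hsn _)
  have h₅ := RunsIn.moveBlock (tape := tape) (d := 2) (b := b) (k := l)
    (s := update (S n) (b + 1) 0) (by omega) (by
      intro r hr hr'
      by_cases h1 : r = b + 1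
      · subst h1; simp
      · rw [update_of_ne h1, show r = b by omega, hSb, tsub_self])
    (update_le hsn (Nat.zero_le _))
  refine ((h₁.seq (h₂.seq (h₃.seq (h₄.seq h₅)))).mono ?_).congr ?_
  · simp only [Polynomial.eval_add, Polynomial.eval_mul, Polynomial.eval_C, Polynomial.eval_ofNat,
      Polynomial.eval_X, Polynomial.eval_one]
    gcongr
  · change _ = put s b (enc (st n))
    funext r
    rcases lt_or_ge r b with hr | hr
    · rw [if_neg (by omega), if_neg (by omega), put_of_lt hr, update_of_ne (by omega)]
      simp only [hS]
      rw [put_of_lt (by omega), update_of_ne (by omega), update_of_ne (by omega)]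
    · obtain ⟨i, rfl⟩ := Nat.exists_eq_add_of_le hr
      rcases lt_or_ge i l with hi' | hi'
      · have : i < (enc (st n)).length := by rw [hl]; exact hi'
        rw [if_pos (by omega), put_add this, update_of_ne (by omega),
          show b + i + 2 = b + 2 + i by omega]
        simp only [hS]
        rw [put_add this]
      · rw [if_neg (by omega), put_of_ge (by rw [hl]; omega), hz _ (by omega)]
        split_ifs with c₁
        · rfl
        · rw [update_of_ne (by omega), hSz _ _ (by omega)]

end HeadProg

/-! ### Logic, modular arithmetic, bounded quantifiers and folds over the tape -/

namespace HeadProg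

open Dat (enc)

variable {B : Type}

theorem le_of_pair {t : List B} {p : ℕ × ℕ} (h : ∀ v ∈ enc p, v ≤ t.length) :
    p.1 ≤ t.length ∧ p.2 ≤ t.length :=
  ⟨h _ (List.mem_append_left _ (List.mem_singleton_self p.1)),
    h _ (List.mem_append_right _ (List.mem_singleton_self p.2))⟩

theorem le_of_triple {t : List B} {p : ℕ × ℕ × ℕ} (h : ∀ v ∈ enc p, v ≤ t.length) :
    p.1 ≤ t.length ∧ p.2.1 ≤ t.length ∧ p.2.2 ≤ t.length :=
  ⟨h _ (List.mem_append_left _ (List.mem_singleton_self p.1)),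
    le_of_pair fun v hv => h v (List.mem_append_right _ hv)⟩

/-- Increase a residue modulo `m + 1`. -/
theorem rec_succMod {n m z : ℕ} {t : List B} (hm : m ≤ t.length) :
    (Nat.rec (z % (m + 1)) (fun _ z => if decide (z = m) = true then 0 else min (z + 1) t.length) n
      : ℕ) = (z + n) % (m + 1) := by
  induction n with
  | zero => rfl
  | succ n ih =>
    dsimp only
    rw [ih]
    have := Nat.mod_lt (z + n) (show 0 < m + 1 by omega)
    by_cases h : (z + n) % (m + 1) = m
    · rw [if_pos (by simpa using h)]
      rw [← add_assoc, Nat.add_mod, h]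
      rcases m with _ | m
      · simp
      · rw [Nat.mod_eq_of_lt (a := 1) (by omega), Nat.mod_self]
    · rw [if_neg (by simpa using h), min_eq_left (by omega), ← add_assoc, Nat.add_mod (z + n)]
      rw [Nat.mod_eq_of_lt (a := 1) (by omega)]
      exact (Nat.mod_eq_of_lt (by omega)).symm

variable [DecidableEq B] {α β γ : Type} [Dat α] [Dat β] [Dat γ]

namespace PolyComp

/-- Two functions of which one is computable are equal if they agree on arguments that fit on the
tape. -/
theorem congr {f g : List B → α → β} (hf : PolyComp f)
    (h : ∀ t a, (∀ v ∈ enc a, v ≤ t.length) → f t a = g t a) : PolyComp g := by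
  obtain ⟨P, q, C, hP⟩ := hf
  refine ⟨P, q, C, fun tape a ins b s hC hs hz hi he => ?_⟩
  rw [← h tape a]
  · exact hP tape a ins b s hC hs hz hi he
  · intro v hv
    rw [← he] at hv
    obtain ⟨r, -, rfl⟩ := List.mem_map.1 hv
    exact hs r

theorem of_enc {f : List B → α → β} {g : List B → α → γ} (hf : PolyComp f)
    (h : ∀ t a, enc (g t a) = enc (f t a)) : PolyComp g := by
  obtain ⟨P, q, C, hP⟩ := hf
  refine ⟨P, q, C, fun tape a ins b s hC hs hz hi he => ?_⟩
  rw [h]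
  exact hP tape a ins b s hC hs hz hi he

theorem arg : PolyComp (B := B) fun _ (a : α) => a :=
  slice (fun a => a) 0 fun a => by rw [List.drop_zero, List.take_of_length_le (Dat.length_enc a).le]

theorem fst {f : List B → α → β × γ} (hf : PolyComp f) : PolyComp fun t a => (f t a).1 :=
  (slice (B := B) (fun p : β × γ => p.1) 0 fun p => by
    rw [List.drop_zero]
    exact (List.take_left' (Dat.length_enc p.1)).symm).comp hf

theorem snd {f : List B → α → β × γ} (hf : PolyComp f) : PolyComp fun t a => (f t a).2 :=
  (slice (B := B) (fun p : β × γ => p.2) (Dat.size β) fun p => by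
    have : (enc p).drop (Dat.size β) = enc p.2 := List.drop_left' (Dat.length_enc p.1)
    rw [this, List.take_of_length_le (Dat.length_enc p.2).le]).comp hf

theorem toNat {f : List B → α → Bool} (hf : PolyComp f) : PolyComp fun t a => (f t a).toNat :=
  hf.of_enc fun _ _ => rfl

theorem bool (b : Bool) : PolyComp (B := B) fun _ (_ : α) => b :=
  (const b.toNat).of_enc fun _ _ => rfl

/-- A recursion of length `0` or `1`: no pass yields `g`, one pass yields `f`. -/
theorem ite {c : List B → α → Bool} {f g : List B → α → β} (hc : PolyComp c) (hf : PolyComp f)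
    (hg : PolyComp g) : PolyComp fun t a => if c t a = true then f t a else g t a := by
  refine (hc.toNat.rec hg (g := fun t p => f t p.1) (hf.comp arg.fst)).congr fun t a _ => ?_
  cases c t a <;> rfl

theorem not {c : List B → α → Bool} (hc : PolyComp c) : PolyComp fun t a => !c t a :=
  (hc.ite (bool false) (bool true)).congr fun t a _ => by cases c t a <;> rfl

theorem and {c d : List B → α → Bool} (hc : PolyComp c) (hd : PolyComp d) :
    PolyComp fun t a => c t a && d t a :=
  (hc.ite hd (bool false)).congr fun t a _ => by cases c t a <;> rfl

theorem or {c d : List B → α → Bool} (hc : PolyComp c) (hd : PolyComp d) :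
    PolyComp fun t a => c t a || d t a :=
  (hc.ite (bool true) hd).congr fun t a _ => by cases c t a <;> rfl

theorem sub {f g : List B → α → ℕ} (hf : PolyComp f) (hg : PolyComp g) :
    PolyComp fun t a => f t a - g t a := by
  refine (hg.rec hf (g := fun _ p => p.2.2 - 1) arg.snd.snd.pred).congr fun t a _ => ?_
  induction g t a with
  | zero => rfl
  | succ n ih => exact (congrArg (· - 1) ih).trans (Nat.sub_sub _ _ _)

theorem eq_zero {f : List B → α → ℕ} (hf : PolyComp f) : PolyComp fun t a => decide (f t a = 0) := by
  refine (hf.rec (bool true) (g := fun _ _ => false) (bool false)).congr fun t a _ => ?_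
  cases f t a <;> rfl

theorem le {f g : List B → α → ℕ} (hf : PolyComp f) (hg : PolyComp g) :
    PolyComp fun t a => decide (f t a ≤ g t a) :=
  (hf.sub hg).eq_zero.congr fun t a _ => by
    rw [Bool.eq_iff_iff, decide_eq_true_iff, decide_eq_true_iff, Nat.sub_eq_zero_iff_le]

theorem lt {f g : List B → α → ℕ} (hf : PolyComp f) (hg : PolyComp g) :
    PolyComp fun t a => decide (f t a < g t a) :=
  (hg.le hf).not.congr fun t a _ => by rw [← decide_not, decide_eq_decide, not_le]

theorem eq {f g : List B → α → ℕ} (hf : PolyComp f) (hg : PolyComp g) :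
    PolyComp fun t a => decide (f t a = g t a) :=
  ((hf.le hg).and (hg.le hf)).congr fun t a _ => by simp [le_antisymm_iff]

theorem add {f g : List B → α → ℕ} (hf : PolyComp f) (hg : PolyComp g) :
    PolyComp fun t a => min (f t a + g t a) t.length := by
  -- Proved for a pair held in registers, because `congr` bounds arguments only; composition then
  -- places the values of `f` and `g` in registers.
  have : PolyComp (B := B) fun t (p : ℕ × ℕ) => min (p.1 + p.2) t.length := by
    refine (arg.snd.rec arg.fst (g := fun t p => min (p.2.2 + 1) t.length)
      arg.snd.snd.succ).congr fun t p hp => ?_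
    have := (le_of_pair hp).1
    obtain ⟨x, y⟩ := p
    induction y with
    | zero => exact (min_eq_left this).symm
    | succ n ih =>
      have ih := ih fun v hv => by
        rcases List.mem_append.1 hv with hv | hv
        · exact hp v (List.mem_append_left _ hv)
        · rw [List.mem_singleton.1 hv]
          exact (Nat.le_succ n).trans (le_of_pair hp).2
      exact (congrArg (fun z => min (z + 1) t.length) (ih this)).trans (by dsimp only; omega)
  exact this.comp (hf.pair hg)

/-- Counting cyclically through the residues never exceeds `m`, which fits on the tape, so no
cut-off occurs. The first summand is reduced by counting from zero, then the second is counted on.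
-/
theorem addMod {m f g : List B → α → ℕ} (hm : PolyComp m) (hf : PolyComp f) (hg : PolyComp g) :
    PolyComp fun t a => (f t a + g t a) % (m t a + 1) := by
  have h₁ : PolyComp (B := B) fun t (p : ((ℕ × ℕ × ℕ) × ℕ × ℕ)) =>
      if decide (p.2.2 = p.1.1) = true then 0 else min (p.2.2 + 1) t.length :=
    (arg.snd.snd.eq arg.fst.fst).ite (const 0) arg.snd.snd.succ
  have h₂ : PolyComp (B := B) fun _ (p : ℕ × ℕ × ℕ) => p.2.1 % (p.1 + 1) := by
    refine (arg.snd.fst.rec (const 0) h₁).congr fun t p hp => ?_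
    have := rec_succMod (n := p.2.1) (z := 0) (le_of_triple hp).1
    simpa using this
  have h₃ : PolyComp (B := B) fun _ (p : ℕ × ℕ × ℕ) => (p.2.1 + p.2.2) % (p.1 + 1) :=
    (arg.snd.snd.rec h₂ h₁).congr fun t p hp => rec_succMod (le_of_triple hp).1
  exact h₃.comp (hm.pair (hf.pair hg))

theorem mulMod {m f g : List B → α → ℕ} (hm : PolyComp m) (hf : PolyComp f) (hg : PolyComp g) :
    PolyComp fun t a => (f t a * g t a) % (m t a + 1) := by
  refine (hf.rec (const 0) (g := fun t (p : α × ℕ × ℕ) => (p.2.2 + g t p.1) % (m t p.1 + 1))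
    (addMod (hm.comp arg.fst) arg.snd.snd (hg.comp arg.fst))).congr fun t a _ => ?_
  induction f t a with
  | zero => simp
  | succ n ih =>
    dsimp only at ih ⊢
    rw [ih, Nat.mod_add_mod, Nat.add_one_mul]

theorem forall_lt {f : List B → α → ℕ} {P : List B → α → ℕ → Bool} (hf : PolyComp f)
    (hP : PolyComp fun t (p : α × ℕ) => P t p.1 p.2) :
    PolyComp fun t a => decide (∀ k < f t a, P t a k = true) := by
  refine (hf.rec (bool true) (g := fun t (p : α × ℕ × Bool) => p.2.2 && P t p.1 p.2.1)
    (arg.snd.snd.and (hP.comp (arg.fst.pair arg.snd.fst)))).congr fun t a _ => ?_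
  induction f t a with
  | zero => simp
  | succ n ih =>
    dsimp only at ih ⊢
    rw [ih, Bool.eq_iff_iff, decide_eq_true_iff, Nat.forall_lt_succ_right]
    simp

theorem exists_lt {f : List B → α → ℕ} {P : List B → α → ℕ → Bool} (hf : PolyComp f)
    (hP : PolyComp fun t (p : α × ℕ) => P t p.1 p.2) :
    PolyComp fun t a => decide (∃ k < f t a, P t a k = true) :=
  (forall_lt (P := fun t a k => !P t a k) hf hP.not).not.congr fun t a _ => by
    rw [Bool.eq_iff_iff]; simp

theorem list_all {ι : Type} (l : List ι) {P : ι → List B → α → Bool} (hP : ∀ i, PolyComp (P i)) :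
    PolyComp fun t a => l.all fun i => P i t a := by
  induction l with
  | nil => exact bool true
  | cons i l ih => exact (hP i).and ih

theorem list_any {ι : Type} (l : List ι) {P : ι → List B → α → Bool} (hP : ∀ i, PolyComp (P i)) :
    PolyComp fun t a => l.any fun i => P i t a := by
  induction l with
  | nil => exact bool false
  | cons i l ih => exact (hP i).or ih

theorem foldl {f : List B → α → β} {g : List B → α → B → β → β} (hf : PolyComp f)
    (hg : PolyComp fun t (p : α × ℕ × β) =>
      t[p.2.1]?.elim p.2.2 fun x => g t p.1 x p.2.2) :
    PolyComp fun t a => t.foldl (fun z x => g t a x z) (f t a) := by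
  refine (length.rec hf hg).congr fun t a _ => ?_
  suffices ∀ n ≤ t.length, (Nat.rec (f t a)
      (fun y z => t[y]?.elim z fun x => g t a x z) n : β) =
      (t.take n).foldl (fun z x => g t a x z) (f t a) by
    have := this t.length le_rfl
    rwa [List.take_length] at this
  intro n hn
  induction n with
  | zero => rfl
  | succ n ih =>
    rw [List.take_succ_eq_append_getElem (by omega), List.foldl_append, ← ih (by omega)]
    simp [List.getElem?_eq_getElem (show n < t.length by omega)]

/-- Before each increment the count is at most the number of cells read, which is below the length
of the tape, so it is never cut off. -/
theorem countP (x : B) : PolyComp fun t (_ : α) => t.countP fun y => decide (y = x) := by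
  refine (length.rec (const 0) (g := fun t (p : α × ℕ × ℕ) =>
    if decide (t[p.2.1]? = some x) = true then min (p.2.2 + 1) t.length else p.2.2)
    ((arg.snd.fst.test x).ite arg.snd.snd.succ arg.snd.snd)).congr fun t a _ => ?_
  suffices ∀ n ≤ t.length, (Nat.rec 0 (fun y z =>
      if decide (t[y]? = some x) = true then min (z + 1) t.length else z) n : ℕ) =
      (t.take n).countP fun y => decide (y = x) by
    have := this t.length le_rfl
    rwa [List.take_length] at this
  intro n hn
  induction n with
  | zero => rfl
  | succ n ih =>
    rw [List.take_succ_eq_append_getElem (by omega), List.countP_append, ← ih (by omega)]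
    have h : (t.take n).countP (fun y => decide (y = x)) ≤ n :=
      List.countP_le_length.trans (by simp)
    dsimp only
    rw [ih (by omega), List.getElem?_eq_getElem (show n < t.length by omega)]
    by_cases hx : t[n] = x
    · simp [hx]; omega
    · simp [hx]

/-- Definition by cases on the symbol under a head. -/
theorem on_symbol {f : List B → α → ℕ} (hf : PolyComp f) (l : List B) {F : B → List B → α → β}
    {d : List B → α → β} (hF : ∀ x ∈ l, PolyComp (F x)) (hd : PolyComp d)
    (hl : ∀ x ∉ l, ∀ t a, F x t a = d t a) :
    PolyComp fun t a => t[f t a]?.elim (d t a) fun x => F x t a := by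
  have h : PolyComp fun t a => (l.foldr
      (fun x r => if decide (t[f t a]? = some x) = true then F x t a else r) (d t a) : β) := by
    clear hl
    induction l with
    | nil => exact hd
    | cons x l ih =>
      exact (hf.test x).ite (hF x (by simp)) (ih fun x hx => hF x (by simp [hx]))
  refine h.congr fun t a _ => ?_
  rcases ht : t[f t a]? with _ | y
  · clear hl hF h
    cases l with
    | nil => rfl
    | cons x l => simp
  · by_cases hy : y ∈ l
    · clear hl hF h
      induction l with
      | nil => simp at hy
      | cons x l ih =>
        by_cases hx : y = x
        · simp [hx]
        · simpa [hx] using ih (by simpa [hx] using hy)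
    · simp only [Option.elim_some, hl y hy]
      clear hl hF h
      induction l with
      | nil => rfl
      | cons x l ih =>
        simp only [List.mem_cons, not_or] at hy
        simpa [hy.1] using ih hy.2

/-- A finite table. -/
theorem table {f : List B → α → ℕ} (hf : PolyComp f) (l : List β) (x : List B → α → β)
    (hx : PolyComp x) (hl : ∀ b ∈ l, PolyComp (B := B) fun _ (_ : α) => b) :
    PolyComp fun t a => l.getD (f t a) (x t a) := by
  induction l generalizing f with
  | nil => simpa using hx
  | cons b l ih =>
    refine (hf.eq_zero.ite (hl b (by simp)) (ih hf.pred fun b hb => hl b (by simp [hb]))).congr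
      fun t a _ => ?_
    cases f t a <;> simp

end PolyComp

end HeadProg

namespace HeadProg

open Dat (enc)

/-! ### Evaluating presented polynomials in one pass over the tape -/

/-- The symbols on the tape. -/
abbrev Cell : Type := Option (SysSym ⊕ Bool)

/-- The cell in which a symbol of the presented system is written. -/
def cell (s : SysSym) : Cell := some (Sum.inl s)

/-- The number of occurrences of a symbol of the presented system. -/
def cellCount (t : List Cell) (s : SysSym) : ℕ := t.countP fun x => decide (x = cell s)

/-- Operations on the numbers that occur in the evaluation. -/
structure Ops (R : Type) where
  zero : R
  one : R
  add : R → R → R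
  mul : R → R → R
  neg : R → R
  succ : ℕ → ℕ

/-- The state of the evaluation: the numbers `k`, `c`, `i` of polynomials, coordinates and variables
read so far (since the beginning of the system, the term, the monomial), flags (reading a monomial,
reading a denominator, negative coordinate, term not zero), the current power of two, the numerator
and denominator of the current coordinate, and those of the value. -/
structure EvalState (R : Type) where
  k : ℕ
  c : ℕ
  i : ℕ
  mono : Bool
  den : Bool
  neg : Bool
  sel : Bool
  pow : R
  a : R
  b : R
  S : R
  P : R

/-- The state before reading a term. -/
def EvalState.clean {R : Type} (o : Ops R) (k : ℕ) (S P : R) : EvalState R :=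
  ⟨k, 0, 0, false, false, false, true, o.one, o.zero, o.zero, S, P⟩

/-- The evaluation of the coordinate `j` of the `n`-th polynomial at the point `pt`. -/
def evalStep {R : Type} (o : Ops R) (n j : ℕ) (pt : ℕ → Bool) : SysSym → EvalState R → EvalState R
  | .var, st => st
  | .bit x, st =>
    if st.mono then { st with i := o.succ st.i, sel := st.sel && (!x || pt st.i) }
    else if decide (st.c = j) then
      if st.den then
        { st with b := if x then o.add st.b st.pow else st.b, pow := o.add st.pow st.pow }
      else { st with a := if x then o.add st.a st.pow else st.a, pow := o.add st.pow st.pow }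
    else st
  | .neg, st => if decide (st.c = j) then { st with neg := true } else st
  | .slash, st => { st with den := true, pow := o.one }
  | .endCoord, st => { st with c := o.succ st.c, den := false, pow := o.one }
  | .mono, st => { st with mono := true }
  | .endTerm, st =>
    if decide (st.k = n) && (st.sel && decide (j < st.c)) then
      .clean o st.k (o.add (o.mul st.S st.b) (o.mul (if st.neg then o.neg st.a else st.a) st.P))
        (o.mul st.P st.b)
    else .clean o st.k st.S st.P
  | .endPoly, st => { st with k := o.succ st.k }

/-- Reading a cell of the tape. -/
def evalCell {R : Type} (o : Ops R) (n j : ℕ) (pt : ℕ → Bool) (x : Cell) (st : EvalState R) :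
    EvalState R :=
  match x with
  | some (.inl s) => evalStep o n j pt s st
  | _ => st

/-- Computation modulo `m + 1`, with counters bounded by `M`. -/
def modOps (M m : ℕ) : Ops ℕ where
  zero := 0
  -- Written as a sum so as to be an instance of `PolyComp.addMod`; modulo `1` it is zero.
  one := (0 + 1) % (m + 1)
  add x y := (x + y) % (m + 1)
  mul x y := (x * y) % (m + 1)
  -- Modulo `m + 1` the number `m` is `-1`.
  neg x := (m * x) % (m + 1)
  succ n := min (n + 1) M

/-- The state after the evaluation of a coordinate of a polynomial modulo `m + 1`. -/
def evalTape (t : List Cell) (n j : ℕ) (pt : ℕ → Bool) (m : ℕ) : EvalState ℕ :=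
  t.foldl (fun st x => evalCell (modOps t.length m) n j pt x st)
    (.clean (modOps t.length m) 0 0 ((0 + 1) % (m + 1)))

/-- The components of a state. -/
def EvalState.toProd (st : EvalState ℕ) :
    ℕ × ℕ × ℕ × Bool × Bool × Bool × Bool × ℕ × ℕ × ℕ × ℕ × ℕ :=
  (st.k, st.c, st.i, st.mono, st.den, st.neg, st.sel, st.pow, st.a, st.b, st.S, st.P)

instance : Dat (EvalState ℕ) where
  enc st := enc st.toProd
  size := Dat.size (ℕ × ℕ × ℕ × Bool × Bool × Bool × Bool × ℕ × ℕ × ℕ × ℕ × ℕ)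
  length_enc st := Dat.length_enc st.toProd

variable {α : Type} [Dat α]

/-! ### Computability of the evaluation -/

namespace PolyComp

section

variable {st : List Cell → α → EvalState ℕ}

theorem toProd (h : PolyComp st) : PolyComp fun t a => (st t a).toProd :=
  h.of_enc fun _ _ => rfl

theorem st_k (h : PolyComp st) : PolyComp fun t a => (st t a).k := h.toProd.fst
theorem st_c (h : PolyComp st) : PolyComp fun t a => (st t a).c := h.toProd.snd.fst
theorem st_i (h : PolyComp st) : PolyComp fun t a => (st t a).i := h.toProd.snd.snd.fst
theorem st_mono (h : PolyComp st) : PolyComp fun t a => (st t a).mono := h.toProd.snd.snd.snd.fst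
theorem st_den (h : PolyComp st) : PolyComp fun t a => (st t a).den :=
  h.toProd.snd.snd.snd.snd.fst
theorem st_neg (h : PolyComp st) : PolyComp fun t a => (st t a).neg :=
  h.toProd.snd.snd.snd.snd.snd.fst
theorem st_sel (h : PolyComp st) : PolyComp fun t a => (st t a).sel :=
  h.toProd.snd.snd.snd.snd.snd.snd.fst
theorem st_pow (h : PolyComp st) : PolyComp fun t a => (st t a).pow :=
  h.toProd.snd.snd.snd.snd.snd.snd.snd.fst
theorem st_a (h : PolyComp st) : PolyComp fun t a => (st t a).a :=
  h.toProd.snd.snd.snd.snd.snd.snd.snd.snd.fst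
theorem st_b (h : PolyComp st) : PolyComp fun t a => (st t a).b :=
  h.toProd.snd.snd.snd.snd.snd.snd.snd.snd.snd.fst
theorem st_S (h : PolyComp st) : PolyComp fun t a => (st t a).S :=
  h.toProd.snd.snd.snd.snd.snd.snd.snd.snd.snd.snd.fst
theorem st_P (h : PolyComp st) : PolyComp fun t a => (st t a).P :=
  h.toProd.snd.snd.snd.snd.snd.snd.snd.snd.snd.snd.snd

end

theorem mk {k c i pow a b S P : List Cell → α → ℕ} {mono den neg sel : List Cell → α → Bool}
    (hk : PolyComp k) (hc : PolyComp c) (hi : PolyComp i) (hmono : PolyComp mono)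
    (hden : PolyComp den) (hneg : PolyComp neg) (hsel : PolyComp sel) (hpow : PolyComp pow)
    (ha : PolyComp a) (hb : PolyComp b) (hS : PolyComp S) (hP : PolyComp P) :
    PolyComp fun t x => (⟨k t x, c t x, i t x, mono t x, den t x, neg t x, sel t x, pow t x, a t x,
      b t x, S t x, P t x⟩ : EvalState ℕ) :=
  (hk.pair (hc.pair (hi.pair (hmono.pair (hden.pair (hneg.pair (hsel.pair (hpow.pair (ha.pair
    (hb.pair (hS.pair hP))))))))))).of_enc fun _ _ => rfl

theorem mod_one {m : List Cell → α → ℕ} (hm : PolyComp m) :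
    PolyComp fun t a => (0 + 1) % (m t a + 1) :=
  addMod hm (const 0) (const 1)

theorem clean {k m S P : List Cell → α → ℕ} (hm : PolyComp m) (hk : PolyComp k) (hS : PolyComp S)
    (hP : PolyComp P) :
    PolyComp fun t a => EvalState.clean (modOps t.length (m t a)) (k t a) (S t a) (P t a) :=
  mk hk (const 0) (const 0) (bool false) (bool false) (bool false) (bool true) (mod_one hm) (const 0)
    (const 0) hS hP

theorem evalStep {st : List Cell → α → EvalState ℕ} {n j m : List Cell → α → ℕ}
    {pt : List Cell → α → ℕ → Bool} (h : PolyComp st) (hn : PolyComp n) (hj : PolyComp j)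
    (hm : PolyComp m) (hpt : PolyComp fun t (p : α × ℕ) => pt t p.1 p.2) (s : SysSym) :
    PolyComp fun t a =>
      evalStep (modOps t.length (m t a)) (n t a) (j t a) (pt t a) s (st t a) := by
  have hcj := h.st_c.eq hj
  have h2 := addMod hm h.st_pow h.st_pow
  cases s with
  | var => exact h
  | bit x =>
    refine h.st_mono.ite (mk h.st_k h.st_c h.st_i.succ h.st_mono h.st_den h.st_neg
      (h.st_sel.and ((bool (!x)).or (hpt.comp (arg.pair h.st_i)))) h.st_pow h.st_a h.st_b h.st_S
      h.st_P) (hcj.ite (h.st_den.ite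
        (mk h.st_k h.st_c h.st_i h.st_mono h.st_den h.st_neg h.st_sel h2 h.st_a
          (ite (bool x) (addMod hm h.st_b h.st_pow) h.st_b) h.st_S h.st_P)
        (mk h.st_k h.st_c h.st_i h.st_mono h.st_den h.st_neg h.st_sel h2
          (ite (bool x) (addMod hm h.st_a h.st_pow) h.st_a) h.st_b h.st_S h.st_P)) h)
  | neg =>
    exact hcj.ite (mk h.st_k h.st_c h.st_i h.st_mono h.st_den (bool true) h.st_sel h.st_pow h.st_a
      h.st_b h.st_S h.st_P) h
  | slash =>
    exact mk h.st_k h.st_c h.st_i h.st_mono (bool true) h.st_neg h.st_sel (mod_one hm) h.st_a h.st_b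
      h.st_S h.st_P
  | endCoord =>
    exact mk h.st_k h.st_c.succ h.st_i h.st_mono (bool false) h.st_neg h.st_sel (mod_one hm) h.st_a
      h.st_b h.st_S h.st_P
  | mono =>
    exact mk h.st_k h.st_c h.st_i (bool true) h.st_den h.st_neg h.st_sel h.st_pow h.st_a h.st_b
      h.st_S h.st_P
  | endTerm =>
    exact ((h.st_k.eq hn).and (h.st_sel.and (hj.lt h.st_c))).ite
      (clean hm h.st_k (addMod hm (mulMod hm h.st_S h.st_b)
        (mulMod hm (h.st_neg.ite (mulMod hm hm h.st_a) h.st_a) h.st_P)) (mulMod hm h.st_P h.st_b))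
      (clean hm h.st_k h.st_S h.st_P)
  | endPoly =>
    exact mk h.st_k.succ h.st_c h.st_i h.st_mono h.st_den h.st_neg h.st_sel h.st_pow h.st_a h.st_b
      h.st_S h.st_P

theorem evalTape {n j m : List Cell → α → ℕ} {pt : List Cell → α → ℕ → Bool}
    (hn : PolyComp n) (hj : PolyComp j) (hpt : PolyComp fun t (p : α × ℕ) => pt t p.1 p.2)
    (hm : PolyComp m) :
    PolyComp fun t a => evalTape t (n t a) (j t a) (pt t a) (m t a) := by
  refine PolyComp.foldl (g := fun t a x st =>
    evalCell (modOps t.length (m t a)) (n t a) (j t a) (pt t a) x st)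
    (clean hm (const 0) (const 0) (mod_one hm)) ?_
  -- Cases over the finitely many cells with a symbol of the system; blanks and certificate bits
  -- leave the state unchanged.
  refine on_symbol (α := α × ℕ × EvalState ℕ) (f := fun _ p => p.2.1) arg.snd.fst
    ((Finset.univ : Finset SysSym).toList.map cell) ?_ arg.snd.snd ?_
  · intro x hx
    obtain ⟨s, -, rfl⟩ := List.mem_map.1 hx
    exact evalStep (α := α × ℕ × EvalState ℕ) (pt := fun t p => pt t p.1) arg.snd.snd
      (hn.comp arg.fst) (hj.comp arg.fst) (hm.comp arg.fst)
      (hpt.comp (arg.fst.fst.pair arg.snd)) s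
  · intro x hx t a
    rcases x with _ | s | b
    · rfl
    · exact absurd (List.mem_map_of_mem (by simp)) hx
    · rfl

end PolyComp

/-! ### The decision procedure -/

/-- The values of the `n`-th polynomial at `pt` and the `n'`-th at `pt'` are different in the
coordinate `j` modulo `m + 1`. -/
def differMod (t : List Cell) (n : ℕ) (pt : ℕ → Bool) (n' : ℕ) (pt' : ℕ → Bool) (j m : ℕ) : Bool :=
  !decide (((evalTape t n j pt m).S * (evalTape t n' j pt' m).P) % (m + 1) =
    ((evalTape t n' j pt' m).S * (evalTape t n j pt m).P) % (m + 1))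

/-- The value of the `n`-th polynomial at `pt` is different from that of the `n'`-th at `pt'`. -/
def differ (t : List Cell) (n : ℕ) (pt : ℕ → Bool) (n' : ℕ) (pt' : ℕ → Bool) : Bool :=
  decide (∃ j < t.length, decide (∃ m < t.length, differMod t n pt n' pt' j m = true) = true)

/-- The value of the `n`-th polynomial at `pt` is not zero in the coordinate `j` modulo `m + 1`. -/
def nonzeroMod (t : List Cell) (n : ℕ) (pt : ℕ → Bool) (j m : ℕ) : Bool :=
  !decide ((evalTape t n j pt m).S = 0)

/-- The point `pt` is not a common zero. -/
def noZero (t : List Cell) (pt : ℕ → Bool) : Bool :=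
  -- Numbers `n` beyond the last polynomial evaluate to zero, so letting `n` run up to the length of
  -- the tape is harmless.
  decide (∃ n < t.length, decide (∃ j < t.length, decide (∃ m < t.length,
    nonzeroMod t n pt j m = true) = true) = true)

/-- The point given by the bits that are written from the position `p` on. -/
def bitsAt (t : List Cell) (p i : ℕ) : Bool :=
  decide (t[min (p + i) t.length]? = some (cell (.bit true)))

/-- The `n`-th polynomial, permuted by `σ`, is different from the `n'`-th polynomial at the points
that correspond to the position `p`; here `σ'` is the inverse of `σ`. -/
def movedAt (t : List Cell) (σ σ' : ℕ → ℕ) (n n' p : ℕ) : Bool :=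
  -- The first comparison serves the monomials of the `n'`-th polynomial, the second those of the
  -- `n`-th.
  differ t n (fun i => bitsAt t p (σ i)) n' (bitsAt t p) ||
    differ t n (bitsAt t p) n' fun i => bitsAt t p (σ' i)

/-- The permutation `σ` with inverse `σ'` maps a polynomial to one that is not in the system. -/
def moved (t : List Cell) (σ σ' : ℕ → ℕ) : Bool :=
  decide (∃ n < cellCount t .endPoly, decide (∀ n' < cellCount t .endPoly,
    decide (∃ p < t.length, movedAt t σ σ' n n' p = true) = true) = true)

/-- The swap of `x` and `y`. -/
def swapNat (x y i : ℕ) : ℕ :=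
  if decide (i = x) then y else if decide (i = y) then x else i

/-- A function on `Fin n`, extended to the natural numbers. -/
def extend {R : Type} {n : ℕ} (d : R) (f : Fin n → R) (i : ℕ) : R := (List.ofFn f).getD i d

/-- The decision for systems in many variables. -/
def decideLarge (t : List Cell) : Bool :=
  decide (∃ x < cellCount t .var, decide (∃ y < cellCount t .var,
    moved t (swapNat x y) (swapNat x y) = true) = true) ||
  decide (∀ r < t.length, noZero t (fun i => decide (i < r)) = true)

/-- The decision for systems in `n` variables. -/
noncomputable def decideSmall (c n : ℕ) (t : List Cell) : Bool :=
  -- The stabilizer misses more than `c` permutations iff it is disjoint from some set of `c + 1`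
  -- permutations; for fixed `n` and `c` there are finitely many such sets, and they can be
  -- hard-wired.
  ((Finset.univ : Finset (Equiv.Perm (Fin n))).powersetCard (c + 1)).toList.any (fun T =>
    T.toList.all fun σ => moved t (extend 0 fun i => (σ i : ℕ)) (extend 0 fun i => (σ⁻¹ i : ℕ))) ||
  (Finset.univ : Finset (Fin n → Bool)).toList.all fun x => noZero t (extend false x)

/-- The decision procedure. -/
noncomputable def decideTape (c n : ℕ) (t : List Cell) : Bool :=
  -- The value `true` means that the system belongs to the complementary problem.
  if decide (n ≤ cellCount t .var) then decideLarge t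
  else (List.range n).any fun k => decide (cellCount t .var = k) && decideSmall c k t

/-! ### Computability of the decision procedure -/

namespace PolyComp

theorem cellCount (s : SysSym) : PolyComp fun t (_ : α) => cellCount t s :=
  countP (cell s)

theorem differMod {n n' j m : List Cell → α → ℕ} {pt pt' : List Cell → α → ℕ → Bool}
    (hn : PolyComp n) (hpt : PolyComp fun t (p : α × ℕ) => pt t p.1 p.2) (hn' : PolyComp n')
    (hpt' : PolyComp fun t (p : α × ℕ) => pt' t p.1 p.2) (hj : PolyComp j) (hm : PolyComp m) :
    PolyComp fun t a => differMod t (n t a) (pt t a) (n' t a) (pt' t a) (j t a) (m t a) := by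
  have h₁ := evalTape hn hj hpt hm
  have h₂ := evalTape hn' hj hpt' hm
  exact ((mulMod hm h₁.st_S h₂.st_P).eq (mulMod hm h₂.st_S h₁.st_P)).not

theorem differ {n n' : List Cell → α → ℕ} {pt pt' : List Cell → α → ℕ → Bool} (hn : PolyComp n)
    (hpt : PolyComp fun t (p : α × ℕ) => pt t p.1 p.2) (hn' : PolyComp n')
    (hpt' : PolyComp fun t (p : α × ℕ) => pt' t p.1 p.2) :
    PolyComp fun t a => differ t (n t a) (pt t a) (n' t a) (pt' t a) := by
  refine exists_lt (P := fun t a j => decide (∃ m < t.length,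
    HeadProg.differMod t (n t a) (pt t a) (n' t a) (pt' t a) j m = true)) length ?_
  refine exists_lt (α := α × ℕ) (P := fun t a m =>
    HeadProg.differMod t (n t a.1) (pt t a.1) (n' t a.1) (pt' t a.1) a.2 m) length ?_
  exact differMod (α := (α × ℕ) × ℕ) (pt := fun t a => pt t a.1.1) (pt' := fun t a => pt' t a.1.1)
    (hn.comp arg.fst.fst) (hpt.comp (arg.fst.fst.fst.pair arg.snd)) (hn'.comp arg.fst.fst)
    (hpt'.comp (arg.fst.fst.fst.pair arg.snd)) arg.fst.snd arg.snd

theorem noZero {pt : List Cell → α → ℕ → Bool}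
    (hpt : PolyComp fun t (p : α × ℕ) => pt t p.1 p.2) :
    PolyComp fun t a => noZero t (pt t a) := by
  refine exists_lt (P := fun t a n => decide (∃ j < t.length, decide (∃ m < t.length,
    nonzeroMod t n (pt t a) j m = true) = true)) length ?_
  refine exists_lt (α := α × ℕ) (P := fun t a j => decide (∃ m < t.length,
    nonzeroMod t a.2 (pt t a.1) j m = true)) length ?_
  refine exists_lt (α := (α × ℕ) × ℕ) (P := fun t a m =>
    nonzeroMod t a.1.2 (pt t a.1.1) a.2 m) length ?_
  exact (evalTape (α := ((α × ℕ) × ℕ) × ℕ) (pt := fun t p => pt t p.1.1.1) arg.fst.fst.snd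
    arg.fst.snd (hpt.comp (arg.fst.fst.fst.fst.pair arg.snd)) arg.snd).st_S.eq_zero.not

theorem bitsAt {p i : List Cell → α → ℕ} (hp : PolyComp p) (hi : PolyComp i) :
    PolyComp fun t a => bitsAt t (p t a) (i t a) :=
  (hp.add hi).test _

theorem movedAt {σ σ' : List Cell → α → ℕ → ℕ} {n n' p : List Cell → α → ℕ}
    (hσ : PolyComp fun t (p : α × ℕ) => σ t p.1 p.2)
    (hσ' : PolyComp fun t (p : α × ℕ) => σ' t p.1 p.2) (hn : PolyComp n) (hn' : PolyComp n')
    (hp : PolyComp p) : PolyComp fun t a => movedAt t (σ t a) (σ' t a) (n t a) (n' t a) (p t a) :=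
  (differ (pt := fun t a i => HeadProg.bitsAt t (p t a) (σ t a i))
    (pt' := fun t a => HeadProg.bitsAt t (p t a)) hn (bitsAt (hp.comp arg.fst) hσ) hn'
    (bitsAt (hp.comp arg.fst) arg.snd)).or
  (differ (pt := fun t a => HeadProg.bitsAt t (p t a))
    (pt' := fun t a i => HeadProg.bitsAt t (p t a) (σ' t a i)) hn
    (bitsAt (hp.comp arg.fst) arg.snd) hn' (bitsAt (hp.comp arg.fst) hσ'))

theorem moved {σ σ' : List Cell → α → ℕ → ℕ} (hσ : PolyComp fun t (p : α × ℕ) => σ t p.1 p.2)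
    (hσ' : PolyComp fun t (p : α × ℕ) => σ' t p.1 p.2) :
    PolyComp fun t a => moved t (σ t a) (σ' t a) := by
  refine exists_lt (P := fun t a n => decide (∀ n' < HeadProg.cellCount t .endPoly,
    decide (∃ p < t.length, HeadProg.movedAt t (σ t a) (σ' t a) n n' p = true) = true))
    (cellCount _) ?_
  refine forall_lt (α := α × ℕ) (P := fun t a n' => decide (∃ p < t.length,
    HeadProg.movedAt t (σ t a.1) (σ' t a.1) a.2 n' p = true)) (cellCount _) ?_
  refine exists_lt (α := (α × ℕ) × ℕ) (P := fun t a p =>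
    HeadProg.movedAt t (σ t a.1.1) (σ' t a.1.1) a.1.2 a.2 p) length ?_
  exact movedAt (α := ((α × ℕ) × ℕ) × ℕ) (σ := fun t a => σ t a.1.1.1)
    (σ' := fun t a => σ' t a.1.1.1) (hσ.comp (arg.fst.fst.fst.fst.pair arg.snd))
    (hσ'.comp (arg.fst.fst.fst.fst.pair arg.snd)) arg.fst.fst.snd arg.fst.snd arg.snd

theorem swapNat {x y i : List Cell → α → ℕ} (hx : PolyComp x) (hy : PolyComp y)
    (hi : PolyComp i) : PolyComp fun t a => swapNat (x t a) (y t a) (i t a) :=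
  (hi.eq hx).ite hy ((hi.eq hy).ite hx hi)

theorem decideLarge : PolyComp fun t (_ : α) => decideLarge t := by
  refine or ?_ ?_
  · refine exists_lt (P := fun t _ x => decide (∃ y < HeadProg.cellCount t .var,
      HeadProg.moved t (HeadProg.swapNat x y) (HeadProg.swapNat x y) = true)) (cellCount _) ?_
    refine exists_lt (α := α × ℕ) (P := fun t a y =>
      HeadProg.moved t (HeadProg.swapNat a.2 y) (HeadProg.swapNat a.2 y)) (cellCount _) ?_
    exact moved (α := (α × ℕ) × ℕ) (σ := fun _ a => HeadProg.swapNat a.1.2 a.2)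
      (σ' := fun _ a => HeadProg.swapNat a.1.2 a.2)
      (swapNat arg.fst.fst.snd arg.fst.snd arg.snd)
      (swapNat arg.fst.fst.snd arg.fst.snd arg.snd)
  · refine forall_lt (P := fun t _ r => HeadProg.noZero t (fun i => decide (i < r))) length ?_
    exact noZero (α := α × ℕ) (pt := fun _ a i => decide (i < a.2)) (arg.snd.lt arg.fst.snd)

theorem decideSmall (c n : ℕ) : PolyComp fun t (_ : α) => decideSmall c n t := by
  have h : ∀ f : Fin n → ℕ, PolyComp (B := Cell) fun _ (p : α × ℕ) => extend 0 f p.2 := fun f =>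
    arg.snd.table _ _ (const 0) fun b _ => const b
  refine (list_any _ fun T => list_all _ fun σ => moved (σ := fun _ _ => extend 0 _)
    (σ' := fun _ _ => extend 0 _) (h _) (h _)).or
    (list_all _ fun x => noZero (pt := fun _ _ => extend false x) ?_)
  exact arg.snd.table _ _ (bool false) fun b _ => bool b

theorem decideTape (c n : ℕ) : PolyComp fun t (_ : α) => decideTape c n t :=
  ((const n).le (cellCount _)).ite decideLarge
    (list_any _ fun k => ((cellCount _).eq (const k)).and (decideSmall c k))

end PolyComp

end HeadProg

namespace HeadProg

/-! ### Evaluation over the integers -/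

/-- Computation with integers and unbounded counters. -/
def intOps : Ops ℤ := ⟨0, 1, (· + ·), (· * ·), (- ·), (· + 1)⟩

/-- The state `st` is the residue of `st'` modulo `m + 1`. -/
structure IsResidue (m : ℕ) (st : EvalState ℕ) (st' : EvalState ℤ) : Prop where
  k : st.k = st'.k
  c : st.c = st'.c
  i : st.i = st'.i
  mono : st.mono = st'.mono
  den : st.den = st'.den
  neg : st.neg = st'.neg
  sel : st.sel = st'.sel
  pow : (st.pow : ZMod (m + 1)) = st'.pow
  a : (st.a : ZMod (m + 1)) = st'.a
  b : (st.b : ZMod (m + 1)) = st'.b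
  S : (st.S : ZMod (m + 1)) = st'.S
  P : (st.P : ZMod (m + 1)) = st'.P
  -- The numerator is tested for zero directly, so it has to be a reduced residue.
  S_le : st.S ≤ m

theorem IsResidue.clean {M m k S P : ℕ} {S' P' : ℤ} (hS : (S : ZMod (m + 1)) = S')
    (hP : (P : ZMod (m + 1)) = P') (h : S ≤ m) :
    IsResidue m (.clean (modOps M m) k S P) (.clean intOps k S' P') := by
  constructor <;> simp [EvalState.clean, modOps, intOps, hS, hP, h]

theorem natCast_mul_eq_neg (m x : ℕ) : ((m * x : ℕ) : ZMod (m + 1)) = -x := by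
  have h : ((m + 1 : ℕ) : ZMod (m + 1)) = 0 := ZMod.natCast_self _
  push_cast at h ⊢
  linear_combination (x : ZMod (m + 1)) * h

/-- The operations respect congruences; the only possible deviation is the cut-off of a counter at
`M`, which the three bounds exclude. -/
theorem IsResidue.evalStep {m M n j : ℕ} {pt : ℕ → Bool} {st : EvalState ℕ} {st' : EvalState ℤ}
    (h : IsResidue m st st') (hk : st'.k < M) (hc : st'.c < M) (hi : st'.i < M) (s : SysSym) :
    IsResidue m (evalStep (modOps M m) n j pt s st) (evalStep intOps n j pt s st') := by
  obtain ⟨k, c, i, mono, den, neg, sel, pow, a, b, S, P⟩ := st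
  obtain ⟨k', c', i', mono', den', neg', sel', pow', a', b', S', P'⟩ := st'
  obtain ⟨h1, h2, h3, h4, h5, h6, h7, h8, h9, h10, h11, h12, h13⟩ := h
  dsimp only at h1 h2 h3 h4 h5 h6 h7 h8 h9 h10 h11 h12 h13 hk hc hi
  subst h1 h2 h3 h4 h5 h6 h7
  cases s with
  | var => exact ⟨rfl, rfl, rfl, rfl, rfl, rfl, rfl, h8, h9, h10, h11, h12, h13⟩
  | bit x =>
    unfold HeadProg.evalStep
    dsimp only
    split_ifs <;> constructor <;> simp [modOps, intOps, h8, h9, h10, h11, h12, h13]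
    omega
  | neg =>
    unfold HeadProg.evalStep
    dsimp only
    split_ifs <;> constructor <;> simp [h8, h9, h10, h11, h12, h13]
  | slash => constructor <;> simp [HeadProg.evalStep, modOps, intOps, h9, h10, h11, h12, h13]
  | endCoord =>
    constructor <;> simp [HeadProg.evalStep, modOps, intOps, h9, h10, h11, h12, h13]
    omega
  | mono => constructor <;> simp [HeadProg.evalStep, h8, h9, h10, h11, h12, h13]
  | endTerm =>
    unfold HeadProg.evalStep
    dsimp only
    split_ifs with h h'
    · refine .clean ?_ ?_ (Nat.lt_succ_iff.1 (Nat.mod_lt _ m.succ_pos))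
      · have := natCast_mul_eq_neg m a
        push_cast at this
        rw [h9] at this
        simp [modOps, intOps, h9, h10, h11, h12, this]
      · simp [modOps, intOps, h10, h12]
    · refine .clean ?_ ?_ (Nat.lt_succ_iff.1 (Nat.mod_lt _ m.succ_pos))
      · simp [modOps, intOps, h9, h10, h11, h12]
      · simp [modOps, intOps, h10, h12]
    · exact .clean h11 h12 h13
  | endPoly =>
    constructor <;> simp [HeadProg.evalStep, modOps, intOps, h8, h9, h10, h11, h12, h13]
    omega

theorem counters_evalStep_le (n j : ℕ) (pt : ℕ → Bool) (s : SysSym) (st : EvalState ℤ) :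
    (evalStep intOps n j pt s st).k ≤ st.k + 1 ∧ (evalStep intOps n j pt s st).c ≤ st.c + 1 ∧
      (evalStep intOps n j pt s st).i ≤ st.i + 1 := by
  cases s <;> unfold evalStep <;> dsimp only <;> (try split_ifs) <;> simp [EvalState.clean, intOps]

/-- Each cell advances a counter by at most one, so a counter plus the number of cells left stays
within `M`. -/
theorem IsResidue.foldl {m M n j : ℕ} {pt : ℕ → Bool} :
    ∀ {t : List Cell} {st : EvalState ℕ} {st' : EvalState ℤ}, IsResidue m st st' →
      st'.k + t.length ≤ M → st'.c + t.length ≤ M → st'.i + t.length ≤ M →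
      IsResidue m (t.foldl (fun st x => evalCell (modOps M m) n j pt x st) st)
        (t.foldl (fun st x => evalCell intOps n j pt x st) st')
  | [], _, _, h, _, _, _ => h
  | x :: t, st, st', h, hk, hc, hi => by
    simp only [List.length_cons] at hk hc hi
    rcases x with _ | s | b
    · exact h.foldl (t := t) (by omega) (by omega) (by omega)
    · have := counters_evalStep_le n j pt s st'
      refine (h.evalStep (by omega) (by omega) (by omega) s).foldl (t := t) ?_ ?_ ?_ <;> omega
    · exact h.foldl (t := t) (by omega) (by omega) (by omega)

/-- Reading a list of symbols, over the integers. -/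
def evalSyms (n j : ℕ) (pt : ℕ → Bool) (l : List SysSym) (st : EvalState ℤ) : EvalState ℤ :=
  l.foldl (fun st s => evalStep intOps n j pt s st) st

theorem evalSyms_append (n j : ℕ) (pt : ℕ → Bool) (l l' : List SysSym) (st : EvalState ℤ) :
    evalSyms n j pt (l ++ l') st = evalSyms n j pt l' (evalSyms n j pt l st) :=
  List.foldl_append

theorem evalSyms_cons (n j : ℕ) (pt : ℕ → Bool) (s : SysSym) (l : List SysSym)
    (st : EvalState ℤ) :
    evalSyms n j pt (s :: l) st = evalSyms n j pt l (evalStep intOps n j pt s st) :=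
  rfl

/-- The tape on which an instance and a certificate are written. -/
def inputTape (C : ℕ) (l : List SysSym) (w : List Bool) : List Cell :=
  pad C (l.map Sum.inl ++ w.map Sum.inr)

theorem inputTape_eq (C : ℕ) (l : List SysSym) (w : List Bool) :
    inputTape C l w = l.map cell ++ (w.map (fun b => some (Sum.inr b)) ++
      List.replicate (C * (l.length + w.length + 1)) none) := by
  simp [inputTape, pad, cell, Function.comp_def]

theorem length_inputTape (C : ℕ) (l : List SysSym) (w : List Bool) :
    (inputTape C l w).length = l.length + w.length + C * (l.length + w.length + 1) := by
  simp [inputTape_eq, add_assoc]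

/-- Certificate and padding are skipped, so the evaluation depends on the system alone. -/
theorem foldl_inputTape (C n j : ℕ) (pt : ℕ → Bool) (l : List SysSym) (w : List Bool)
    (st : EvalState ℤ) :
    (inputTape C l w).foldl (fun st x => evalCell intOps n j pt x st) st =
      evalSyms n j pt l st := by
  have h : ∀ (t : List Cell) (st : EvalState ℤ), (∀ x ∈ t, ∀ s, x ≠ some (Sum.inl s)) →
      t.foldl (fun st x => evalCell intOps n j pt x st) st = st := by
    intro t st ht
    induction t with
    | nil => rfl
    | cons x t ih =>
      rw [List.foldl_cons]
      rcases x with _ | s | b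
      · exact ih fun x hx => ht x (List.mem_cons_of_mem _ hx)
      · exact absurd rfl (ht _ List.mem_cons_self s)
      · exact ih fun x hx => ht x (List.mem_cons_of_mem _ hx)
  rw [inputTape_eq, List.foldl_append, h _ _ (by
    simp only [List.mem_append, List.mem_map, List.mem_replicate]
    rintro x (⟨b, -, rfl⟩ | ⟨-, rfl⟩) s <;> simp), List.foldl_map]
  rfl

theorem isResidue_evalTape (C n j : ℕ) (pt : ℕ → Bool) (m : ℕ) (l : List SysSym) (w : List Bool) :
    IsResidue m (evalTape (inputTape C l w) n j pt m)
      (evalSyms n j pt l (.clean intOps 0 0 1)) := by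
  rw [← foldl_inputTape C n j pt l w]
  refine IsResidue.foldl (.clean (by simp) (by simp) (Nat.zero_le _)) ?_ ?_ ?_ <;>
    simp [EvalState.clean]

end HeadProg

namespace HeadProg

/-! ### Reading a presented system -/

variable {n j : ℕ} {pt : ℕ → Bool}

/-- The number with the given binary digits. -/
def ofBits (l : List Bool) : ℕ := l.foldr (fun b v => b.toNat + 2 * v) 0

theorem ofBits_lt (l : List Bool) : ofBits l < 2 ^ l.length := by
  induction l with
  | nil => simp [ofBits]
  | cons b l ih =>
    have : ofBits (b :: l) = b.toNat + 2 * ofBits l := rfl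
    rw [this, List.length_cons, pow_succ]
    cases b <;> simp <;> omega

theorem ofBits_encodePosNum (p : PosNum) : ofBits (Computability.encodePosNum p) = p := by
  induction p with
  | one => rfl
  | bit0 p ih =>
    have : ofBits (Computability.encodePosNum p.bit0) =
      0 + 2 * ofBits (Computability.encodePosNum p) := rfl
    rw [this, ih, PosNum.cast_bit0]
    ring
  | bit1 p ih =>
    have : ofBits (Computability.encodePosNum p.bit1) =
      1 + 2 * ofBits (Computability.encodePosNum p) := rfl
    rw [this, ih, PosNum.cast_bit1]
    ring

theorem ofBits_encodeNat (a : ℕ) : ofBits (Computability.encodeNat a) = a := by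
  have h : ∀ b : Num, ofBits (Computability.encodeNum b) = b := by
    rintro (_ | p)
    · rfl
    · exact ofBits_encodePosNum p
  rw [Computability.encodeNat, h, Num.to_of_nat]

/-- This turns the length of the input into bounds for numerators and denominators. -/
theorem lt_two_pow_length_encNat (a : ℕ) : a < 2 ^ (encNat a).length := by
  have := ofBits_lt (Computability.encodeNat a)
  rwa [ofBits_encodeNat, ← List.length_map (f := SysSym.bit)] at this

/-- The digits come with the least significant one first, so a running power of two suffices. -/
theorem evalSyms_bits_num (l : List Bool) (k : ℕ) (neg : Bool) (pow a b S P : ℤ) :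
    evalSyms n j pt (l.map .bit) ⟨k, j, 0, false, false, neg, true, pow, a, b, S, P⟩ =
      ⟨k, j, 0, false, false, neg, true, pow * 2 ^ l.length, a + pow * ofBits l, b, S, P⟩ := by
  induction l generalizing pow a with
  | nil => simp [evalSyms, ofBits]
  | cons x l ih =>
    have : ofBits (x :: l) = x.toNat + 2 * ofBits l := rfl
    rw [List.map_cons, evalSyms_cons, this, List.length_cons]
    simp only [evalStep, Bool.false_eq_true, if_false, decide_true, if_true]
    rw [ih]
    simp only [intOps]
    congr 1
    · ring
    · cases x <;> simp <;> ring

theorem evalSyms_bits_den (l : List Bool) (k : ℕ) (neg : Bool) (pow a b S P : ℤ) :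
    evalSyms n j pt (l.map .bit) ⟨k, j, 0, false, true, neg, true, pow, a, b, S, P⟩ =
      ⟨k, j, 0, false, true, neg, true, pow * 2 ^ l.length, a, b + pow * ofBits l, S, P⟩ := by
  induction l generalizing pow b with
  | nil => simp [evalSyms, ofBits]
  | cons x l ih =>
    have : ofBits (x :: l) = x.toNat + 2 * ofBits l := rfl
    rw [List.map_cons, evalSyms_cons, this, List.length_cons]
    simp only [evalStep, Bool.false_eq_true, if_false, decide_true, if_true]
    rw [ih]
    simp only [intOps]
    congr 1
    · ring
    · cases x <;> simp <;> ring

theorem evalSyms_bits_of_ne {c : ℕ} (hc : c ≠ j) (l : List Bool) (st : EvalState ℤ)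
    (hst : st.mono = false) (h : st.c = c) : evalSyms n j pt (l.map .bit) st = st := by
  induction l with
  | nil => rfl
  | cons x l ih =>
    rw [List.map_cons, evalSyms_cons]
    simpa [evalStep, hst, h, hc] using ih

/-- The state between two coordinates. -/
def coordState (k c : ℕ) (S P : ℤ) (x : Option ℚ) : EvalState ℤ :=
  match x with
  | none => ⟨k, c, 0, false, false, false, true, 1, 0, 0, S, P⟩
  | some q => ⟨k, c, 0, false, false, decide (q < 0), true, 1, q.num.natAbs, q.den, S, P⟩

theorem evalSyms_encRat (k : ℕ) (S P : ℤ) (q : ℚ) :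
    evalSyms n j pt (encRat q ++ [.endCoord]) (coordState k j S P none) =
      coordState k (j + 1) S P (some q) := by
  have h : evalSyms n j pt (if q < 0 then [SysSym.neg] else []) (coordState k j S P none) =
      ⟨k, j, 0, false, false, decide (q < 0), true, 1, 0, 0, S, P⟩ := by
    split_ifs with hq <;> simp [evalSyms, evalStep, coordState, hq]
  rw [encRat, encNat, encNat, evalSyms_append, evalSyms_append, evalSyms_append,
    evalSyms_cons _ _ _ SysSym.slash, h,
    evalSyms_bits_num]
  simp only [evalStep]
  rw [evalSyms_bits_den]
  simp [evalSyms, evalStep, coordState, intOps, ofBits_encodeNat]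

/-- In a coordinate other than `j`, only `den`, `pow` and `c` are touched, and `endCoord` resets the
first two. -/
theorem evalSyms_encRat_of_ne {c : ℕ} (hc : c ≠ j) (k : ℕ) (S P : ℤ) (q : ℚ) (x : Option ℚ) :
    evalSyms n j pt (encRat q ++ [.endCoord]) (coordState k c S P x) =
      coordState k (c + 1) S P x := by
  have hs : (coordState k c S P x).mono = false ∧ (coordState k c S P x).c = c := by
    cases x <;> exact ⟨rfl, rfl⟩
  have h : evalSyms n j pt (if q < 0 then [SysSym.neg] else []) (coordState k c S P x) =
      coordState k c S P x := by
    split_ifs with hq <;> simp [evalSyms, evalStep, hs.2, hc]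
  rw [encRat, encNat, encNat, evalSyms_append, evalSyms_append, evalSyms_append,
    evalSyms_cons _ _ _ SysSym.slash, h,
    evalSyms_bits_of_ne hc _ _ hs.1 hs.2, evalSyms_bits_of_ne hc _ _ (by exact hs.1) (by exact hs.2)]
  cases x <;> simp [evalSyms, evalStep, coordState, intOps]

theorem evalSyms_coords_of_lt (k : ℕ) (S P : ℤ) (x : Option ℚ) (l : List ℚ) {c : ℕ} (hc : j < c) :
    evalSyms n j pt (l.flatMap fun q => encRat q ++ [.endCoord]) (coordState k c S P x) =
      coordState k (c + l.length) S P x := by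
  induction l generalizing c with
  | nil => rfl
  | cons q l ih =>
    rw [List.flatMap_cons, evalSyms_append, evalSyms_encRat_of_ne hc.ne', ih (by omega),
      List.length_cons, add_assoc, add_comm 1]

theorem evalSyms_coords (k : ℕ) (S P : ℤ) (l : List ℚ) {c i : ℕ} (hc : c + i = j) :
    evalSyms n j pt (l.flatMap fun q => encRat q ++ [.endCoord]) (coordState k c S P none) =
      coordState k (c + l.length) S P l[i]? := by
  induction l generalizing c i with
  | nil => rfl
  | cons q l ih =>
    rw [List.flatMap_cons, evalSyms_append, List.length_cons]
    rcases i with _ | i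
    · obtain rfl : c = j := by omega
      rw [evalSyms_encRat, evalSyms_coords_of_lt _ _ _ _ _ (by omega), add_assoc, add_comm 1]
      rfl
    · rw [evalSyms_encRat_of_ne (by omega), ih (i := i) (by omega), add_assoc, add_comm 1]
      rfl

theorem evalSyms_vars (l : List Bool) (k c i : ℕ) (den neg sel : Bool) (pow a b S P : ℤ) :
    evalSyms n j pt (l.map .bit) ⟨k, c, i, true, den, neg, sel, pow, a, b, S, P⟩ =
      ⟨k, c, i + l.length, true, den, neg,
        sel && decide (∀ r : Fin l.length, l[r] = true → pt (i + r) = true),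
        pow, a, b, S, P⟩ := by
  induction l generalizing i sel with
  | nil => simp [evalSyms]
  | cons x l ih =>
    rw [List.map_cons, evalSyms_cons]
    simp only [evalStep, if_true]
    rw [ih]
    simp only [intOps, List.length_cons, EvalState.mk.injEq, true_and, and_true]
    refine ⟨by omega, ?_⟩
    rw [Bool.eq_iff_iff]
    simp only [Bool.and_eq_true, Bool.or_eq_true, decide_eq_true_eq, Bool.not_eq_true',
      Fin.forall_fin_succ, and_assoc]
    simp [add_assoc, add_comm 1]
    cases x <;> simp

/-- The monomial of the term does not vanish at the point. -/
def selected {N : ℕ} (pt : ℕ → Bool) (t : BoolTerm N) : Bool := decide (∀ i ∈ t.vars, pt i = true)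

/-- Add the coordinate of a term to a fraction. -/
def addTerm {N : ℕ} (j : ℕ) (pt : ℕ → Bool) (x : ℤ × ℤ) (t : BoolTerm N) : ℤ × ℤ :=
  match t.coords[j]? with
  | some q => if selected pt t then (x.1 * q.den + q.num * x.2, x.2 * q.den) else x
  | none => x

theorem evalSyms_encTerm {N : ℕ} (t : BoolTerm N) (k : ℕ) (x : ℤ × ℤ) :
    evalSyms n j pt (encTerm t ++ [.endTerm]) (.clean intOps k x.1 x.2) =
      if k = n then .clean intOps k (addTerm j pt x t).1 (addTerm j pt x t).2
      else .clean intOps k x.1 x.2 := by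
  have h₀ : EvalState.clean intOps k x.1 x.2 = coordState k 0 x.1 x.2 none := rfl
  have h₁ : (List.ofFn fun i : Fin N => SysSym.bit (decide (i ∈ t.vars))) =
      (List.ofFn fun i : Fin N => decide (i ∈ t.vars)).map .bit := by
    rw [List.map_ofFn]; rfl
  have h₂ : decide (∀ r : Fin (List.ofFn fun i : Fin N => decide (i ∈ t.vars)).length,
      (List.ofFn fun i : Fin N => decide (i ∈ t.vars))[r] = true → pt (0 + r) = true) =
      selected pt t := by
    rw [selected, decide_eq_decide]
    constructor
    · intro h i hi
      have := h ⟨i, by simp⟩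
      simp_all
    · rintro h ⟨r, hr⟩ hi
      simp at hi hr
      have := h _ hi
      simpa using this
  rw [encTerm, evalSyms_append, evalSyms_append, evalSyms_cons _ _ _ SysSym.mono, h₀,
    evalSyms_coords _ _ _ _ (zero_add j), h₁]
  rcases ht : t.coords[j]? with _ | q
  · have hj : ¬ j < t.coords.length := by simpa using ht
    simp only [coordState, evalStep]
    rw [evalSyms_vars]
    rw [addTerm, ht]
    simp [evalSyms, evalStep, hj, EvalState.clean, intOps]
  · have hj : j < t.coords.length := (List.getElem?_eq_some_iff.1 ht).1
    simp only [coordState, evalStep]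
    rw [evalSyms_vars, h₂]
    -- The sign flag and the absolute value that was read recombine to the numerator.
    have hq : (if q < 0 then -(|q.num| * x.2) else |q.num| * x.2) = q.num * x.2 := by
      split_ifs with hq
      · rw [abs_of_neg (Rat.num_neg.2 hq)]; ring
      · rw [abs_of_nonneg (Rat.num_nonneg.2 (not_lt.1 hq))]
    rw [addTerm, ht]
    by_cases hk : k = n <;> cases hs : selected pt t <;>
      simp [evalSyms, evalStep, hj, EvalState.clean, intOps, hk, hq]

/-- The value of a polynomial in a coordinate, as a fraction. -/
def fracValue {N : ℕ} (j : ℕ) (pt : ℕ → Bool) (p : List (BoolTerm N)) : ℤ × ℤ :=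
  p.foldl (addTerm j pt) (0, 1)

theorem evalSyms_encPoly {N : ℕ} (p : List (BoolTerm N)) (k : ℕ) (x : ℤ × ℤ) :
    evalSyms n j pt (encPoly p) (.clean intOps k x.1 x.2) =
      if k = n then .clean intOps k (p.foldl (addTerm j pt) x).1 (p.foldl (addTerm j pt) x).2
      else .clean intOps k x.1 x.2 := by
  unfold encPoly
  induction p generalizing x with
  | nil => simp [evalSyms]
  | cons t p ih =>
    rw [List.flatMap_cons, evalSyms_append, evalSyms_encTerm]
    split_ifs with h
    · rw [ih, if_pos h, List.foldl_cons]
    · rw [ih, if_neg h]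

theorem evalSyms_polys_of_lt {N : ℕ} (l : List (List (BoolTerm N))) {k : ℕ} (hk : n < k)
    (x : ℤ × ℤ) :
    evalSyms n j pt (l.flatMap fun p => encPoly p ++ [.endPoly]) (.clean intOps k x.1 x.2) =
      .clean intOps (k + l.length) x.1 x.2 := by
  induction l generalizing k with
  | nil => rfl
  | cons p l ih =>
    rw [List.flatMap_cons, evalSyms_append, evalSyms_append, evalSyms_encPoly, if_neg hk.ne']
    have : evalSyms n j pt [.endPoly] (.clean intOps k x.1 x.2) =
      .clean intOps (k + 1) x.1 x.2 := rfl
    rw [this, ih (by omega), List.length_cons, add_assoc, add_comm 1]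

/-- If there is no polynomial with number `n`, the fraction remains `0/1`, which is the value of the
default `[]`. -/
theorem evalSyms_polys {N : ℕ} (l : List (List (BoolTerm N))) {k i : ℕ} (hk : k + i = n) :
    evalSyms n j pt (l.flatMap fun p => encPoly p ++ [.endPoly]) (.clean intOps k 0 1) =
      .clean intOps (k + l.length) (fracValue j pt (l.getD i [])).1
        (fracValue j pt (l.getD i [])).2 := by
  induction l generalizing k i with
  | nil => rfl
  | cons p l ih =>
    have h1 := fun x => evalSyms_encPoly (n := n) (j := j) (pt := pt) p k x
    have h2 : ∀ S P, evalSyms n j pt [.endPoly] (.clean intOps k S P) =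
      .clean intOps (k + 1) S P := fun _ _ => rfl
    rw [List.flatMap_cons, evalSyms_append, evalSyms_append, h1 (0, 1), List.length_cons]
    rcases i with _ | i
    · rw [if_pos (by omega), h2, evalSyms_polys_of_lt _ (by omega), add_assoc, add_comm 1]
      rfl
    · rw [if_neg (by omega), h2, ih (i := i) (by omega), add_assoc, add_comm 1]
      rfl

theorem evalSyms_encSystem (T : BoolSystem) :
    evalSyms n j pt (encSystem T) (.clean intOps 0 0 1) =
      .clean intOps T.polys.length (fracValue j pt (T.polys.getD n [])).1
        (fracValue j pt (T.polys.getD n [])).2 := by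
  have h : ∀ (N : ℕ) (st : EvalState ℤ),
      evalSyms n j pt (List.replicate N SysSym.var) st = st := by
    intro N st
    induction N with
    | zero => rfl
    | succ N ih => exact ih
  rw [encSystem, evalSyms_append, h, evalSyms_polys _ (zero_add n), zero_add]

end HeadProg

namespace HeadProg

/-! ### Rational values and complex values -/

/-- Some small number does not divide a given nonzero number. -/
theorem exists_not_dvd {A n : ℕ} (h₀ : A ≠ 0) (h : A < 2 ^ n) : ∃ m < 2 * n, ¬ m + 1 ∣ A := by
  by_contra! hA
  have hn : n ≠ 0 := by rintro rfl; omega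
  -- Every prime power dividing the central binomial coefficient is at most `2 * n`, hence divides
  -- `A` by assumption.
  have hdvd : n.centralBinom ∣ A := by
    rw [Nat.dvd_iff_prime_pow_dvd_dvd]
    intro p k hp hk
    rcases Nat.eq_zero_or_pos k with rfl | hk0
    · simp
    have hle : p ^ k ≤ 2 * n :=
      (Nat.pow_le_pow_right hp.pos
        ((hp.pow_dvd_iff_le_factorization n.centralBinom_ne_zero).1 hk)).trans
        (Nat.pow_factorization_choose_le (by omega))
    have hpos := Nat.pow_pos (n := k) hp.pos
    have := hA (p ^ k - 1) (by omega)
    rwa [Nat.sub_add_cancel hpos] at this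
  have h₁ := Nat.le_of_dvd (Nat.pos_of_ne_zero h₀) hdvd
  have h₂ := Nat.four_pow_le_two_mul_self_mul_centralBinom n (Nat.pos_of_ne_zero hn)
  have h₃ : 2 * n ≤ 2 ^ n := by
    obtain ⟨k, rfl⟩ := Nat.exists_eq_succ_of_ne_zero hn
    have := Nat.lt_two_pow_self (n := k)
    rw [pow_succ]
    omega
  have h₄ : 4 ^ n = 2 ^ n * 2 ^ n := by rw [← mul_pow]; norm_num
  -- The coefficient divides `A`, so it is below `2 ^ n`; this contradicts its lower bound `4 ^ n /
  -- (2 * n)`.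
  have h₅ : 2 * n * n.centralBinom < 2 ^ n * 2 ^ n :=
    calc 2 * n * n.centralBinom ≤ 2 ^ n * n.centralBinom := Nat.mul_le_mul_right _ h₃
      _ < 2 ^ n * 2 ^ n := Nat.mul_lt_mul_of_pos_left (by omega) (by positivity)
  omega

variable {N : ℕ} (j : ℕ) (pt : ℕ → Bool)

/-- The value of a polynomial in a coordinate. -/
def coordSum (p : List (BoolTerm N)) : ℚ :=
  (p.map fun t => if selected pt t then t.coords.getD j 0 else 0).sum

/-- The additional `1` is the slash; it pays for the factor two in `addTerm_spec`. -/
theorem length_encRat_le {t : BoolTerm N} {q : ℚ} (h : q ∈ t.coords) :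
    (encNat q.num.natAbs).length + (encNat q.den).length + 1 ≤ (encTerm t).length := by
  have h₁ : (encRat q).length ≤ (encTerm t).length := by
    refine List.Sublist.length_le ?_
    refine ((List.sublist_append_left _ [SysSym.endCoord]).trans ?_).trans
      (List.sublist_append_left _ _)
    exact (List.sublist_flatten_of_mem (List.mem_map_of_mem h))
  refine le_trans ?_ h₁
  simp [encRat]
  omega

/-- Fractions are never reduced, so each term may lengthen numerator and denominator, but by no more
bits than its own encoding has symbols. -/
theorem addTerm_spec (x : ℤ × ℤ) (hx : 0 < x.2) (t : BoolTerm N) {e : ℕ}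
    (h₁ : |x.1| ≤ 2 ^ e) (h₂ : x.2 ≤ 2 ^ e) :
    0 < (addTerm j pt x t).2 ∧
      ((addTerm j pt x t).1 : ℚ) / (addTerm j pt x t).2 =
        x.1 / x.2 + (if selected pt t then t.coords.getD j 0 else 0) ∧
      |(addTerm j pt x t).1| ≤ 2 ^ (e + (encTerm t).length) ∧
      (addTerm j pt x t).2 ≤ 2 ^ (e + (encTerm t).length) := by
  have hle : (2 : ℤ) ^ e ≤ 2 ^ (e + (encTerm t).length) :=
    pow_le_pow_right₀ (by norm_num) (by omega)
  rw [List.getD_eq_getElem?_getD, addTerm]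
  rcases ht : t.coords[j]? with _ | q
  · simpa using ⟨hx, h₁.trans hle, h₂.trans hle⟩
  · dsimp only
    split_ifs with hs
    · have hn := lt_two_pow_length_encNat q.num.natAbs
      have hd := lt_two_pow_length_encNat q.den
      set u := (encNat q.num.natAbs).length
      set v := (encNat q.den).length
      have hq : |q.num| < 2 ^ u := by rw [Int.abs_eq_natAbs]; exact_mod_cast hn
      have hd' : (q.den : ℤ) < 2 ^ v := by exact_mod_cast hd
      have hd0 : (0 : ℤ) < q.den := by exact_mod_cast q.den_pos
      have hlen : u + v + 1 ≤ (encTerm t).length := length_encRat_le (List.mem_of_getElem? ht)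
      -- The new numerator is a sum of two products, each at most `2 ^ (e + u + v)`.
      have hpow : (2 : ℤ) ^ e * (2 ^ (u + v) + 2 ^ (u + v)) ≤ 2 ^ (e + (encTerm t).length) := by
        rw [← two_mul, ← pow_succ', ← pow_add]
        exact pow_le_pow_right₀ (by norm_num) (by omega)
      have hu : (2 : ℤ) ^ u ≤ 2 ^ (u + v) := pow_le_pow_right₀ (by norm_num) (by omega)
      have hv : (2 : ℤ) ^ v ≤ 2 ^ (u + v) := pow_le_pow_right₀ (by norm_num) (by omega)
      have he : (0 : ℤ) < 2 ^ e := by positivity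
      have k₁ : |x.1| * q.den ≤ 2 ^ e * 2 ^ (u + v) :=
        mul_le_mul h₁ (by omega) hd0.le he.le
      have k₂ : |q.num| * x.2 ≤ 2 ^ (u + v) * 2 ^ e :=
        mul_le_mul (by omega) h₂ hx.le (by positivity)
      have k₃ : x.2 * q.den ≤ 2 ^ e * 2 ^ (u + v) :=
        mul_le_mul h₂ (by omega) hd0.le he.le
      refine ⟨mul_pos hx hd0, ?_, ?_, ?_⟩
      · have hx' : (x.2 : ℚ) ≠ 0 := by exact_mod_cast hx.ne'
        have hd'' : (q.den : ℚ) ≠ 0 := by exact_mod_cast hd0.ne'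
        have hq' : (q.num : ℚ) = q * q.den := (Rat.mul_den_eq_num q).symm
        push_cast
        rw [hq']
        simp only [Option.getD_some]
        field_simp
      · calc |x.1 * q.den + q.num * x.2| ≤ |x.1 * q.den| + |q.num * x.2| := abs_add_le _ _
          _ = |x.1| * q.den + |q.num| * x.2 := by
            rw [abs_mul, abs_mul, abs_of_pos hd0, abs_of_pos hx]
          _ ≤ _ := by linarith
      · refine k₃.trans (le_trans ?_ hpow)
        gcongr
        simp
    · simpa using ⟨hx, h₁.trans hle, h₂.trans hle⟩

theorem foldl_addTerm_spec (p : List (BoolTerm N)) (x : ℤ × ℤ) (hx : 0 < x.2) {e : ℕ}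
    (h₁ : |x.1| ≤ 2 ^ e) (h₂ : x.2 ≤ 2 ^ e) :
    0 < (p.foldl (addTerm j pt) x).2 ∧
      ((p.foldl (addTerm j pt) x).1 : ℚ) / (p.foldl (addTerm j pt) x).2 =
        x.1 / x.2 + coordSum j pt p ∧
      |(p.foldl (addTerm j pt) x).1| ≤ 2 ^ (e + (encPoly p).length) ∧
      (p.foldl (addTerm j pt) x).2 ≤ 2 ^ (e + (encPoly p).length) := by
  induction p generalizing x e with
  | nil => simpa [coordSum, encPoly] using ⟨hx, h₁, h₂⟩
  | cons t p ih =>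
    obtain ⟨a₁, a₂, a₃, a₄⟩ := addTerm_spec j pt x hx t h₁ h₂
    obtain ⟨b₁, b₂, b₃, b₄⟩ := ih _ a₁ a₃ a₄
    have hlen : (encPoly (t :: p)).length = (encTerm t).length + 1 + (encPoly p).length := by
      simp [encPoly]
      ring
    have hle : (2 : ℤ) ^ (e + (encTerm t).length + (encPoly p).length) ≤
        2 ^ (e + (encPoly (t :: p)).length) :=
      pow_le_pow_right₀ (by norm_num) (by omega)
    refine ⟨b₁, ?_, b₃.trans hle, b₄.trans hle⟩
    rw [List.foldl_cons, b₂, a₂, coordSum, coordSum, List.map_cons, List.sum_cons, add_assoc]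

theorem fracValue_spec (p : List (BoolTerm N)) :
    0 < (fracValue j pt p).2 ∧
      ((fracValue j pt p).1 : ℚ) / (fracValue j pt p).2 = coordSum j pt p ∧
      |(fracValue j pt p).1| ≤ 2 ^ (encPoly p).length ∧
      (fracValue j pt p).2 ≤ 2 ^ (encPoly p).length := by
  simpa [fracValue] using foldl_addTerm_spec j pt p (0, 1) (by simp) (e := 0) (by simp) (by simp)

/-! ### Complex values through their rational coordinates -/

/-- The coordinates of the value of a polynomial. -/
noncomputable def coordsSum (p : List (BoolTerm N)) : ℕ →₀ ℚ :=
  (p.map fun t => if selected pt t then t.coords.toFinsupp else 0).sum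

theorem coordsSum_apply (p : List (BoolTerm N)) : coordsSum pt p j = coordSum j pt p := by
  induction p with
  | nil => rfl
  | cons t p ih =>
    rw [coordsSum, coordSum, List.map_cons, List.map_cons, List.sum_cons, List.sum_cons,
      Finsupp.add_apply]
    rw [coordsSum, coordSum] at ih
    rw [ih]
    split_ifs <;> simp [List.toFinsupp_apply]

theorem coeffValue_eq (θ : ℕ → ℂ) (q : List ℚ) :
    coeffValue θ q = Finsupp.linearCombination ℚ θ q.toFinsupp := by
  rw [Finsupp.linearCombination_apply, Finsupp.sum_of_support_subset (s := Finset.range q.length)]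
  · rw [Finset.sum_range]
    simp [coeffValue, List.toFinsupp_apply, Algebra.smul_def]
  · intro i hi
    simp only [List.toFinsupp_support, Finset.mem_filter] at hi
    exact hi.1
  · simp

/-- The point of the cube given by a sequence of bits. -/
def cubePoint (N : ℕ) (pt : ℕ → Bool) : Fin N → Bool := fun i => pt i

/-- The element of the ring that is denoted by a list of terms. -/
noncomputable def polyClass (θ : ℕ → ℂ) (p : List (BoolTerm N)) : BoolVarRing N :=
  Ideal.Quotient.mk (boolIdeal N) (polyValue θ p)

theorem evalAt_mk (a : Fin N → Bool) (f : MvPolynomial (Fin N) ℂ) :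
    evalAt a (Ideal.Quotient.mk (boolIdeal N) f) = MvPolynomial.eval (boolPoint a) f :=
  rfl

/-- At a point of the cube a monomial is `1` or `0`, so the value is the sum of the coefficients of
the selected terms. -/
theorem evalAt_polyClass (θ : ℕ → ℂ) (p : List (BoolTerm N)) :
    evalAt (cubePoint N pt) (polyClass θ p) =
      Finsupp.linearCombination ℚ θ (coordsSum pt p) := by
  rw [polyClass, evalAt_mk, polyValue, coordsSum, map_list_sum, map_list_sum, List.map_map,
    List.map_map]
  congr 1
  refine List.map_congr_left fun t _ => ?_
  simp only [Function.comp, map_mul, MvPolynomial.eval_C, map_prod, MvPolynomial.eval_X]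
  rcases hs : selected pt t with _ | _
  · rw [selected, decide_eq_false_iff_not] at hs
    push Not at hs
    obtain ⟨i, hi, hpt⟩ := hs
    rw [Finset.prod_eq_zero hi] <;> simp [boolPoint, cubePoint, hpt]
  · rw [selected, decide_eq_true_eq] at hs
    rw [Finset.prod_eq_one fun i hi => by simp [boolPoint, cubePoint, hs i hi]]
    simp [coeffValue_eq]

/-- Linear independence over `ℚ` is injectivity of the map from coordinates to complex numbers. This
is the only way in which the sequence enters the algorithm's correctness. -/
theorem evalAt_polyClass_eq_iff {θ : ℕ → ℂ} (hθ : LinearIndependent ℚ θ) (pt' : ℕ → Bool)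
    (p p' : List (BoolTerm N)) :
    evalAt (cubePoint N pt) (polyClass θ p) = evalAt (cubePoint N pt') (polyClass θ p') ↔
      ∀ j, coordSum j pt p = coordSum j pt' p' := by
  rw [evalAt_polyClass, evalAt_polyClass]
  refine (Function.Injective.eq_iff hθ).trans ?_
  simp only [Finsupp.ext_iff, coordsSum_apply]

end HeadProg

namespace HeadProg

/-! ### Correctness of the comparisons -/

theorem infix_flatMap {α β : Type} {l : List α} {x : α} (h : x ∈ l) (f : α → List β) :
    f x <:+: l.flatMap f := by
  obtain ⟨s, t, rfl⟩ := List.append_of_mem h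
  exact ⟨s.flatMap f, t.flatMap f, by simp⟩

theorem encPoly_infix {T : BoolSystem} {p : List (BoolTerm T.numVars)} (h : p ∈ T.polys) :
    encPoly p <:+: encSystem T :=
  ((List.prefix_append _ _).isInfix.trans (infix_flatMap h fun p => encPoly p ++ [.endPoly])).trans
    (List.suffix_append _ _).isInfix

theorem encTerm_infix {N : ℕ} {p : List (BoolTerm N)} {t : BoolTerm N} (h : t ∈ p) :
    encTerm t <:+: encPoly p :=
  (List.prefix_append _ _).isInfix.trans (infix_flatMap h fun t => encTerm t ++ [.endTerm])

theorem vars_infix {N : ℕ} (t : BoolTerm N) :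
    (List.ofFn fun i : Fin N => SysSym.bit (decide (i ∈ t.vars))) <:+: encTerm t :=
  (List.suffix_cons _ _).isInfix.trans (List.suffix_append _ _).isInfix

theorem length_coords_le {N : ℕ} (t : BoolTerm N) : t.coords.length ≤ (encTerm t).length := by
  simp only [encTerm, List.length_append, List.length_flatMap]
  refine le_trans ?_ (Nat.le_add_right _ _)
  induction t.coords with
  | nil => simp
  | cons q l ih =>
    simp at ih ⊢
    omega

variable {T : BoolSystem}

theorem getD_mem_or (n : ℕ) : T.polys.getD n [] ∈ T.polys ∨ T.polys.getD n [] = [] := by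
  by_cases h : n < T.polys.length
  · left
    rw [List.getD_eq_getElem _ _ h]
    exact List.getElem_mem h
  · right
    exact List.getD_eq_default _ _ (not_lt.1 h)

theorem length_encPoly_getD_le (n : ℕ) :
    (encPoly (T.polys.getD n [])).length ≤ (encSystem T).length := by
  rcases getD_mem_or (T := T) n with h | h
  · exact (encPoly_infix h).length_le
  · rw [h]
    exact Nat.zero_le _

/-- Coordinates that are not written are zero, so only those below the length of the input need to
be compared. -/
theorem lt_of_coordSum_ne_zero {N j : ℕ} {pt : ℕ → Bool} {p : List (BoolTerm N)}
    (h : coordSum j pt p ≠ 0) : j < (encPoly p).length := by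
  by_contra! hj
  refine h (List.sum_eq_zero fun x hx => ?_)
  obtain ⟨t, ht, rfl⟩ := List.mem_map.1 hx
  rw [List.getD_eq_default _ _
    (((length_coords_le t).trans (encTerm_infix ht).length_le).trans hj), ite_self]

section Compare

variable {C : ℕ} {w : List Bool}

theorem isResidue_evalTape_encSystem (n j : ℕ) (pt : ℕ → Bool) (m : ℕ) :
    IsResidue m (evalTape (inputTape C (encSystem T) w) n j pt m)
      (.clean intOps T.polys.length (fracValue j pt (T.polys.getD n [])).1
        (fracValue j pt (T.polys.getD n [])).2) := by
  rw [← evalSyms_encSystem]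
  exact isResidue_evalTape C n j pt m _ w

/-- Fractions are compared by cross-multiplication, and congruence modulo `m + 1` is divisibility of
the difference of the cross products. -/
theorem differMod_iff (n n' j m : ℕ) (pt pt' : ℕ → Bool) :
    differMod (inputTape C (encSystem T) w) n pt n' pt' j m = true ↔
      ¬ m + 1 ∣ ((fracValue j pt (T.polys.getD n [])).1 * (fracValue j pt' (T.polys.getD n' [])).2 -
        (fracValue j pt' (T.polys.getD n' [])).1 *
          (fracValue j pt (T.polys.getD n [])).2).natAbs := by
  have h₁ := isResidue_evalTape_encSystem (T := T) (C := C) (w := w) n j pt m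
  have h₂ := isResidue_evalTape_encSystem (T := T) (C := C) (w := w) n' j pt' m
  rw [differMod, Bool.not_eq_true', decide_eq_false_iff_not, ← ZMod.natCast_eq_natCast_iff',
    Nat.cast_mul, Nat.cast_mul, h₁.S, h₁.P, h₂.S, h₂.P, ← Int.natCast_dvd,
    ← ZMod.intCast_zmod_eq_zero_iff_dvd, Int.cast_sub, sub_eq_zero, Int.cast_mul, Int.cast_mul]
  rfl

theorem nonzeroMod_iff (n j m : ℕ) (pt : ℕ → Bool) :
    nonzeroMod (inputTape C (encSystem T) w) n pt j m = true ↔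
      ¬ m + 1 ∣ (fracValue j pt (T.polys.getD n [])).1.natAbs := by
  have h₁ := isResidue_evalTape_encSystem (T := T) (C := C) (w := w) n j pt m
  rw [nonzeroMod, Bool.not_eq_true', decide_eq_false_iff_not, ← Int.natCast_dvd,
    ← ZMod.intCast_zmod_eq_zero_iff_dvd]
  rw [show (((fracValue j pt (T.polys.getD n [])).1 : ℤ) : ZMod (m + 1)) = _ from h₁.S.symm,
    ZMod.natCast_eq_zero_iff]
  exact not_congr ⟨fun h => h ▸ dvd_zero _, fun h =>
    Nat.eq_zero_of_dvd_of_lt h (Nat.lt_succ_of_le h₁.S_le)⟩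

variable {θ : ℕ → ℂ}

/-- The value of the `n`-th polynomial. -/
noncomputable def valueAt (T : BoolSystem) (θ : ℕ → ℂ) (n : ℕ) (a : Fin T.numVars → Bool) : ℂ :=
  evalAt a (polyClass θ (T.polys.getD n []))

/-- The padding makes room for the moduli: `differ_iff` needs all `m` below `4 * L + 4`, where `L`
is the length of the system. -/
theorem five_mul_le_length (hC : 4 ≤ C) : 5 * (encSystem T).length + 4 ≤
    (inputTape C (encSystem T) w).length := by
  rw [length_inputTape]
  have := Nat.mul_le_mul_right ((encSystem T).length + w.length + 1) hC
  omega

theorem differ_iff (hθ : LinearIndependent ℚ θ) (hC : 4 ≤ C) (n n' : ℕ) (pt pt' : ℕ → Bool) :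
    differ (inputTape C (encSystem T) w) n pt n' pt' = true ↔
      valueAt T θ n (cubePoint _ pt) ≠ valueAt T θ n' (cubePoint _ pt') := by
  have hlen := five_mul_le_length (T := T) (w := w) hC
  rw [Ne, valueAt, valueAt, evalAt_polyClass_eq_iff pt hθ, not_forall, differ, decide_eq_true_eq]
  simp only [decide_eq_true_eq, differMod_iff]
  set p := T.polys.getD n []
  set p' := T.polys.getD n' []
  have hp : (encPoly p).length ≤ _ := length_encPoly_getD_le (T := T) n
  have hp' : (encPoly p').length ≤ _ := length_encPoly_getD_le (T := T) n'
  have key : ∀ j, (coordSum j pt p = coordSum j pt' p' ↔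
      (fracValue j pt p).1 * (fracValue j pt' p').2 - (fracValue j pt' p').1 *
        (fracValue j pt p).2 = 0) := by
    intro j
    obtain ⟨a₁, a₂, -⟩ := fracValue_spec j pt p
    obtain ⟨b₁, b₂, -⟩ := fracValue_spec j pt' p'
    rw [← a₂, ← b₂, div_eq_div_iff (by exact_mod_cast a₁.ne') (by exact_mod_cast b₁.ne'),
      sub_eq_zero]
    exact_mod_cast Iff.rfl
  constructor
  · rintro ⟨j, -, m, -, hm⟩
    refine ⟨j, fun h => hm ?_⟩
    rw [(key j).1 h]
    exact dvd_zero _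
  · rintro ⟨j, hj⟩
    have hjL : j < (encSystem T).length := by
      by_contra! hL
      have h₁ : coordSum j pt p = 0 := by
        by_contra h
        have := lt_of_coordSum_ne_zero h
        omega
      have h₂ : coordSum j pt' p' = 0 := by
        by_contra h
        have := lt_of_coordSum_ne_zero h
        omega
      exact hj (h₁.trans h₂.symm)
    refine ⟨j, by omega, ?_⟩
    rw [key, ← Int.natAbs_eq_zero] at hj
    obtain ⟨a₁, -, a₃, a₄⟩ := fracValue_spec j pt p
    obtain ⟨b₁, -, b₃, b₄⟩ := fracValue_spec j pt' p'
    set L := (encSystem T).length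
    have mono : ∀ u ≤ L, (2 : ℤ) ^ u ≤ 2 ^ L := fun u hu =>
      pow_le_pow_right₀ (by norm_num) hu
    have hpos : (0 : ℤ) < 2 ^ L := by positivity
    -- Each cross product is at most `2 ^ (2 * L)` in absolute value, so their difference is below
    -- `2 ^ (2 * L + 2)`.
    obtain ⟨m, hm, hdvd⟩ := exists_not_dvd (n := 2 * L + 2) hj (by
      zify
      rw [show (2 : ℤ) ^ (2 * L + 2) = 2 ^ L * 2 ^ L * 4 by ring]
      calc _ ≤ |(fracValue j pt p).1 * (fracValue j pt' p').2| +
            |(fracValue j pt' p').1 * (fracValue j pt p).2| := abs_sub _ _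
        _ = |(fracValue j pt p).1| * (fracValue j pt' p').2 +
            |(fracValue j pt' p').1| * (fracValue j pt p).2 := by
          rw [abs_mul, abs_mul, abs_of_pos a₁, abs_of_pos b₁]
        _ ≤ 2 ^ L * 2 ^ L + 2 ^ L * 2 ^ L := by
          refine add_le_add (mul_le_mul (a₃.trans (mono _ hp)) (b₄.trans (mono _ hp')) b₁.le
            hpos.le) (mul_le_mul (b₃.trans (mono _ hp')) (a₄.trans (mono _ hp)) a₁.le hpos.le)
        _ < _ := by nlinarith)
    exact ⟨m, by omega, hdvd⟩

theorem noZero_iff (hθ : LinearIndependent ℚ θ) (hC : 4 ≤ C) (pt : ℕ → Bool) :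
    noZero (inputTape C (encSystem T) w) pt = true ↔
      cubePoint _ pt ∉ boolVariety (T.toSet θ) := by
  have hlen := five_mul_le_length (T := T) (w := w) hC
  have key : ∀ n, valueAt T θ n (cubePoint _ pt) = 0 ↔
      ∀ j, (fracValue j pt (T.polys.getD n [])).1 = 0 := by
    intro n
    rw [valueAt, evalAt_polyClass, ← map_zero (Finsupp.linearCombination ℚ θ),
      Function.Injective.eq_iff hθ, Finsupp.ext_iff]
    refine forall_congr' fun j => ?_
    obtain ⟨a₁, a₂, -⟩ := fracValue_spec j pt (T.polys.getD n [])
    rw [coordsSum_apply, ← a₂, Finsupp.zero_apply, div_eq_zero_iff]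
    have : ((fracValue j pt (T.polys.getD n [])).2 : ℚ) ≠ 0 := by exact_mod_cast a₁.ne'
    rw [or_iff_left this, Int.cast_eq_zero]
  have hZ : cubePoint _ pt ∉ boolVariety (T.toSet θ) ↔
      ∃ n < T.polys.length, valueAt T θ n (cubePoint _ pt) ≠ 0 := by
    simp only [boolVariety, Set.mem_ofPred_eq, not_forall, BoolSystem.toSet]
    constructor
    · rintro ⟨_, ⟨p, hp, rfl⟩, h⟩
      obtain ⟨n, hn, rfl⟩ := List.mem_iff_getElem.1 hp
      refine ⟨n, hn, ?_⟩
      rwa [valueAt, List.getD_eq_getElem _ _ hn]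
    · rintro ⟨n, hn, h⟩
      rw [valueAt, List.getD_eq_getElem _ _ hn] at h
      exact ⟨_, ⟨_, List.getElem_mem hn, rfl⟩, h⟩
  rw [hZ, noZero, decide_eq_true_eq]
  simp only [decide_eq_true_eq, nonzeroMod_iff]
  constructor
  · rintro ⟨n, -, j, -, m, -, hm⟩
    have hv : valueAt T θ n (cubePoint _ pt) ≠ 0 := by
      rw [Ne, key]
      intro h
      rw [h j] at hm
      exact hm (dvd_zero _)
    refine ⟨n, ?_, hv⟩
    by_contra! hn
    refine hv ?_
    rw [valueAt, List.getD_eq_default _ _ hn]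
    simp [polyClass, polyValue]
  · rintro ⟨n, hn, h⟩
    rw [Ne, key, not_forall] at h
    obtain ⟨j, hj⟩ := h
    obtain ⟨a₁, a₂, a₃, -⟩ := fracValue_spec j pt (T.polys.getD n [])
    have hp := length_encPoly_getD_le (T := T) n
    have hK : T.polys.length ≤ (encSystem T).length := by
      have : ∀ l : List (List (BoolTerm T.numVars)),
          l.length ≤ (l.flatMap fun p => encPoly p ++ [SysSym.endPoly]).length := by
        intro l
        induction l with
        | nil => simp
        | cons p l ih => simp at ih ⊢; omega
      rw [encSystem, List.length_append]
      exact (this _).trans (Nat.le_add_left _ _)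
    have hc : coordSum j pt (T.polys.getD n []) ≠ 0 := by
      rw [← a₂]
      exact div_ne_zero (by exact_mod_cast hj) (by exact_mod_cast a₁.ne')
    have := lt_of_coordSum_ne_zero hc
    refine ⟨n, by omega, j, by omega, ?_⟩
    obtain ⟨m, hm, hdvd⟩ := exists_not_dvd (n := (encSystem T).length + 1)
      (Int.natAbs_ne_zero.2 hj) (by
        zify
        refine lt_of_le_of_lt a₃ (pow_lt_pow_right₀ (by norm_num) (by omega)))
    exact ⟨m, by omega, hdvd⟩

end Compare

end HeadProg

namespace HeadProg

/-! ### Permutations of variables -/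

variable {N : ℕ}

theorem permute_mk (σ : Equiv.Perm (Fin N)) (f : MvPolynomial (Fin N) ℂ) :
    permute σ (Ideal.Quotient.mk _ f) = Ideal.Quotient.mk _ (MvPolynomial.rename σ f) :=
  rfl

theorem permute_one (f : BoolVarRing N) : permute 1 f = f := by
  obtain ⟨f, rfl⟩ := Ideal.Quotient.mk_surjective f
  rw [permute_mk, Equiv.Perm.coe_one, MvPolynomial.rename_id_apply]

theorem permute_mul (σ τ : Equiv.Perm (Fin N)) (f : BoolVarRing N) :
    permute (σ * τ) f = permute σ (permute τ f) := by
  obtain ⟨f, rfl⟩ := Ideal.Quotient.mk_surjective f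
  rw [permute_mk, permute_mk, permute_mk, MvPolynomial.rename_rename, Equiv.Perm.coe_mul]

theorem permute_injective (σ : Equiv.Perm (Fin N)) : Function.Injective (permute σ) :=
  Function.LeftInverse.injective (g := permute σ⁻¹) fun f => by
    rw [← permute_mul, inv_mul_cancel, permute_one]

theorem evalAt_permute (σ : Equiv.Perm (Fin N)) (a : Fin N → Bool) (f : BoolVarRing N) :
    evalAt a (permute σ f) = evalAt (a ∘ σ) f := by
  obtain ⟨f, rfl⟩ := Ideal.Quotient.mk_surjective f
  rw [permute_mk, evalAt_mk, evalAt_mk, MvPolynomial.eval_rename]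
  rfl

/-- The stabilizer as a subgroup. -/
def stabSubgroup (F : Set (BoolVarRing N)) : Subgroup (Equiv.Perm (Fin N)) where
  carrier := stab F
  one_mem' := by simp [stab, permute_one]
  mul_mem' {σ τ} (hσ : _ = F) (hτ : _ = F) := by
    change (fun f => permute (σ * τ) f) '' F = F
    conv_rhs => rw [← hσ, ← hτ]
    rw [Set.image_image]
    simp only [permute_mul]
  inv_mem' {σ} (hσ : _ = F) := by
    change (fun f => permute σ⁻¹ f) '' F = F
    conv_lhs => rw [← hσ]
    rw [Set.image_image]
    simp [← permute_mul, permute_one]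

/-- Since `permute σ` is injective and `F` is finite, an image contained in `F` is equal to `F`. -/
theorem notMem_stab_iff {F : Set (BoolVarRing N)} (hF : F.Finite) (σ : Equiv.Perm (Fin N)) :
    σ ∉ stab F ↔ ∃ f ∈ F, permute σ f ∉ F := by
  rw [← not_iff_not]
  push Not
  constructor
  · intro (h : _ = F) f hf
    rw [← h]
    exact ⟨f, hf, rfl⟩
  · intro h
    exact hF.eq_of_subset_of_encard_le' (Set.image_subset_iff.2 h)
      ((permute_injective σ).encard_image F).ge

/-- Transpositions generate the symmetric group, so quadratically many tests replace `N!` of them.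
-/
theorem stab_eq_univ_iff (F : Set (BoolVarRing N)) :
    stab F = Set.univ ↔ ∀ x y : Fin N, Equiv.swap x y ∈ stab F := by
  refine ⟨fun h x y => h ▸ Set.mem_univ _, fun h => ?_⟩
  have : stabSubgroup F = ⊤ := by
    rw [eq_top_iff, ← Equiv.Perm.closure_isSwap, Subgroup.closure_le]
    rintro _ ⟨x, y, -, rfl⟩
    exact h x y
  rw [← Subgroup.coe_top, ← this]
  rfl

/-- If a set of permutations is not the stabilizer, then it has many elements. -/
theorem card_compl_stab_lt {F : Set (BoolVarRing N)} (h : stab F ≠ Set.univ) {c : ℕ}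
    (hN : 2 * c + 1 ≤ N) : c < ((stab F)ᶜ).ncard := by
  obtain ⟨τ, hτ⟩ := (Set.ne_univ_iff_exists_notMem _).1 h
  -- Left multiplication by an element outside the subgroup maps it into its complement. So the
  -- complement is at least half of `N!`, and `N!` is at least `N`, hence at least `2 * c + 1`.
  have h₁ : (stab F).ncard ≤ ((stab F)ᶜ).ncard := by
    refine Set.ncard_le_ncard_of_injOn (τ * ·) ?_ (mul_right_injective τ).injOn
    intro σ hσ hmem
    exact hτ (((stabSubgroup F).mul_mem_cancel_right (x := σ) (y := τ) hσ).1 hmem)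
  have h₂ := Set.ncard_add_ncard_compl (stab F)
  rw [Nat.card_eq_fintype_card, Fintype.card_perm, Fintype.card_fin] at h₂
  have := Nat.self_le_factorial N
  omega

/-- For a large number of variables, only the trivial case remains. -/
theorem large_iff {F : Set (BoolVarRing N)} {c : ℕ} (hN : 2 * c + 1 ≤ N) :
    ((stab F)ᶜ.ncard ≤ c ∧ (boolVariety F).Nonempty) ↔
      (∀ x y : Fin N, Equiv.swap x y ∈ stab F) ∧
        ∃ r ≤ N, cubePoint N (fun i => decide (i < r)) ∈ boolVariety F := by
  rw [← stab_eq_univ_iff]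
  have h₁ : (stab F)ᶜ.ncard ≤ c ↔ stab F = Set.univ :=
    ⟨fun h => by_contra fun hs => (card_compl_stab_lt hs hN).not_ge h, fun h => by simp [h]⟩
  rw [h₁]
  refine and_congr_right fun hs => ⟨?_, fun ⟨r, _, h⟩ => ⟨_, h⟩⟩
  rintro ⟨a, ha⟩
  -- With `r` the number of ones of `a`, a bijection from the first `r` places to the ones of `a`
  -- extends to a permutation.
  obtain ⟨r, hr, σ, hσ⟩ : ∃ r ≤ N, ∃ σ : Equiv.Perm (Fin N),
      cubePoint N (fun i => decide (i < r)) = a ∘ σ := by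
    have hr : Fintype.card {i // a i = true} ≤ N := by
      simpa using Fintype.card_subtype_le fun i => a i = true
    let e : {i : Fin N // (i : ℕ) < Fintype.card {i // a i = true}} ≃ {i // a i = true} :=
      Fintype.equivOfCardEq (Fintype.card_fin_lt_of_le hr)
    refine ⟨_, hr, e.extendSubtype, ?_⟩
    funext i
    by_cases hi : (i : ℕ) < Fintype.card {i // a i = true}
    · simpa [cubePoint, hi] using (e.extendSubtype_mem i hi).symm
    · have := e.extendSubtype_not_mem i hi
      rw [Bool.not_eq_true] at this
      simp [cubePoint, hi, this]
  refine ⟨r, hr, fun f hf => ?_⟩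
  -- The value of `f` at `a ∘ σ` is that of the permuted polynomial at `a`, and the permuted
  -- polynomial is again in `F`.
  rw [hσ, ← evalAt_permute]
  refine ha _ ?_
  have : σ ∈ stab F := hs ▸ Set.mem_univ _
  have : _ = F := this
  rw [← this]
  exact ⟨f, hf, rfl⟩

/-! ### Testing equality of polynomials at the indicators of their monomials -/

/-- The square-free monomial with the given variables. -/
noncomputable def monom (u : Finset (Fin N)) : BoolVarRing N :=
  Ideal.Quotient.mk _ (∏ i ∈ u, MvPolynomial.X i)

/-- The indicator of a set. -/
def indicator (u : Finset (Fin N)) : Fin N → Bool := fun i => decide (i ∈ u)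

theorem evalAt_monom (u v : Finset (Fin N)) :
    evalAt (indicator v) (monom u) = if u ⊆ v then 1 else 0 := by
  rw [monom, evalAt_mk, map_prod]
  simp only [MvPolynomial.eval_X, boolPoint, indicator, decide_eq_true_eq]
  rw [Finset.prod_ite_zero]
  simp [Finset.subset_iff]

theorem permute_monom (σ : Equiv.Perm (Fin N)) (u : Finset (Fin N)) :
    permute σ (monom u) = monom (u.map σ.toEmbedding) := by
  rw [monom, permute_mk, map_prod, monom, Finset.prod_map]
  simp

theorem evalAt_smul (a : Fin N → Bool) (c : ℂ) (f : BoolVarRing N) :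
    evalAt a (c • f) = c * evalAt a f := by
  obtain ⟨f, rfl⟩ := Ideal.Quotient.mk_surjective f
  rw [← Ideal.Quotient.mkₐ_eq_mk ℂ, ← map_smul, Ideal.Quotient.mkₐ_eq_mk, evalAt_mk, evalAt_mk,
    MvPolynomial.smul_eval]

/-- A combination of monomials that vanishes at the indicators of these is zero. -/
theorem eq_zero_of_evalAt_eq_zero (U : Finset (Finset (Fin N))) {g : BoolVarRing N}
    (hg : g ∈ Submodule.span ℂ (monom '' (U : Set (Finset (Fin N)))))
    (h : ∀ u ∈ U, evalAt (indicator u) g = 0) : g = 0 := by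
  obtain ⟨c, rfl⟩ := (Submodule.mem_span_image_finset_iff_exists_fun' ℂ).1 hg
  -- At the indicator of `u` only the coefficients of subsets of `u` contribute; those of proper
  -- subsets vanish by induction, which leaves `c u`.
  have hc : ∀ u ∈ U, c u = 0 := by
    intro u
    induction u using Finset.strongInduction with
    | H u ih =>
      intro hu
      have := h u hu
      rw [map_sum, Finset.sum_eq_single u] at this
      · simpa [evalAt_smul, evalAt_monom] using this
      · intro v hv hvu
        rw [evalAt_smul, evalAt_monom]
        split_ifs with hs
        · rw [ih v (lt_of_le_of_ne hs hvu) hv, zero_mul]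
        · rw [mul_zero]
      · exact fun hu' => absurd hu hu'
  exact Finset.sum_eq_zero fun u hu => by rw [hc u hu, zero_smul]

theorem polyClass_mem_span (θ : ℕ → ℂ) (p : List (BoolTerm N)) (U : Set (Finset (Fin N)))
    (hU : ∀ t ∈ p, t.vars ∈ U) : polyClass θ p ∈ Submodule.span ℂ (monom '' U) := by
  rw [polyClass, polyValue, map_list_sum, List.map_map]
  refine list_sum_mem ?_
  intro f hf
  obtain ⟨t, ht, rfl⟩ := List.mem_map.1 hf
  have : (Ideal.Quotient.mk (boolIdeal N) ∘ fun t : BoolTerm N =>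
      MvPolynomial.C (coeffValue θ t.coords) * ∏ i ∈ t.vars, MvPolynomial.X i) t =
      coeffValue θ t.coords • monom t.vars := by
    rw [Function.comp, ← MvPolynomial.smul_eq_C_mul, ← Ideal.Quotient.mkₐ_eq_mk ℂ, map_smul]
    rfl
  rw [this]
  exact Submodule.smul_mem _ _ (Submodule.subset_span ⟨_, hU t ht, rfl⟩)

theorem permute_mem_span (σ : Equiv.Perm (Fin N)) {g : BoolVarRing N} {U : Set (Finset (Fin N))}
    (hg : g ∈ Submodule.span ℂ (monom '' U)) :
    permute σ g ∈ Submodule.span ℂ (monom '' ((fun u => u.map σ.toEmbedding) '' U)) := by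
  induction hg using Submodule.span_induction with
  | mem f hf =>
    obtain ⟨u, hu, rfl⟩ := hf
    rw [permute_monom]
    exact Submodule.subset_span ⟨_, ⟨u, hu, rfl⟩, rfl⟩
  | zero => rw [map_zero]; exact Submodule.zero_mem _
  | add f g _ _ hf hg => rw [map_add]; exact Submodule.add_mem _ hf hg
  | smul c f _ hf =>
    have : permute σ (c • f) = c • permute σ f := by
      obtain ⟨f, rfl⟩ := Ideal.Quotient.mk_surjective f
      rw [← Ideal.Quotient.mkₐ_eq_mk ℂ, ← map_smul, Ideal.Quotient.mkₐ_eq_mk, permute_mk, permute_mk,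
        map_smul, ← Ideal.Quotient.mkₐ_eq_mk ℂ, map_smul]
    rw [this]
    exact Submodule.smul_mem _ _ hf

/-- Equality after a permutation can be tested at the indicators of the monomials that occur. -/
theorem permute_polyClass_eq_iff (θ : ℕ → ℂ) (σ : Equiv.Perm (Fin N)) (p p' : List (BoolTerm N)) :
    permute σ (polyClass θ p) = polyClass θ p' ↔
      (∀ t ∈ p, evalAt (indicator t.vars) (polyClass θ p) =
        evalAt (indicator t.vars ∘ σ.symm) (polyClass θ p')) ∧
      ∀ t ∈ p', evalAt (indicator t.vars ∘ σ) (polyClass θ p) =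
        evalAt (indicator t.vars) (polyClass θ p') := by
  have hcomp : ∀ a : Fin N → Bool, (a ∘ σ.symm) ∘ σ = a := fun a => by
    funext i; simp
  constructor
  · intro h
    rw [← h]
    simp only [evalAt_permute, hcomp, implies_true, and_self]
  · rintro ⟨h₁, h₂⟩
    -- The monomials of the difference: those of `p`, permuted, and those of `p'`.
    let U : Finset (Finset (Fin N)) :=
      ((p.map BoolTerm.vars).toFinset.image fun u => u.map σ.toEmbedding) ∪
        (p'.map BoolTerm.vars).toFinset
    rw [← sub_eq_zero]
    refine eq_zero_of_evalAt_eq_zero U (Submodule.sub_mem _ ?_ ?_) ?_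
    · refine Submodule.span_mono ?_ (permute_mem_span σ (polyClass_mem_span θ p
        ((p.map BoolTerm.vars).toFinset : Set (Finset (Fin N))) ?_))
      · refine Set.image_mono ?_
        simp [U]
      · intro t ht
        simpa using ⟨t, ht, rfl⟩
    · refine polyClass_mem_span θ p' _ fun t ht => ?_
      simp only [U, Finset.coe_union, Set.mem_union]
      right
      simpa using ⟨t, ht, rfl⟩
    · intro u hu
      rw [map_sub, sub_eq_zero, evalAt_permute]
      rcases Finset.mem_union.1 hu with hu | hu
      · obtain ⟨_, hv, rfl⟩ := Finset.mem_image.1 hu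
        obtain ⟨t, ht, rfl⟩ := List.mem_map.1 (List.mem_toFinset.1 hv)
        -- At the indicator of a permuted monomial the permutation cancels, so the unpermuted `p` is
        -- evaluated at its own monomial.
        have e : indicator (t.vars.map σ.toEmbedding) = indicator t.vars ∘ σ.symm := by
          funext i
          simp [indicator]
        rw [e, hcomp]
        exact h₁ t ht
      · obtain ⟨t, ht, rfl⟩ := List.mem_map.1 (List.mem_toFinset.1 hu)
        exact h₂ t ht

end HeadProg

namespace HeadProg

open Dat (enc)

/-! ### Correctness of the decision procedure -/

section Decide

variable {T : BoolSystem} {C : ℕ} {w : List Bool} {θ : ℕ → ℂ}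

theorem cellCount_inputTape (l : List SysSym) (s : SysSym) :
    cellCount (inputTape C l w) s = l.countP fun x => decide (x = s) := by
  rw [cellCount, inputTape_eq, List.countP_append, List.countP_append, List.countP_map]
  have h₁ : (List.map (fun b => (some (Sum.inr b) : Cell)) w).countP
      (fun x => decide (x = cell s)) = 0 := by simp [cell]
  have h₂ : (List.replicate (C * (l.length + w.length + 1)) (none : Cell)).countP
      (fun x => decide (x = cell s)) = 0 := by simp [cell]
  rw [h₁, h₂]
  simp [Function.comp_def, cell]

theorem cellCount_var : cellCount (inputTape C (encSystem T) w) .var = T.numVars := by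
  rw [cellCount_inputTape, encSystem, List.countP_append]
  have h : (T.polys.flatMap fun p => encPoly p ++ [SysSym.endPoly]).countP
      (fun x => decide (x = .var)) = 0 := by
    simp only [List.countP_eq_zero, decide_eq_true_eq]
    rintro x hx rfl
    obtain ⟨p, -, hp⟩ := List.mem_flatMap.1 hx
    rcases List.mem_append.1 hp with hp | hp
    · exact not_mem_encPoly (by simp) (by simp) (by simp) (by simp) (by simp) (by simp) p hp
    · simp at hp
  rw [h]
  simp [List.countP_replicate]

theorem cellCount_endPoly :
    cellCount (inputTape C (encSystem T) w) .endPoly = T.polys.length := by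
  rw [cellCount_inputTape, encSystem, List.countP_append]
  have h : ∀ l : List (List (BoolTerm T.numVars)),
      (l.flatMap fun p => encPoly p ++ [SysSym.endPoly]).countP
        (fun x => decide (x = .endPoly)) = l.length := by
    intro l
    induction l with
    | nil => rfl
    | cons p l ih =>
      have hp : (encPoly p).countP (fun x => decide (x = .endPoly)) = 0 := by
        simp only [List.countP_eq_zero, decide_eq_true_eq]
        rintro x hx rfl
        exact not_mem_encPoly (by simp) (by simp) (by simp) (by simp) (by simp) (by simp) p hx
      rw [List.flatMap_cons, List.countP_append, List.countP_append, ih, hp]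
      simp [add_comm]
  rw [h]
  simp [List.countP_replicate]

theorem finite_toSet : (T.toSet θ).Finite := by
  refine (T.polys.map fun p => polyClass θ p).finite_toSet.subset ?_
  rintro _ ⟨p, hp, rfl⟩
  exact List.mem_map_of_mem (f := fun p => polyClass θ p) hp

/-- A monomial is encoded as its 0/1 vector, so the required test points already stand on the tape
and need not be constructed. -/
theorem exists_bitsAt (hC : 4 ≤ C) {p : List (BoolTerm T.numVars)} (hp : p ∈ T.polys)
    {t : BoolTerm T.numVars} (ht : t ∈ p) :
    ∃ q < (inputTape C (encSystem T) w).length,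
      cubePoint T.numVars (bitsAt (inputTape C (encSystem T) w) q) = indicator t.vars := by
  obtain ⟨A, B, h⟩ := ((vars_infix t).trans (encTerm_infix ht)).trans (encPoly_infix hp)
  have hlen := five_mul_le_length (T := T) (w := w) hC
  have hA : A.length ≤ (encSystem T).length := by
    rw [← h, List.append_assoc, List.length_append]
    exact Nat.le_add_right _ _
  have hget : ∀ i : Fin T.numVars, (inputTape C (encSystem T) w)[A.length + i]? =
      some (cell (.bit (decide (i ∈ t.vars)))) := by
    intro i
    rw [inputTape_eq, ← h, List.append_assoc, List.map_append, List.append_assoc,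
      List.getElem?_append_right (by simp), List.map_append, List.append_assoc,
      List.getElem?_append_left (by simp)]
    simp
  refine ⟨A.length, by omega, funext fun i => ?_⟩
  have hi := (List.getElem?_eq_some_iff.1 (hget i)).1
  rw [cubePoint, bitsAt, min_eq_left hi.le, hget]
  simp [indicator, cell]

/-- All tape positions are tried as beginnings of test points. Most of them do not begin a monomial,
which does no harm: equal polynomials agree at every point, while the positions of the monomials
suffice to detect a difference. -/
theorem moved_iff (hθ : LinearIndependent ℚ θ) (hC : 4 ≤ C) (σ : Equiv.Perm (Fin T.numVars))
    {s s' : ℕ → ℕ} (hs : ∀ i : Fin T.numVars, s i = σ i)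
    (hs' : ∀ i : Fin T.numVars, s' i = σ.symm i) :
    moved (inputTape C (encSystem T) w) s s' = true ↔ σ ∉ stab (T.toSet θ) := by
  set t := inputTape C (encSystem T) w with ht
  have h₁ : ∀ q, cubePoint T.numVars (fun i => bitsAt t q (s i)) =
      cubePoint T.numVars (bitsAt t q) ∘ σ := fun q => by
    funext i
    simp [cubePoint, hs]
  have h₂ : ∀ q, cubePoint T.numVars (fun i => bitsAt t q (s' i)) =
      cubePoint T.numVars (bitsAt t q) ∘ σ.symm := fun q => by
    funext i
    simp [cubePoint, hs']
  have key : ∀ n < T.polys.length, ∀ n' < T.polys.length,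
      ((∃ q < t.length, movedAt t s s' n n' q = true) ↔
        permute σ (polyClass θ (T.polys.getD n [])) ≠ polyClass θ (T.polys.getD n' [])) := by
    intro n hn n' hn'
    simp only [movedAt, Bool.or_eq_true, ht, differ_iff hθ hC]
    simp only [← ht, h₁, h₂, valueAt]
    rw [← not_iff_not, not_not]
    push Not
    have hcomp : ∀ a : Fin T.numVars → Bool, (a ∘ σ.symm) ∘ σ = a := fun a => by
      funext i; simp
    constructor
    · intro h
      rw [permute_polyClass_eq_iff]
      constructor
      · intro u hu
        obtain ⟨q, hq, e⟩ := exists_bitsAt hC (w := w) (p := T.polys.getD n [])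
          (by rw [List.getD_eq_getElem _ _ hn]; exact List.getElem_mem hn) hu
        rw [← e]
        exact (h q hq).2
      · intro u hu
        obtain ⟨q, hq, e⟩ := exists_bitsAt hC (w := w) (p := T.polys.getD n' [])
          (by rw [List.getD_eq_getElem _ _ hn']; exact List.getElem_mem hn') hu
        rw [← e]
        exact (h q hq).1
    · intro h q _
      rw [← h]
      simp only [evalAt_permute, hcomp, and_self]
  rw [notMem_stab_iff finite_toSet, moved, ht, cellCount_endPoly, ← ht, decide_eq_true_eq]
  simp only [decide_eq_true_eq]
  constructor
  · rintro ⟨n, hn, h⟩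
    refine ⟨polyClass θ (T.polys.getD n []), ⟨_, ?_, rfl⟩, ?_⟩
    · rw [List.getD_eq_getElem _ _ hn]
      exact List.getElem_mem hn
    · rintro ⟨p, hp, e⟩
      obtain ⟨n', hn', rfl⟩ := List.mem_iff_getElem.1 hp
      refine (key n hn n' hn').1 (h n' hn') ?_
      rw [e, List.getD_eq_getElem _ _ hn']
      rfl
  · rintro ⟨_, ⟨p, hp, rfl⟩, h⟩
    obtain ⟨n, hn, rfl⟩ := List.mem_iff_getElem.1 hp
    refine ⟨n, hn, fun n' hn' => (key n hn n' hn').2 fun e => h ⟨_, List.getElem_mem hn', ?_⟩⟩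
    rw [List.getD_eq_getElem _ _ hn, List.getD_eq_getElem _ _ hn'] at e
    exact e

theorem decideLarge_iff (hθ : LinearIndependent ℚ θ) (hC : 4 ≤ C) :
    decideLarge (inputTape C (encSystem T) w) = false ↔
      (∀ x y : Fin T.numVars, Equiv.swap x y ∈ stab (T.toSet θ)) ∧
        ∃ r ≤ T.numVars, cubePoint T.numVars (fun i => decide (i < r)) ∈
          boolVariety (T.toSet θ) := by
  have hswap : ∀ x y : Fin T.numVars, moved (inputTape C (encSystem T) w) (swapNat x y)
      (swapNat x y) = true ↔ Equiv.swap x y ∉ stab (T.toSet θ) := by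
    intro x y
    have : ∀ i : Fin T.numVars, swapNat x y i = Equiv.swap x y i := by
      intro i
      simp only [swapNat, Equiv.swap_apply_def, decide_eq_true_eq, Fin.val_inj]
      split_ifs <;> rfl
    exact moved_iff hθ hC _ this this
  have hN : T.numVars < (inputTape C (encSystem T) w).length := by
    have := five_mul_le_length (T := T) (w := w) hC
    have h : T.numVars ≤ (encSystem T).length := by simp [encSystem]
    omega
  rw [decideLarge, Bool.or_eq_false_iff, decide_eq_false_iff_not, decide_eq_false_iff_not,
    cellCount_var]
  refine and_congr ?_ ?_
  · simp only [decide_eq_true_eq]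
    push Not
    constructor
    · intro h x y
      have := h x x.2 y y.2
      rwa [Ne, hswap, not_not] at this
    · intro h x hx y hy
      rw [Ne, hswap ⟨x, hx⟩ ⟨y, hy⟩, not_not]
      exact h _ _
  · push Not
    constructor
    · rintro ⟨r, -, h⟩
      rw [Ne, noZero_iff hθ hC, not_not] at h
      -- For `r` beyond the number of variables the point is again that of all ones.
      refine ⟨min r T.numVars, min_le_right _ _, ?_⟩
      convert h using 1
      funext i
      simp [cubePoint]
    · rintro ⟨r, hr, h⟩
      refine ⟨r, by omega, ?_⟩
      rwa [Ne, noZero_iff hθ hC, not_not]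

theorem extend_apply {R : Type} {n : ℕ} (d : R) (f : Fin n → R) (i : Fin n) :
    extend d f i = f i := by
  simp [extend]

theorem decideSmall_iff (hθ : LinearIndependent ℚ θ) (hC : 4 ≤ C) (c : ℕ) :
    decideSmall c T.numVars (inputTape C (encSystem T) w) = false ↔
      (stab (T.toSet θ))ᶜ.ncard ≤ c ∧ (boolVariety (T.toSet θ)).Nonempty := by
  have hm : ∀ σ : Equiv.Perm (Fin T.numVars), moved (inputTape C (encSystem T) w)
      (extend 0 fun i => (σ i : ℕ)) (extend 0 fun i => (σ⁻¹ i : ℕ)) = true ↔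
        σ ∈ (stab (T.toSet θ))ᶜ := fun σ =>
    moved_iff hθ hC σ (fun i => extend_apply 0 (fun i => (σ i : ℕ)) i)
      fun i => extend_apply 0 (fun i => (σ⁻¹ i : ℕ)) i
  have hz : ∀ x : Fin T.numVars → Bool, noZero (inputTape C (encSystem T) w) (extend false x) =
      true ↔ x ∉ boolVariety (T.toSet θ) := by
    intro x
    rw [noZero_iff hθ hC]
    have : cubePoint T.numVars (extend false x) = x := funext fun i => extend_apply _ _ i
    rw [this]
  rw [decideSmall, Bool.or_eq_false_iff]
  refine and_congr ?_ ?_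
  · rw [← Bool.not_eq_true, not_iff_comm, not_le, List.any_eq_true]
    simp only [List.all_eq_true, Finset.mem_toList, Finset.mem_powersetCard, Finset.subset_univ,
      true_and, hm]
    constructor
    · intro h
      obtain ⟨s, hs, hcard⟩ := Set.exists_subset_card_eq (Nat.succ_le_of_lt h)
      refine ⟨s.toFinite.toFinset, ?_, fun σ hσ => hs (by simpa using hσ)⟩
      rw [← Set.ncard_eq_toFinset_card, hcard]
    · rintro ⟨s, hcard, h⟩
      have := Set.ncard_le_ncard (s := (s : Set (Equiv.Perm (Fin T.numVars)))) h (Set.toFinite _)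
      rw [Set.ncard_coe_finset] at this
      omega
  · rw [← Bool.not_eq_true, List.all_eq_true]
    simp only [Finset.mem_toList, Finset.mem_univ, true_imp_iff, hz]
    push Not
    rfl

/-- The threshold `2 * c + 1` is that of `large_iff`; each smaller number of variables has its own
hard-wired procedure. -/
theorem decideTape_iff (hθ : LinearIndependent ℚ θ) (hC : 4 ≤ C) (c : ℕ) :
    decideTape c (2 * c + 1) (inputTape C (encSystem T) w) = false ↔
      (stab (T.toSet θ))ᶜ.ncard ≤ c ∧ (boolVariety (T.toSet θ)).Nonempty := by
  rw [decideTape, cellCount_var]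
  split_ifs with h
  · rw [decide_eq_true_eq] at h
    rw [decideLarge_iff hθ hC, large_iff h]
  · rw [decide_eq_true_eq, not_le] at h
    rw [← decideSmall_iff hθ hC c (w := w), List.any_eq_false]
    constructor
    · intro hf
      simpa using hf T.numVars (List.mem_range.2 h)
    · intro hf k _ hk
      rw [Bool.and_eq_true, decide_eq_true_eq] at hk
      rw [← hk.1, hf] at hk
      exact absurd hk.2 (by simp)

end Decide

open scoped Classical in
/-- The problem, hence its complement, is decided in polynomial time: a verifier may ignore the
certificate. If the number of variables is large, then the stabilizer has to be the full symmetric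
group, and it suffices to look at one zero for each number of ones. -/
theorem nonempty_tm2ComputableInPolyTime_decide {θ : ℕ → ℂ} (hθ : LinearIndependent ℚ θ) (c : ℕ) :
    Nonempty (Turing.TM2ComputableInPolyTime
      (Computability.encodingProd systemEncoding (Computability.encodingList Bool)).encode
      Computability.encodingBoolBool.encode fun x : BoolSystem × List Bool =>
        decide (¬ ((stab (x.1.toSet θ))ᶜ.ncard ≤ c ∧ (boolVariety (x.1.toSet θ)).Nonempty))) := by
  -- There is no argument besides the tape, so the program runs with `b = 0` and leaves its answer
  -- in register `0`, where the machine looks for it.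
  obtain ⟨P, q, C, h⟩ := PolyComp.decideTape (α := Unit) c (2 * c + 1)
  have : Inhabited (SysSym ⊕ Bool) := ⟨Sum.inr false⟩
  -- The padding constant `4` makes room for the moduli, and `C` for the numerals of the program.
  refine nonempty_tm2ComputableInPolyTime _ _ (max 4 C) (P [] 0) q fun ⟨T, w⟩ => ?_
  have htape : pad (max 4 C) ((Computability.encodingProd systemEncoding
      (Computability.encodingList Bool)).encode (T, w)) =
      inputTape (max 4 C) (encSystem T) w := rfl
  rw [htape]
  obtain ⟨t, ht, hr⟩ := h (inputTape (max 4 C) (encSystem T) w) () [] 0 (fun _ => 0) (by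
    rw [length_inputTape]
    have := Nat.mul_le_mul (le_max_right 4 C) (Nat.le_add_left 1 ((encSystem T).length + w.length))
    omega) (fun _ => Nat.zero_le _) (fun _ _ => rfl) (by simp) rfl
  refine ⟨t, ht, _, hr, ?_⟩
  rw [decide_eq_decide, ← decideTape_iff hθ (le_max_left 4 C) c (w := w)]
  cases h : decideTape c (2 * c + 1) (inputTape (max 4 C) (encSystem T) w) <;> simp [put, enc, h]

end HeadProg

theorem mainTheorem1 (θ : ℕ → ℂ) (hθ : LinearIndependent ℚ θ) (c₀ : ℕ) :
    InCoNP systemEncoding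
      {S : BoolSystem | (stab (S.toSet θ))ᶜ.ncard ≤ c₀ ∧ (boolVariety (S.toSet θ)).Nonempty} := by
  classical
  -- The bound `0` on certificates admits only the empty one.
  refine ⟨0, _, HeadProg.nonempty_tm2ComputableInPolyTime_decide hθ c₀, fun T => ?_⟩
  constructor
  · intro h
    exact ⟨[], Nat.zero_le _, decide_eq_true h⟩
  · rintro ⟨w, -, h⟩
    exact of_decide_eq_true h
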